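/- **Proposition 1.1.** Let $Z$ be a closed oriented smooth manifold of dimension $n$ with a Riemannian metric, let $G$ be a compact Lie group acting smoothly on $Z$, and suppose that $TZ$ has a $G$-equivariant $\mathrm{Spin}^c$ structure: a principal $\mathrm{Spin}^c_n$-bundle $P\to Z$ with an equivariant bundle map (along $\mathrm{Spin}^c_n\to SO(n)$) to the bundle of oriented orthonormal frames of $TZ$, and a continuous action of $G$ on $P$ by principal bundle automorphisms covering the action of $G$ on frames by differentials. (If $n=0$, no compatibility of the frames with the orientation signs is required.) Then for every $g\in G$ the fixed-point set $Z^g$ is a submanifold of $Z$ with $T_zZ^g=\ker(dg_z-1)$, and $Z^g$ is naturally oriented in the following sense. Let $N$ be the normal bundle of $Z^g$, identified with the orthogonal complement of $TZ^g$ in $TZ|_{Z^g}$. Let $C(T_zZ)$ be the complex Clifford algebra with $c(v)c(w)+c(w)c(v)=-2\langle v,w\rangle$, and let $\sigma:C(T_zZ)\to\Lambda(T_zZ)\otimes\mathbb C$ be the linear isomorphism under which $c(v)$ becomes $v\wedge\cdot-\iota_v$. For $z\in Z^g$, $p\in P_z$ and $gp=p\cdot s$ with $s\in\mathrm{Spin}^c_n$,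 the element of $C(T_zZ)$ corresponding to $s$ in the frame given by $p$ does not depend on $p$; it is the action of $g$ on the spinors at $z$ and is again denoted by $g$. Call $\alpha\in\mathbb C$, $|\alpha|=1$, a *phase* of $g$ at $z$ if there is an orthonormal basis $e_1,\dots,e_{2k}$ of $N_z$ in which $dg|_{N_z}$ consists of diagonal blocks $\begin{pmatrix}\cos\theta_j&-\sin\theta_j\\ \sin\theta_j&\cos\theta_j\end{pmatrix}$, $0<\theta_j\le\pi$, $1\le j\le k$, and $$g=\alpha\prod_{j=1}^k\bigl(\cos(\theta_j/2)+\sin(\theta_j/2)\,c(e_{2j-1})c(e_{2j})\bigr)\quad\text{in } C(T_zZ).$$ 1. If $\alpha$ is a phase at $z$, the phases at $z$ are exactly $\alpha$ and, if $-1$ is an eigenvalue of $dg_z$, also $-\alpha$. 2. There is exactly one locally constant function $\alpha$ on $Z^g$ such that $\alpha(z)$ is a phase at every $z$ and $\arg\alpha(z)\in[0,\pi)$ at every $z$ where $-1$ is an eigenvalue of $dg_z$. 3. Let $\alpha$ be any locally constant function on $Z^g$ such that $\alpha(z)$ is a phase at every $z$. Then the top-degree part $\alpha^{-1}[\sigma(g)]_{\operatorname{rk}N}$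 is at every point a non-zero real multiple of $f_1\wedge\dots\wedge f_{\operatorname{rk} N}$ for every basis $(f_i)$ of $N_z$, so it orients $N$; and there is exactly one continuous orientation of $Z^g$ such that $TZ|_{Z^g}=TZ^g\oplus N$ as oriented vector bundles. In particular, the function $\alpha$ of part 2 gives a canonical orientation of $Z^g$. -/

import Mathlib

open scoped Manifold ContDiff TensorProduct Topology

universe u v w

noncomputable section

namespace SpincFixed

/-! ### Complex Clifford algebras and the group `Spin^c(n)` -/

section Clifford

variable {V W : Type*} [AddCommGroup V] [Module ℝ V] [AddCommGroup W] [Module ℝ W]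

/-- The quadratic form `v ↦ -⟨v, v⟩` of a bilinear form; with it, the relation of the Clifford
algebra is `c(v) c(w) + c(w) c(v) = -2 ⟨v, w⟩`. -/
def negForm (B : V →ₗ[ℝ] V →ₗ[ℝ] ℝ) : QuadraticForm ℝ V :=
  -(LinearMap.BilinMap.toQuadraticMap B)

/-- The complex Clifford algebra `C(V) = ℂ ⊗ Cl(V)`. -/
abbrev CliffC (Q : QuadraticForm ℝ V) : Type _ := ℂ ⊗[ℝ] CliffordAlgebra Q

/-- The complex exterior algebra `Λ(V) ⊗ ℂ`. -/
abbrev ExtC (V : Type*) [AddCommGroup V] [Module ℝ V] : Type _ := ℂ ⊗[ℝ] ExteriorAlgebra ℝ V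

/-- Clifford multiplication `c : V → C(V)`. -/
def cliff (Q : QuadraticForm ℝ V) (v : V) : CliffC Q := 1 ⊗ₜ CliffordAlgebra.ι Q v

/-- The homomorphism `C(V) → C(W)` induced by an isometry `V → W`. -/
def cliffMap {Q : QuadraticForm ℝ V} {Q' : QuadraticForm ℝ W} (f : Q →qᵢ Q') :
    CliffC Q →ₐ[ℂ] CliffC Q' :=
  Algebra.TensorProduct.map (AlgHom.id ℂ ℂ) (CliffordAlgebra.map f)

/-- The degree-`r` part `[σ(a)]_r` of the symbol of `a ∈ C(V)`, where `σ : C(V) ≃ Λ(V) ⊗ ℂ` is the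
linear isomorphism under which Clifford multiplication by `v` becomes exterior multiplication minus
interior multiplication by `v`. -/
def symbolPart (Q : QuadraticForm ℝ V) (r : ℕ) : CliffC Q →ₗ[ℂ] ExtC V :=
  LinearMap.baseChange ℂ
    ((GradedAlgebra.proj (fun i : ℕ => ⋀[ℝ]^i V) r) ∘ₗ
      (CliffordAlgebra.equivExterior Q).toLinearMap)

/-- The element `v_0 ∧ ⋯ ∧ v_{r-1}` of `Λ(V)`. -/
def wedge {r : ℕ} (f : Fin r → V) : ExteriorAlgebra ℝ V := ExteriorAlgebra.ιMulti ℝ r f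

end Clifford

/-- The model Euclidean space `ℝ^n`. -/
abbrev Euc (n : ℕ) : Type := EuclideanSpace ℝ (Fin n)

/-- The form `-|v|²` on `ℝ^n`. -/
def stdForm (n : ℕ) : QuadraticForm ℝ (Euc n) := negForm (innerₗ (Euc n))

/-- `Spin^c(n)`: the units of `C(ℝ^n)` of the form `ζ x` with `ζ ∈ U(1)` and `x ∈ Spin(n)`. -/
def Spinc (n : ℕ) : Subgroup (CliffC (stdForm n))ˣ where
  carrier := {s | ∃ ζ : Circle, ∃ x ∈ spinGroup (stdForm n),
    (s : CliffC (stdForm n)) = (ζ : ℂ) ⊗ₜ x}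
  one_mem' := ⟨1, 1, one_mem _, by simp [Algebra.TensorProduct.one_def]⟩
  mul_mem' := by
    rintro a b ⟨ζ, x, hx, ha⟩ ⟨ξ, y, hy, hb⟩
    exact ⟨ζ * ξ, x * y, mul_mem hx hy, by
      rw [Units.val_mul, ha, hb, Algebra.TensorProduct.tmul_mul_tmul, Circle.coe_mul]⟩
  inv_mem' := by
    rintro a ⟨ζ, x, hx, ha⟩
    refine ⟨ζ⁻¹, star x, spinGroup.star_mem hx, Units.inv_eq_of_mul_eq_one_right ?_⟩
    rw [ha, Algebra.TensorProduct.tmul_mul_tmul, spinGroup.mul_star_self_of_mem hx,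
      ← Circle.coe_mul, mul_inv_cancel, Circle.coe_one, Algebra.TensorProduct.one_def]

/-- `Spin^c(n)` carries the subspace topology of the finite-dimensional real vector space
`C(ℝ^n)`. -/
instance (n : ℕ) : TopologicalSpace (Spinc n) :=
  TopologicalSpace.induced (fun s => ((s : (CliffC (stdForm n))ˣ) : CliffC (stdForm n)))
    (moduleTopology ℝ (CliffC (stdForm n)))

theorem exists_rotation {n : ℕ} (s : Spinc n) (v : Euc n) :
    ∃ w : Euc n, ((s : (CliffC (stdForm n))ˣ) : CliffC (stdForm n)) * cliff (stdForm n) v *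
      ((s⁻¹ : Spinc n) : (CliffC (stdForm n))ˣ) = cliff (stdForm n) w := by
  obtain ⟨s, ζ, x, hx, hs⟩ := s
  have h1 : x * star x = 1 := spinGroup.mul_star_self_of_mem hx
  have h2 : star x * x = 1 := spinGroup.star_mul_self_of_mem hx
  let xu : (CliffordAlgebra (stdForm n))ˣ := ⟨x, star x, h1, h2⟩
  obtain ⟨w, hw⟩ := spinGroup.conjAct_smul_ι_mem_range_ι (x := xu) hx v
  refine ⟨w, ?_⟩
  have hinv : ((s⁻¹ : (CliffC (stdForm n))ˣ) : CliffC (stdForm n)) =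
      ((ζ⁻¹ : Circle) : ℂ) ⊗ₜ star x := by
    refine Units.inv_eq_of_mul_eq_one_right ?_
    rw [hs, Algebra.TensorProduct.tmul_mul_tmul, h1,
      ← Circle.coe_mul, mul_inv_cancel, Circle.coe_one, Algebra.TensorProduct.one_def]
  simp only [cliff, InvMemClass.coe_inv, hinv]
  rw [hs, Algebra.TensorProduct.tmul_mul_tmul, Algebra.TensorProduct.tmul_mul_tmul, mul_one,
    ← Circle.coe_mul, mul_inv_cancel, Circle.coe_one, hw, ConjAct.units_smul_def]
  rfl

/-- The covering homomorphism `Spin^c(n) → SO(n)`: `c(rotation s v) = s c(v) s⁻¹`. -/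
def rotation {n : ℕ} (s : Spinc n) (v : Euc n) : Euc n := Classical.choose (exists_rotation s v)

/-! ### Orientations, metrics and `Spin^c` structures -/

section Manifold

variable {n : ℕ} {Z : Type u} [TopologicalSpace Z] [ChartedSpace (Euc n) Z]
  [IsManifold (𝓡 n) ∞ Z]

/-- The tangent space `T_z Z`. -/
abbrev Tan (n : ℕ) {Z : Type u} [TopologicalSpace Z] [ChartedSpace (Euc n) Z] (z : Z) : Type :=
  TangentSpace (𝓡 n) z

variable (n Z) in
/-- A smooth Riemannian metric on `Z`. -/
abbrev Metric : Type _ :=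
  Bundle.ContMDiffRiemannianMetric (𝓡 n) ∞ (Euc n) (fun z : Z => Tan n z)

variable (n Z) in
/-- An orientation of the manifold `Z`: an orientation of every tangent space such that near every
point there is a continuous frame whose sign does not change. -/
structure ManifoldOrientation where
  /-- the orientation of the tangent space at a point -/
  at' (z : Z) : Orientation ℝ (Tan n z) (Fin n)
  continuous' (z₀ : Z) : ∃ (U : Set Z) (b : ∀ z : Z, Module.Basis (Fin n) ℝ (Tan n z)),
    IsOpen U ∧ z₀ ∈ U ∧
    (∀ i, ContinuousOn (fun z => (⟨z, b z i⟩ : TangentBundle (𝓡 n) Z)) U) ∧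
    ∀ z ∈ U, ((b z).orientation = at' z ↔ (b z₀).orientation = at' z₀)

/-- A family of orientations of subspaces `F z ⊆ T_z Z`, `z ∈ A`, is continuous if near every point
of `A` there is a continuous frame of the family `F` whose sign does not change. -/
def IsContinuousOrientation {A : Set Z} (F : ∀ z : A, Submodule ℝ (Tan n (z : Z)))
    (o : ∀ z : A, Orientation ℝ (F z) (Fin (Module.finrank ℝ (F z)))) : Prop :=
  ∀ z₀ : A, ∃ (U : Set A) (X : ℕ → ∀ z : A, Tan n (z : Z))
    (b : ∀ z : A, Module.Basis (Fin (Module.finrank ℝ (F z))) ℝ (F z)),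
    IsOpen U ∧ z₀ ∈ U ∧
    (∀ z ∈ U, Module.finrank ℝ (F z) = Module.finrank ℝ (F z₀)) ∧
    (∀ z ∈ U, ∀ i, (b z i : Tan n (z : Z)) = X i z) ∧
    (∀ i < Module.finrank ℝ (F z₀),
      ContinuousOn (fun z : A => (⟨z, X i z⟩ : TangentBundle (𝓡 n) Z)) U) ∧
    ∀ z ∈ U, ((b z).orientation = o z ↔ (b z₀).orientation = o z₀)

/-- The bilinear form of the metric on `T_z Z`. -/
def Metric.bilin (m : Metric n Z) (z : Z) : Tan n z →ₗ[ℝ] Tan n z →ₗ[ℝ] ℝ :=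
  LinearMap.mk₂ ℝ (fun v w => m.inner z v w) (by simp) (by simp) (by simp) (by simp)

/-- The form `-|v|²` on `T_z Z`; its complex Clifford algebra is `C(T_z Z)`. -/
def Metric.form (m : Metric n Z) (z : Z) : QuadraticForm ℝ (Tan n z) := negForm (m.bilin z)

/-- A `Spin^c` structure on the oriented Riemannian manifold `Z`: a principal `Spin^c(n)`-bundle `P`
(with right action, `MulOpposite.op s • p` being `p · s`) together with a continuous map from `P` to
the oriented orthonormal frames of `TZ`, over `Z`, equivariant along `Spin^c(n) → SO(n)`. A frame of
`T_z Z` is a linear isometry `ℝ^n → T_z Z`. (For `n = 0` the orientation of a point is a sign, and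
no compatibility is asked.) -/
structure SpincStructure (m : Metric n Z) (oZ : ManifoldOrientation n Z) where
  /-- the total space of the principal bundle -/
  P : Type w
  [topP : TopologicalSpace P]
  [actP : MulAction (Spinc n)ᵐᵒᵖ P]
  continuous_act : Continuous fun x : P × Spinc n => MulOpposite.op x.2 • x.1
  /-- the bundle projection -/
  proj : P → Z
  proj_act (p : P) (s : Spinc n) : proj (MulOpposite.op s • p) = proj p
  locally_trivial (z : Z) : ∃ e : Bundle.Trivialization (Spinc n) proj, z ∈ e.baseSet ∧
    ∀ (p : P) (s : Spinc n), proj p ∈ e.baseSet → (e (MulOpposite.op s • p)).2 = (e p).2 * s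
  /-- the frame covered by a point of the principal bundle -/
  frame (p : P) : Euc n ≃ₗ[ℝ] Tan n (proj p)
  frame_inner (p : P) (v w : Euc n) : m.inner (proj p) (frame p v) (frame p w) = inner ℝ v w
  frame_orientation (hn : n ≠ 0) (p : P) :
    Orientation.map (Fin n) (frame p) (EuclideanSpace.basisFun (Fin n) ℝ).toBasis.orientation =
      oZ.at' (proj p)
  frame_act (p : P) (s : Spinc n) (v : Euc n) :
    (⟨proj (MulOpposite.op s • p), frame (MulOpposite.op s • p) v⟩ : TangentBundle (𝓡 n) Z) =
      ⟨proj p, frame p (rotation s v)⟩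
  continuous_frame (v : Euc n) :
    Continuous fun p => (⟨proj p, frame p v⟩ : TangentBundle (𝓡 n) Z)

attribute [instance] SpincStructure.topP SpincStructure.actP

/-- A `G`-equivariant `Spin^c` structure: `G` acts on `P` by bundle automorphisms which commute with
`Spin^c(n)` and cover the action on frames by differentials. (So `G` acts on `Z` by orientation
preserving isometries.) -/
structure EquivariantSpincStructure (G : Type v) [Group G] [TopologicalSpace G] [MulAction G Z]
    (m : Metric n Z) (oZ : ManifoldOrientation n Z) extends SpincStructure.{u, w} m oZ where
  [actG : MulAction G P]
  continuous_actG : Continuous fun x : G × P => x.1 • x.2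
  proj_actG (g : G) (p : P) : proj (g • p) = g • proj p
  comm_actG (g : G) (p : P) (s : Spinc n) :
    g • (MulOpposite.op s • p) = MulOpposite.op s • (g • p)
  frame_actG (g : G) (p : P) (v : Euc n) :
    (⟨proj (g • p), frame (g • p) v⟩ : TangentBundle (𝓡 n) Z) =
      tangentMap (𝓡 n) (𝓡 n) (fun z : Z => g • z) ⟨proj p, frame p v⟩

attribute [instance] EquivariantSpincStructure.actG

/-! ### The fixed-point set -/

section FixedPoints

variable {G : Type v} [Group G] [MulAction G Z]

/-- The differential `dg : T_z Z → T_z Z` at a fixed point `z` of `g`, where `T_{gz} Z` is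
`T_z Z`. -/
def fixedDiff (g : G) (z : MulAction.fixedBy Z g) : Module.End ℝ (Tan n (z : Z)) :=
  (mfderiv (𝓡 n) (𝓡 n) (fun y : Z => g • y) (z : Z) : Euc n →L[ℝ] Euc n).toLinearMap

variable (n) in
/-- The tangent space `T_z Z^g`, as the space of vectors of `T_z Z` fixed by `dg`. -/
def fixedTangent (g : G) (z : MulAction.fixedBy Z g) : Submodule ℝ (Tan n (z : Z)) :=
  LinearMap.ker (fixedDiff g z - LinearMap.id)

/-- The normal space `N_z` of `Z^g`: the orthogonal complement of `T_z Z^g` in `T_z Z`. -/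
def normalSpace (m : Metric n Z) (g : G) (z : MulAction.fixedBy Z g) :
    Submodule ℝ (Tan n (z : Z)) where
  carrier := {v | ∀ w ∈ fixedTangent n g z, m.inner (z : Z) v w = 0}
  zero_mem' := by simp
  add_mem' := by
    intro a b ha hb w hw
    simp [ha w hw, hb w hw]
  smul_mem' := by
    intro c a ha w hw
    simp [ha w hw]

/-- `Z^g` is a submanifold of `Z` with tangent spaces `T_z Z^g = ker (dg - 1)`: around each of its
points there is a smooth chart of `Z` which maps `Z^g` to a linear subspace `L` of `ℝ^n`, and whose
differential maps exactly `ker (dg - 1)` to `L`. -/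
def IsFixedSubmanifold (n : ℕ) (Z : Type u) [TopologicalSpace Z] [ChartedSpace (Euc n) Z]
    [IsManifold (𝓡 n) ∞ Z] [MulAction G Z] (g : G) : Prop :=
  ∀ z₀ : MulAction.fixedBy Z g, ∃ e ∈ IsManifold.maximalAtlas (𝓡 n) ∞ Z,
    (z₀ : Z) ∈ e.source ∧ ∃ L : Submodule ℝ (Euc n),
      (∀ y ∈ e.source, y ∈ MulAction.fixedBy Z g ↔ e y ∈ L) ∧
      ∀ z : MulAction.fixedBy Z g, (z : Z) ∈ e.source → ∀ v : Tan n (z : Z),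
        v ∈ fixedTangent n g z ↔ (mfderiv (𝓡 n) (𝓡 n) e (z : Z) v : Euc n) ∈ L

end FixedPoints

/-! ### The spinor action of a group element at a fixed point -/

section Spinor

variable {m : Metric n Z} {oZ : ManifoldOrientation n Z}

/-- The isometry underlying the frame at `p`. -/
def SpincStructure.isometry (S : SpincStructure.{u, w} m oZ) (p : S.P) :
    stdForm n →qᵢ m.form (S.proj p) where
  toLinearMap := (S.frame p).toLinearMap
  map_app' := by
    intro v
    have h := S.frame_inner p v v
    simp only [Metric.form, stdForm, negForm, Metric.bilin]
    simpa using h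

variable {G : Type v} [Group G] [TopologicalSpace G] [MulAction G Z]

/-- `a ∈ C(T_z Z)` is the action of `g` on the spinors at the fixed point `z`: if `p ∈ P_z` and
`g p = p · s` with `s ∈ Spin^c(n)`, then `g [p, φ] = [p, s φ]` in `P ×_{Spin^c(n)} 𝒮_n`, so that `g`
acts on the spinors as Clifford multiplication by the element of `C(T_z Z)` that corresponds to `s`
in the frame given by `p`. -/
def EquivariantSpincStructure.IsSpinorAction (S : EquivariantSpincStructure.{u, v, w} G m oZ)
    (g : G) (z : MulAction.fixedBy Z g) (a : CliffC (m.form (z : Z))) : Prop :=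
  ∃ (p : S.P) (s : Spinc n), g • p = MulOpposite.op s • p ∧
    (⟨S.proj p, cliffMap (S.toSpincStructure.isometry p)
        ((s : (CliffC (stdForm n))ˣ) : CliffC (stdForm n))⟩ : Σ y : Z, CliffC (m.form y)) =
      ⟨(z : Z), a⟩

/-- `α` is a phase of the spinor action of `g` at `z`: for some orthonormal basis
`e_{j,0}, e_{j,1}` (`j < k`) of the normal space `N_z` in which `dg` has diagonal blocks the
rotations by angles `0 < θ_j ≤ π`, the spinor action of `g` is
`α ∏_j (cos (θ_j / 2) + sin (θ_j / 2) c(e_{j,0}) c(e_{j,1}))`. -/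
def EquivariantSpincStructure.IsPhase (S : EquivariantSpincStructure.{u, v, w} G m oZ)
    (g : G) (z : MulAction.fixedBy Z g) (α : Circle) : Prop :=
  ∃ (k : ℕ) (θ : Fin k → ℝ) (e : Module.Basis (Fin k × Fin 2) ℝ (normalSpace m g z)),
    (∀ i j, m.inner (z : Z) (e i) (e j) = if i = j then 1 else 0) ∧
    (∀ j, 0 < θ j ∧ θ j ≤ Real.pi) ∧
    (∀ j, fixedDiff g z (e (j, 0)) =
      Real.cos (θ j) • (e (j, 0) : Tan n (z : Z)) + Real.sin (θ j) • (e (j, 1) : Tan n (z : Z))) ∧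
    (∀ j, fixedDiff g z (e (j, 1)) =
      -Real.sin (θ j) • (e (j, 0) : Tan n (z : Z)) + Real.cos (θ j) • (e (j, 1) : Tan n (z : Z))) ∧
    S.IsSpinorAction g z ((α : ℂ) • (List.ofFn fun j : Fin k =>
      algebraMap ℝ (CliffC (m.form (z : Z))) (Real.cos (θ j / 2)) +
        Real.sin (θ j / 2) • (cliff (m.form (z : Z)) (e (j, 0)) *
          cliff (m.form (z : Z)) (e (j, 1)))).prod)

/-- For a basis `f` of `N_z`: the form `α⁻¹ [σ(g)]_{rk N}` is `c · f_0 ∧ f_1 ∧ ⋯` with `c`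
real. -/
def EquivariantSpincStructure.TopSymbolIs (S : EquivariantSpincStructure.{u, v, w} G m oZ)
    (g : G) (z : MulAction.fixedBy Z g) (α : Circle)
    (f : Module.Basis (Fin (Module.finrank ℝ (normalSpace m g z))) ℝ (normalSpace m g z))
    (c : ℝ) : Prop :=
  ∃ a : CliffC (m.form (z : Z)), S.IsSpinorAction g z a ∧
    (α : ℂ)⁻¹ • symbolPart (m.form (z : Z)) (Module.finrank ℝ (normalSpace m g z)) a =
      (c : ℂ) ⊗ₜ[ℝ] wedge (fun i => (f i : Tan n (z : Z)))

/-- `o` is the orientation of `Z^g` for which `TZ = TZ^g ⊕ N` holds as oriented bundles, where `Z`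
has its given orientation and `N` is oriented by `α⁻¹ [σ(g)]_{rk N}`: if `t` is a basis of `T_z Z^g`
and `f` a basis of `N_z` such that `α⁻¹ [σ(g)]_{rk N}` is a positive multiple of `f_0 ∧ f_1 ∧ ⋯`,
then `t` is positive in `T_z Z^g` if and only if `e = (t, f)` is positive in `T_z Z`. -/
def EquivariantSpincStructure.IsInducedOrientation
    (S : EquivariantSpincStructure.{u, v, w} G m oZ) (g : G) (α : MulAction.fixedBy Z g → Circle)
    (o : ∀ z : MulAction.fixedBy Z g,
      Orientation ℝ (fixedTangent n g z) (Fin (Module.finrank ℝ (fixedTangent n g z)))) : Prop :=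
  ∀ (z : MulAction.fixedBy Z g)
    (t : Module.Basis (Fin (Module.finrank ℝ (fixedTangent n g z))) ℝ (fixedTangent n g z))
    (f : Module.Basis (Fin (Module.finrank ℝ (normalSpace m g z))) ℝ (normalSpace m g z))
    (e : Module.Basis (Fin n) ℝ (Tan n (z : Z))) (c : ℝ),
    (∀ (j : Fin n) (i : Fin (Module.finrank ℝ (fixedTangent n g z))),
      (j : ℕ) = i → e j = t i) →
    (∀ (j : Fin n) (i : Fin (Module.finrank ℝ (normalSpace m g z))),
      (j : ℕ) = Module.finrank ℝ (fixedTangent n g z) + i → e j = f i) →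
    S.TopSymbolIs g z (α z) f c → 0 < c →
    (t.orientation = o z ↔ e.orientation = oZ.at' (z : Z))

end Spinor

end Manifold

end SpincFixed

end

noncomputable section

namespace SpincFixed

/-! ### Clifford and exterior algebras: naturality of the symbol, the twisted centre -/

section CliffordLemmas

open CliffordAlgebra

variable {V W : Type*} [AddCommGroup V] [Module ℝ V] [AddCommGroup W] [Module ℝ W]

/-! At a fixed point `z` choose `p` over `z` and write `g p = p s`, `s = ζ x` with `ζ` a phase and
`x` in Spin. In the frame of `p`, `dg` is the rotation covered by `s`, hence an isometry, and `x`
becomes a lift `y` of `dg`: an even unitary Clifford element with `y c(v) = c(dg v) y`. For a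
definite form the twisted centre of the Clifford algebra is the scalars
(`mem_range_algebraMap_of_twisted_commute`), so two lifts agree up to sign (`IsLift.eq_or_eq_neg`).
The normal form of an isometry gives rotation blocks on `N`, with at most one leftover line on which
`dg = -1`; a lift, being even, rules this line out (`exists_isAdapted`). The product of the
half-angle factors, the rotor, is also a lift, so `y` is plus or minus the rotor and a phase exists.
Two phases differ at most by sign. If `-1` is not an eigenvalue, every rotor has positive scalar
part `∏ cos (θ_j / 2)`, so the sign is determined; if some angle is `π`, swapping the two vectors of
that block reverses the sign.

The submanifold statement uses neither geodesics nor averaging. In a chart, let `F` be `g`, `A` its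
derivative at the fixed point, and `P` the projection onto the normal space along `ker (A - 1)`. The
map `P (x - F x) + (1 - P) (x - x₀)` is a local chart, and fixed points satisfy `P (F x - x) = 0`.
Conversely, if `l = F x - x` lies in `ker (A - 1)`, then every power of `g` moves `x` to `F x` by
nearly `l`, uniformly in the power, because the isotropy group is compact. The sequence `g ^ k x`
then drifts by about `l` at each step while staying bounded, so `l = 0`
(`eq_zero_of_bounded_drift`).

The eigenvalue `-1` is detected by comparing the ranks of the fixed submanifolds of `g` and `g ^ 2`,
so its presence is locally constant. The square of a phase is the value at `s` of the continuous
character `ζ x ↦ ζ²`. Uniform continuity over a compact group containing all powers of `g`, together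
with the absence of small subgroups in `U(1)`, makes this square locally constant
(`eventually_phase_sq_eq`). The sign is fixed by the argument normalization where `-1` is an
eigenvalue, and by the continuous scalar part of `s` elsewhere.

The symbol of the rotor is the same product taken in the exterior algebra, with top part `∏ sin (θ_j
/ 2)` times the wedge of the basis, a positive multiple. This orients `N`, and the determinant of
block diagonal matrices turns it into exactly one orientation of the tangent space of `Z^g`. For
continuity, the spaces `ker (dg - 1)` and `N` are trivialized locally by an explicit family of
isomorphisms (`exists_kernel_transport`), and the coefficient of the top symbol in the transported
frame stays positive. -/

theorem contractLeft_map {Q : QuadraticForm ℝ V} {Q' : QuadraticForm ℝ W} (f : Q →qᵢ Q')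
    (d : Module.Dual ℝ W) (x : CliffordAlgebra Q) :
    contractLeft (Q := Q') d (CliffordAlgebra.map f x) =
      CliffordAlgebra.map f (contractLeft (Q := Q) (d ∘ₗ f.toLinearMap) x) := by
  induction x using CliffordAlgebra.left_induction with
  | algebraMap r => simp [AlgHom.commutes]
  | add x y hx hy => simp only [map_add, hx, hy]
  | ι_mul x m hx =>
    rw [map_mul, map_apply_ι, contractLeft_ι_mul, contractLeft_ι_mul, hx]
    simp only [map_sub, map_smul, map_mul, map_apply_ι, LinearMap.comp_apply]
    rfl

/-- The recursion defining the symbol uses only exterior multiplication by a vector and contraction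
with its polar form, and an isometry carries both along. Symbols on `T_z Z` can thus be computed in
`ℝ^n` through a frame. -/
theorem equivExterior_map {Q : QuadraticForm ℝ V} {Q' : QuadraticForm ℝ W} (f : Q →qᵢ Q')
    (x : CliffordAlgebra Q) :
    equivExterior Q' (CliffordAlgebra.map f x) =
      ExteriorAlgebra.map f.toLinearMap (equivExterior Q x) := by
  induction x using CliffordAlgebra.left_induction with
  | algebraMap r => simp [AlgHom.commutes]
  | add x y hx hy => simp only [map_add, hx, hy]
  | ι_mul x m hx =>
    simp only [equivExterior, changeFormEquiv_apply] at hx ⊢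
    rw [map_mul, map_apply_ι, changeForm_ι_mul, changeForm_ι_mul, hx, map_sub, map_mul]
    congr 1
    · congr 1
      exact (ExteriorAlgebra.map_apply_ι _ _).symm
    · rw [ExteriorAlgebra.map, contractLeft_map]
      congr 3
      ext v
      simp only [LinearMap.comp_apply, QuadraticMap.associated_apply]
      have h1 := fun v => f.map_app v
      have h2 : ∀ v, f.toLinearMap v = f v := fun _ => rfl
      simp only [neg_apply, h2, ← map_add, h1]

theorem extMap_mem_exteriorPower (f : V →ₗ[ℝ] W) {r : ℕ} {x : ExteriorAlgebra ℝ V}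
    (hx : x ∈ ⋀[ℝ]^r V) : ExteriorAlgebra.map f x ∈ ⋀[ℝ]^r W := by
  induction hx using Submodule.pow_induction_on_left' with
  | algebraMap a => rw [AlgHom.commutes]; exact Submodule.algebraMap_mem a
  | add x y i hx hy h1 h2 => rw [map_add]; exact add_mem h1 h2
  | mem_mul m hm i x hx h =>
    obtain ⟨v, rfl⟩ := hm
    rw [map_mul, ExteriorAlgebra.map_apply_ι]
    have h1 : ExteriorAlgebra.ι ℝ (f v) ∈ LinearMap.range (ExteriorAlgebra.ι ℝ (M := W)) := ⟨_, rfl⟩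
    have h2 := Submodule.mul_mem_mul h1 h
    rwa [← pow_succ'] at h2

theorem proj_of_mem {i : ℕ} (r : ℕ) {x : ExteriorAlgebra ℝ V} (hx : x ∈ ⋀[ℝ]^i V) :
    GradedAlgebra.proj (fun i : ℕ => ⋀[ℝ]^i V) r x = if i = r then x else 0 := by
  rw [GradedAlgebra.proj_apply]
  split_ifs with h
  · subst h
    exact DirectSum.decompose_of_mem_same (fun i : ℕ => ⋀[ℝ]^i V) hx
  · exact DirectSum.decompose_of_mem_ne (fun i : ℕ => ⋀[ℝ]^i V) hx h

theorem proj_extMap (f : V →ₗ[ℝ] W) (r : ℕ) (x : ExteriorAlgebra ℝ V) :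
    GradedAlgebra.proj (fun i : ℕ => ⋀[ℝ]^i W) r (ExteriorAlgebra.map f x) =
      ExteriorAlgebra.map f (GradedAlgebra.proj (fun i : ℕ => ⋀[ℝ]^i V) r x) := by
  induction x using DirectSum.Decomposition.inductionOn (fun i : ℕ => ⋀[ℝ]^i V) with
  | zero => simp
  | @homogeneous i m =>
    rw [proj_of_mem r m.2, proj_of_mem r (extMap_mem_exteriorPower f m.2)]
    split_ifs <;> simp
  | add x y hx hy => simp only [map_add, hx, hy]

/-- The homomorphism of complex exterior algebras induced by a linear map. -/
def extCMap (f : V →ₗ[ℝ] W) : ExtC V →ₗ[ℂ] ExtC W :=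
  LinearMap.baseChange ℂ (ExteriorAlgebra.map f).toLinearMap

theorem symbolPart_cliffMap {Q : QuadraticForm ℝ V} {Q' : QuadraticForm ℝ W} (f : Q →qᵢ Q')
    (r : ℕ) (a : CliffC Q) :
    symbolPart Q' r (cliffMap f a) = extCMap f.toLinearMap (symbolPart Q r a) := by
  induction a using TensorProduct.induction_on with
  | zero => simp
  | add x y hx hy => simp only [map_add, hx, hy]
  | tmul z x =>
    simp only [symbolPart, cliffMap, extCMap, Algebra.TensorProduct.map_tmul,
      LinearMap.baseChange_tmul, LinearMap.comp_apply, LinearEquiv.coe_coe, AlgHom.toLinearMap_apply]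
    rw [equivExterior_map, proj_extMap]
    rfl

theorem extMap_wedge (f : V →ₗ[ℝ] W) {r : ℕ} (u : Fin r → V) :
    ExteriorAlgebra.map f (wedge u) = wedge (fun i => f (u i)) := by
  rw [wedge, wedge, ExteriorAlgebra.map_apply_ιMulti]; rfl

/-- The twisted commutator with `v` is an antiderivation which takes a vector `w` to `-2 ⟨v, w⟩`;
contraction is determined by the same rule. -/
theorem ι_mul_sub_involute_mul_ι {B : V →ₗ[ℝ] V →ₗ[ℝ] ℝ} (hB : ∀ v w, B v w = B w v) (v : V)
    (y : CliffordAlgebra (negForm B)) :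
    ι (negForm B) v * y - involute y * ι (negForm B) v = (-2 : ℝ) • contractLeft (B v) y := by
  induction y using CliffordAlgebra.left_induction with
  | algebraMap r => rw [AlgHom.commutes, contractLeft_algebraMap, smul_zero, Algebra.commutes, sub_self]
  | add x y hx hy =>
    simp only [map_add, mul_add, add_mul, smul_add, ← hx, ← hy]; abel
  | ι_mul x w hx =>
    have h : ι (negForm B) v * ι (negForm B) w =
        algebraMap ℝ _ (-2 * B v w) - ι (negForm B) w * ι (negForm B) v := by
      rw [eq_sub_iff_add_eq, ι_mul_ι_add_swap]
      congr 1
      simp [negForm, QuadraticMap.polar, hB w v]; ring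
    rw [map_mul, involute_ι, ← mul_assoc, h, sub_mul, contractLeft_ι_mul, smul_sub, ← mul_smul_comm,
      ← hx, mul_sub, ← Algebra.smul_def, smul_smul]
    simp only [neg_mul, mul_assoc]
    abel

/-- Euler's identity: removing a vector and putting it back counts the degree. -/
theorem sum_ι_mul_contractLeft {κ : Type*} [Fintype κ] (b : Module.Basis κ ℝ V) {r : ℕ}
    {y : ExteriorAlgebra ℝ V} (hy : y ∈ ⋀[ℝ]^r V) :
    ∑ i, ExteriorAlgebra.ι ℝ (b i) * contractLeft (Q := (0 : QuadraticForm ℝ V)) (b.coord i) y =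
      (r : ℝ) • y := by
  induction hy using Submodule.pow_induction_on_left' with
  | algebraMap a =>
    simp only [Nat.cast_zero, zero_smul]
    refine Finset.sum_eq_zero fun i _ => ?_
    erw [contractLeft_algebraMap, mul_zero]
  | add x y i hx hy h1 h2 => simp only [map_add, mul_add, Finset.sum_add_distrib, h1, h2, smul_add]
  | mem_mul m hm i x hx h =>
    obtain ⟨v, rfl⟩ := hm
    have h1 : ∀ j, contractLeft (Q := (0 : QuadraticForm ℝ V)) (b.coord j)
        (ExteriorAlgebra.ι ℝ v * x) = b.coord j v • x -
          ExteriorAlgebra.ι ℝ v * contractLeft (Q := (0 : QuadraticForm ℝ V)) (b.coord j) x :=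
      fun j => contractLeft_ι_mul _ _ _
    have h2 : ∀ u, ExteriorAlgebra.ι ℝ u * ExteriorAlgebra.ι ℝ v =
        - (ExteriorAlgebra.ι ℝ v * ExteriorAlgebra.ι ℝ u) := fun u =>
      eq_neg_of_add_eq_zero_left (ExteriorAlgebra.ι_add_mul_swap u v)
    simp only [h1, mul_sub, ← mul_assoc, h2, neg_mul, sub_neg_eq_add, Finset.sum_add_distrib]
    simp only [mul_assoc, ← Finset.mul_sum, h]
    have h3 : ∑ j, ExteriorAlgebra.ι ℝ (b j) * b.coord j v • x = ExteriorAlgebra.ι ℝ v * x := by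
      conv_rhs => rw [← b.sum_repr v, map_sum, Finset.sum_mul]
      exact Finset.sum_congr rfl fun j _ => by
        rw [map_smul, mul_smul_comm, smul_mul_assoc]; rfl
    rw [h3, mul_smul_comm]
    push_cast
    rw [add_smul, one_smul, add_comm]

/-- Such an element is killed by the Euler operator, which is multiplication by `r` in degree `r`;
only the part of degree 0 survives. -/
theorem mem_range_algebraMap_of_contractLeft_eq_zero [FiniteDimensional ℝ V]
    {y : ExteriorAlgebra ℝ V}
    (hy : ∀ d : Module.Dual ℝ V, contractLeft (Q := (0 : QuadraticForm ℝ V)) d y = 0) :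
    ∃ r : ℝ, y = algebraMap ℝ _ r := by
  let b := Module.finBasis ℝ V
  let E : ExteriorAlgebra ℝ V →ₗ[ℝ] ExteriorAlgebra ℝ V :=
    ∑ i, LinearMap.mulLeft ℝ (ExteriorAlgebra.ι ℝ (b i)) ∘ₗ
      contractLeft (Q := (0 : QuadraticForm ℝ V)) (b.coord i)
  have hE : ∀ (r : ℕ) (x : ExteriorAlgebra ℝ V), x ∈ ⋀[ℝ]^r V → E x = (r : ℝ) • x := by
    intro r x hx
    rw [← sum_ι_mul_contractLeft b hx]
    simp [E]
  have hE0 : E y = 0 := by simp [E, hy]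
  have key : ∀ (r : ℕ) (x : ExteriorAlgebra ℝ V),
      GradedAlgebra.proj (fun i : ℕ => ⋀[ℝ]^i V) r (E x) =
        (r : ℝ) • GradedAlgebra.proj (fun i : ℕ => ⋀[ℝ]^i V) r x := by
    intro r x
    induction x using DirectSum.Decomposition.inductionOn (fun i : ℕ => ⋀[ℝ]^i V) with
    | zero => simp
    | @homogeneous i m =>
      rw [hE i m m.2, map_smul]
      rw [proj_of_mem r m.2]
      split_ifs with h <;> simp [h]
    | add x y hx hy => simp only [map_add, hx, hy, smul_add]
  have h0 : ∀ r : ℕ, r ≠ 0 → GradedAlgebra.proj (fun i : ℕ => ⋀[ℝ]^i V) r y = 0 := by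
    intro r hr
    have h := key r y
    rw [hE0, map_zero] at h
    exact (smul_eq_zero.mp h.symm).resolve_left (Nat.cast_ne_zero.mpr hr)
  have hy0 : y ∈ ⋀[ℝ]^0 V := by
    classical
    rw [← DirectSum.sum_support_decompose (fun i : ℕ => ⋀[ℝ]^i V) y]
    refine Submodule.sum_mem _ fun i _ => ?_
    by_cases hi : i = 0
    · subst hi; exact SetLike.coe_mem _
    · have := h0 i hi
      rw [GradedAlgebra.proj_apply] at this
      rw [this]; exact zero_mem _
  have hy1 : y ∈ (1 : Submodule ℝ (ExteriorAlgebra ℝ V)) := by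
    rwa [← pow_zero (LinearMap.range (ExteriorAlgebra.ι ℝ (M := V)))]
  obtain ⟨r, hr⟩ := Submodule.mem_one.mp hy1
  exact ⟨r, hr.symm⟩

/-- In the Clifford algebra of a nondegenerate form, only scalars are in the twisted center. -/
theorem mem_range_algebraMap_of_twisted_commute [FiniteDimensional ℝ V]
    {B : V →ₗ[ℝ] V →ₗ[ℝ] ℝ} (hB : ∀ v w, B v w = B w v) (hpos : ∀ v, v ≠ 0 → 0 < B v v)
    {y : CliffordAlgebra (negForm B)}
    (hy : ∀ v, ι (negForm B) v * y = involute y * ι (negForm B) v) :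
    ∃ r : ℝ, y = algebraMap ℝ _ r := by
  -- A definite form identifies `V` with its dual, so every contraction is one by some `B v`, which
  -- the twisted commutator controls.
  have hsurj : Function.Surjective B := by
    refine (LinearMap.injective_iff_surjective_of_finrank_eq_finrank
      (Subspace.dual_finrank_eq (K := ℝ) (V := V)).symm).mp ?_
    rw [← LinearMap.ker_eq_bot, LinearMap.ker_eq_bot']
    intro v hv
    by_contra h
    have := hpos v h
    rw [hv] at this
    simp at this
  have h1 : ∀ d : Module.Dual ℝ V, contractLeft d y = 0 := by
    intro d
    obtain ⟨v, rfl⟩ := hsurj d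
    have h := ι_mul_sub_involute_mul_ι hB v y
    rw [hy v, sub_self] at h
    exact (smul_eq_zero.mp h.symm).resolve_left (by norm_num)
  -- Contractions commute with the change of quadratic form, so their vanishing passes to the
  -- exterior algebra.
  obtain ⟨r, hr⟩ := mem_range_algebraMap_of_contractLeft_eq_zero (y := equivExterior _ y) (by
    intro d
    simp only [equivExterior, changeFormEquiv_apply]
    rw [← changeForm_contractLeft, h1, map_zero])
  refine ⟨r, (equivExterior (negForm B)).injective ?_⟩
  rw [hr]
  simp only [equivExterior, changeFormEquiv_apply]
  rw [changeForm_algebraMap]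

end CliffordLemmas

/-! ### Rotors: the rotation they cover, their scalar part and top-degree part -/

section Rotor

open CliffordAlgebra

variable {V : Type*} [AddCommGroup V] [Module ℝ V]

/-- The product of the elements `cos (θ_j / 2) + sin (θ_j / 2) e_{j,0} e_{j,1}`. -/
def rotor (Q : QuadraticForm ℝ V) {k : ℕ} (θ : Fin k → ℝ) (e : Fin k × Fin 2 → V) :
    CliffordAlgebra Q :=
  (List.ofFn fun j : Fin k => algebraMap ℝ (CliffordAlgebra Q) (Real.cos (θ j / 2)) +
    Real.sin (θ j / 2) • (ι Q (e (j, 0)) * ι Q (e (j, 1)))).prod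

theorem tmul_rotor (Q : QuadraticForm ℝ V) {k : ℕ} (θ : Fin k → ℝ) (e : Fin k × Fin 2 → V) :
    (List.ofFn fun j : Fin k =>
      algebraMap ℝ (CliffC Q) (Real.cos (θ j / 2)) +
        Real.sin (θ j / 2) • (cliff Q (e (j, 0)) * cliff Q (e (j, 1)))).prod =
      (1 : ℂ) ⊗ₜ[ℝ] rotor Q θ e := by
  rw [rotor, ← Algebra.TensorProduct.includeRight_apply (R := ℝ) (A := ℂ), map_list_prod,
    List.map_ofFn]
  congr 2
  ext j
  simp only [Function.comp_apply, map_add, AlgHom.commutes, map_smul, map_mul]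
  rfl

theorem rotor_succ (Q : QuadraticForm ℝ V) {k : ℕ} (θ : Fin (k + 1) → ℝ)
    (e : Fin (k + 1) × Fin 2 → V) :
    rotor Q θ e = (algebraMap ℝ (CliffordAlgebra Q) (Real.cos (θ 0 / 2)) +
      Real.sin (θ 0 / 2) • (ι Q (e (0, 0)) * ι Q (e (0, 1)))) *
      rotor Q (fun j => θ j.succ) (fun p => e (p.1.succ, p.2)) := by
  rw [rotor, List.ofFn_succ, List.prod_cons]; rfl

theorem involute_rotor (Q : QuadraticForm ℝ V) {k : ℕ} (θ : Fin k → ℝ) (e : Fin k × Fin 2 → V) :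
    involute (rotor Q θ e) = rotor Q θ e := by
  rw [rotor, map_list_prod, List.map_ofFn]
  congr 2
  ext j
  simp [AlgHom.commutes]

variable {B : V →ₗ[ℝ] V →ₗ[ℝ] ℝ}

theorem ι_mul_ι_negForm (hB : ∀ v w, B v w = B w v) (v w : V) :
    ι (negForm B) v * ι (negForm B) w =
      algebraMap ℝ _ (-2 * B v w) - ι (negForm B) w * ι (negForm B) v := by
  rw [eq_sub_iff_add_eq, ι_mul_ι_add_swap]
  congr 1
  simp [negForm, QuadraticMap.polar, hB w v]; ring

theorem ι_mul_self_negForm (v : V) :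
    ι (negForm B) v * ι (negForm B) v = algebraMap ℝ _ (-B v v) := by
  rw [ι_sq_scalar]; simp [negForm]

theorem ι_anticomm (hB : ∀ v w, B v w = B w v) {v w : V} (h : B v w = 0) :
    ι (negForm B) v * ι (negForm B) w = -(ι (negForm B) w * ι (negForm B) v) := by
  rw [ι_mul_ι_negForm hB, h]; simp

/-- A vector orthogonal to `a` and `b` anticommutes with each of them, hence commutes with `a b`. -/
theorem commute_pair (hB : ∀ v w, B v w = B w v) {v a b : V} (h0 : B v a = 0) (h1 : B v b = 0)
    (c s : ℝ) :
    Commute (ι (negForm B) v) (algebraMap ℝ _ c + s • (ι (negForm B) a * ι (negForm B) b)) := by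
  refine (Algebra.commute_algebraMap_right _ _).add_right (Commute.smul_right ?_ _)
  rw [Commute, SemiconjBy, ← mul_assoc, ι_anticomm hB h0, neg_mul, mul_assoc, ι_anticomm hB h1,
    mul_neg, neg_neg, mul_assoc]

theorem commute_rotor (hB : ∀ v w, B v w = B w v) {k : ℕ} (θ : Fin k → ℝ) (e : Fin k × Fin 2 → V)
    {v : V} (hv : ∀ i, B v (e i) = 0) : Commute (ι (negForm B) v) (rotor (negForm B) θ e) := by
  rw [rotor]
  refine Commute.list_prod_right _ _ fun x hx => ?_
  obtain ⟨j, rfl⟩ := (List.mem_ofFn' _ _).mp hx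
  exact commute_pair hB (hv _) (hv _) _ _

theorem pair_mul_star (hB : ∀ v w, B v w = B w v) {a b : V} (ha : B a a = 1) (hb : B b b = 1)
    (hab : B a b = 0) (t : ℝ) :
    (algebraMap ℝ _ (Real.cos t) + Real.sin t • (ι (negForm B) a * ι (negForm B) b)) *
      star (algebraMap ℝ _ (Real.cos t) + Real.sin t • (ι (negForm B) a * ι (negForm B) b)) = 1 ∧
    star (algebraMap ℝ _ (Real.cos t) + Real.sin t • (ι (negForm B) a * ι (negForm B) b)) *
      (algebraMap ℝ _ (Real.cos t) + Real.sin t • (ι (negForm B) a * ι (negForm B) b)) = 1 := by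
  have h0 := ι_mul_self_negForm (B := B) a
  have h1 := ι_mul_self_negForm (B := B) b
  have h2 := ι_anticomm hB hab
  have h3 := Real.cos_sq_add_sin_sq t
  set x := ι (negForm B) a
  set y := ι (negForm B) b
  have h4 : x * y * (y * x) = 1 := by
    rw [mul_assoc, ← mul_assoc y y x, h1, Algebra.algebraMap_eq_smul_one, smul_mul_assoc, one_mul,
      mul_smul_comm, h0, hb, ha]
    simp
  have h5 : y * x * (x * y) = 1 := by
    rw [mul_assoc, ← mul_assoc x x y, h0, Algebra.algebraMap_eq_smul_one, smul_mul_assoc, one_mul,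
      mul_smul_comm, h1, hb, ha]
    simp
  have hs : star (algebraMap ℝ _ (Real.cos t) + Real.sin t • (x * y)) =
      algebraMap ℝ _ (Real.cos t) + Real.sin t • (y * x) := by
    rw [star_add, CliffordAlgebra.star_smul, CliffordAlgebra.star_algebraMap, star_mul,
      CliffordAlgebra.star_ι, CliffordAlgebra.star_ι, neg_mul_neg]
  rw [hs, Algebra.algebraMap_eq_smul_one]
  simp only [add_mul, mul_add, smul_mul_smul_comm, mul_one, one_mul, h4, h5]
  rw [h2]
  constructor
  · match_scalars
    · linear_combination h3
    · ring
  · match_scalars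
    · linear_combination h3
    · ring

theorem rotor_mul_star (hB : ∀ v w, B v w = B w v) {k : ℕ} (θ : Fin k → ℝ)
    (e : Fin k × Fin 2 → V) (he : ∀ i j, B (e i) (e j) = if i = j then 1 else 0) :
    rotor (negForm B) θ e * star (rotor (negForm B) θ e) = 1 := by
  induction k with
  | zero => simp [rotor]
  | succ k ih =>
    rw [rotor_succ, star_mul, mul_assoc, ← mul_assoc (rotor _ _ _), ih, one_mul]
    · exact (pair_mul_star hB (by simp [he]) (by simp [he]) (by simp [he]) _).1
    · intro i j
      rw [he]
      simp [Prod.ext_iff]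

theorem star_rotor_mul (hB : ∀ v w, B v w = B w v) {k : ℕ} (θ : Fin k → ℝ)
    (e : Fin k × Fin 2 → V) (he : ∀ i j, B (e i) (e j) = if i = j then 1 else 0) :
    star (rotor (negForm B) θ e) * rotor (negForm B) θ e = 1 := by
  induction k with
  | zero => simp [rotor]
  | succ k ih =>
    rw [rotor_succ, star_mul, mul_assoc, ← mul_assoc (star (_ + _)),
      (pair_mul_star hB (by simp [he]) (by simp [he]) (by simp [he]) _).2, one_mul]
    refine ih _ _ fun i j => ?_
    rw [he]
    simp [Prod.ext_iff]

/-- Since `a b` squares to `-1`, the factor is the exponential of `(t / 2) a b`; conjugation by it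
acts on the plane from both sides and so turns it by the full angle `t`. -/
theorem pair_mul_ι (hB : ∀ v w, B v w = B w v) {a b : V} (ha : B a a = 1) (hb : B b b = 1)
    (hab : B a b = 0) (t : ℝ) :
    (algebraMap ℝ _ (Real.cos (t / 2)) + Real.sin (t / 2) • (ι (negForm B) a * ι (negForm B) b)) *
      ι (negForm B) a = ι (negForm B) (Real.cos t • a + Real.sin t • b) *
    (algebraMap ℝ _ (Real.cos (t / 2)) + Real.sin (t / 2) • (ι (negForm B) a * ι (negForm B) b)) ∧
    (algebraMap ℝ _ (Real.cos (t / 2)) + Real.sin (t / 2) • (ι (negForm B) a * ι (negForm B) b)) *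
      ι (negForm B) b = ι (negForm B) (-Real.sin t • a + Real.cos t • b) *
    (algebraMap ℝ _ (Real.cos (t / 2)) + Real.sin (t / 2) • (ι (negForm B) a * ι (negForm B) b)) := by
  have h0 := ι_mul_self_negForm (B := B) a
  have h1 := ι_mul_self_negForm (B := B) b
  have h2 := ι_anticomm hB ((hB b a).trans hab)
  have h3 := Real.cos_sq_add_sin_sq (t / 2)
  have hc : Real.cos t = Real.cos (t / 2) ^ 2 - Real.sin (t / 2) ^ 2 := by
    rw [← Real.cos_two_mul']; ring_nf
  have hs : Real.sin t = 2 * Real.sin (t / 2) * Real.cos (t / 2) := by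
    rw [← Real.sin_two_mul]; ring_nf
  rw [hc, hs]
  rw [ha] at h0
  rw [hb] at h1
  simp only [map_add, map_smul, map_neg, map_one] at h0 h1 ⊢
  set x := ι (negForm B) a
  set y := ι (negForm B) b
  have e1 : x * y * x = y := by rw [mul_assoc, h2, mul_neg, ← mul_assoc, h0]; simp
  have e2 : x * (x * y) = -y := by rw [← mul_assoc, h0]; simp
  have e3 : x * y * y = -x := by rw [mul_assoc, h1]; simp
  have e4 : y * (x * y) = x := by rw [← mul_assoc, h2, neg_mul, e3, neg_neg]
  have hsq : Real.sin (t / 2) ^ 2 = 1 - Real.cos (t / 2) ^ 2 := by linarith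
  constructor
  · simp only [Algebra.algebraMap_eq_smul_one, add_mul, mul_add, smul_mul_assoc, mul_smul_comm,
      one_mul, mul_one, e1, e2, e4]
    match_scalars
    · linear_combination (-Real.cos (t/2)) * h3
    · linear_combination (-Real.sin (t/2)) * h3
  · simp only [Algebra.algebraMap_eq_smul_one, add_mul, mul_add, smul_mul_assoc, mul_smul_comm,
      one_mul, mul_one, e3, e2, e4]
    match_scalars
    · linear_combination (-Real.cos (t/2)) * h3
    · linear_combination (Real.sin (t/2)) * h3

/-- The rotor covers the rotation with the given angles. -/
theorem rotor_mul_ι (hB : ∀ v w, B v w = B w v) {k : ℕ} (θ : Fin k → ℝ)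
    (e : Fin k × Fin 2 → V) (he : ∀ i j, B (e i) (e j) = if i = j then 1 else 0) (j : Fin k) :
    rotor (negForm B) θ e * ι (negForm B) (e (j, 0)) =
      ι (negForm B) (Real.cos (θ j) • e (j, 0) + Real.sin (θ j) • e (j, 1)) *
        rotor (negForm B) θ e ∧
    rotor (negForm B) θ e * ι (negForm B) (e (j, 1)) =
      ι (negForm B) (-Real.sin (θ j) • e (j, 0) + Real.cos (θ j) • e (j, 1)) *
        rotor (negForm B) θ e := by
  induction k with
  | zero => exact j.elim0
  | succ k ih =>
    rw [rotor_succ]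
    have hp := pair_mul_ι hB (a := e (0, 0)) (b := e (0, 1)) (by simp [he]) (by simp [he])
      (by simp [he]) (θ 0)
    -- For the first block the remaining factors commute with its vectors; for a later block it is
    -- the first factor that commutes.
    induction j using Fin.cases with
    | zero =>
      have hc : ∀ i, Commute (ι (negForm B) (e (0, i)))
          (rotor (negForm B) (fun j => θ j.succ) (fun p => e (p.1.succ, p.2))) := fun i =>
        commute_rotor hB _ _ fun p => by simp [he, Prod.ext_iff, (Fin.succ_ne_zero _).symm]
      constructor
      · rw [mul_assoc, ← (hc 0).eq, ← mul_assoc, hp.1, mul_assoc]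
      · rw [mul_assoc, ← (hc 1).eq, ← mul_assoc, hp.2, mul_assoc]
    | succ j =>
      have h := ih (fun j => θ j.succ) (fun p => e (p.1.succ, p.2))
        (by intro i j; rw [he]; simp [Prod.ext_iff]) j
      have hc : ∀ a b : ℝ, Commute (ι (negForm B) (a • e (j.succ, 0) + b • e (j.succ, 1)))
          (algebraMap ℝ (CliffordAlgebra (negForm B)) (Real.cos (θ 0 / 2)) +
      Real.sin (θ 0 / 2) • (ι (negForm B) (e (0, 0)) * ι (negForm B) (e (0, 1)))) := fun a b =>
        commute_pair hB (by simp [he]) (by simp [he]) _ _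
      constructor
      · rw [mul_assoc, h.1, ← mul_assoc, ← (hc _ _).eq, mul_assoc]
      · rw [mul_assoc, h.2, ← mul_assoc, ← (hc _ _).eq, mul_assoc]

theorem associated_neg_negForm (hB : ∀ v w, B v w = B w v) (v : V) :
    QuadraticMap.associated (R := ℝ) (-(negForm B)) v = B v := by
  rw [negForm, neg_neg]
  exact LinearMap.congr_fun (QuadraticMap.associated_left_inverse ℝ hB) v

theorem contractLeft_pair_mul {d : Module.Dual ℝ V} {a b : V} (ha : d a = 0) (hb : d b = 0)
    {y : CliffordAlgebra (0 : QuadraticForm ℝ V)} (hy : contractLeft d y = 0) (c s : ℝ) :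
    contractLeft d ((algebraMap ℝ _ c + s • (ι 0 a * ι 0 b)) * y) = 0 := by
  rw [add_mul, map_add, contractLeft_algebraMap_mul, hy, smul_mul_assoc, map_smul, mul_assoc,
    contractLeft_ι_mul, contractLeft_ι_mul, hy, ha, hb]
  simp

theorem contractLeft_rotor {k : ℕ} (θ : Fin k → ℝ) (e : Fin k × Fin 2 → V)
    {d : Module.Dual ℝ V} (hd : ∀ i, d (e i) = 0) : contractLeft d (rotor 0 θ e) = 0 := by
  induction k with
  | zero => simp [rotor]
  | succ k ih =>
    rw [rotor_succ]
    exact contractLeft_pair_mul (hd _) (hd _) (ih _ _ fun i => hd _) _ _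

/-- Each contraction correction in the symbol pairs two distinct basis vectors, and these are
orthogonal. Hence the symbol is the same product, formed for the zero form. -/
theorem equivExterior_rotor (hB : ∀ v w, B v w = B w v) {k : ℕ} (θ : Fin k → ℝ)
    (e : Fin k × Fin 2 → V) (he : ∀ i j, B (e i) (e j) = if i = j then 1 else 0) :
    equivExterior (negForm B) (rotor (negForm B) θ e) = rotor 0 θ e := by
  simp only [equivExterior, changeFormEquiv_apply]
  induction k with
  | zero => simp [rotor]
  | succ k ih =>
    have h := ih (fun j => θ j.succ) (fun p => e (p.1.succ, p.2))
        (by intro i j; rw [he]; simp [Prod.ext_iff])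
    have hc : ∀ i, contractLeft (B (e (0, i)))
        (rotor 0 (fun j => θ j.succ) (fun p => e (p.1.succ, p.2))) = 0 := fun i =>
      contractLeft_rotor _ _ fun p => by simp [he, Prod.ext_iff, (Fin.succ_ne_zero _).symm]
    rw [rotor_succ, rotor_succ, add_mul, add_mul, map_add, ← Algebra.smul_def, ← Algebra.smul_def,
      map_smul, h, smul_mul_assoc, smul_mul_assoc, map_smul, mul_assoc, changeForm_ι_mul,
      changeForm_ι_mul, h, associated_neg_negForm hB, associated_neg_negForm hB, hc, sub_zero,
      contractLeft_ι_mul, hc, mul_zero, sub_zero, he]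
    simp [mul_assoc]

/-- The scalar part of an element of the Clifford algebra. -/
def scalarPart (Q : QuadraticForm ℝ V) : CliffordAlgebra Q →ₗ[ℝ] ℝ :=
  ExteriorAlgebra.algebraMapInv.toLinearMap ∘ₗ (equivExterior Q).toLinearMap

/-- The augmentation of the exterior algebra is multiplicative and kills vectors, so each factor
contributes only its cosine. -/
theorem scalarPart_rotor (hB : ∀ v w, B v w = B w v) {k : ℕ} (θ : Fin k → ℝ)
    (e : Fin k × Fin 2 → V) (he : ∀ i j, B (e i) (e j) = if i = j then 1 else 0) :
    scalarPart (negForm B) (rotor (negForm B) θ e) = ∏ j, Real.cos (θ j / 2) := by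
  rw [scalarPart, LinearMap.comp_apply, LinearEquiv.coe_coe, equivExterior_rotor hB θ e he, rotor,
    AlgHom.toLinearMap_apply]
  erw [map_list_prod]
  rw [List.map_ofFn, List.prod_ofFn]
  refine Finset.prod_congr rfl fun j _ => ?_
  have h1 : ∀ v : V, ExteriorAlgebra.algebraMapInv (R := ℝ) (ι (0 : QuadraticForm ℝ V) v) = 0 :=
    fun v => ExteriorAlgebra.lift_ι_apply ℝ _ _ v
  simp only [Function.comp_apply]
  erw [map_add, AlgHom.commutes, map_smul, map_mul, h1]
  simp

theorem scalarPart_map {W : Type*} [AddCommGroup W] [Module ℝ W] {Q : QuadraticForm ℝ V}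
    {Q' : QuadraticForm ℝ W} (f : Q →qᵢ Q') (x : CliffordAlgebra Q) :
    scalarPart Q' (CliffordAlgebra.map f x) = scalarPart Q x := by
  simp only [scalarPart, LinearMap.comp_apply, LinearEquiv.coe_coe, equivExterior_map,
    AlgHom.toLinearMap_apply]
  rw [← AlgHom.comp_apply]
  congr 1
  ext v
  simp [ExteriorAlgebra.algebraMapInv]

/-- The product `∏ e_{j,0} ∧ e_{j,1}`. -/
def pairWedge {k : ℕ} (e : Fin k × Fin 2 → V) : ExteriorAlgebra ℝ V :=
  (List.ofFn fun j : Fin k =>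
    ExteriorAlgebra.ι ℝ (e (j, 0)) * ExteriorAlgebra.ι ℝ (e (j, 1))).prod

theorem pairWedge_eq {k : ℕ} (e : Fin k × Fin 2 → V) :
    pairWedge e = wedge (fun i : Fin (k * 2) => e (finProdFinEquiv.symm i)) := by
  rw [wedge, ExteriorAlgebra.ιMulti_apply, List.ofFn_mul, List.prod_flatten, List.map_ofFn,
    pairWedge]
  congr 2
  ext j
  -- The pair `(j, i)` has number `2 j + i`, so the list of `2 k` vectors splits into consecutive
  -- pairs.
  have h : ∀ i : Fin 2, ∀ h, finProdFinEquiv.symm (⟨j * 2 + i, h⟩ : Fin (k * 2)) = (j, i) := by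
    intro i h
    rw [Equiv.symm_apply_eq]
    ext
    simp [finProdFinEquiv]; ring
  simp only [Function.comp_apply, List.ofFn_succ, List.ofFn_zero, List.prod_cons, List.prod_nil, mul_one,
    h]
  rfl

theorem proj_pair_mul (r : ℕ) (a b : V) (y : ExteriorAlgebra ℝ V) :
    GradedAlgebra.proj (fun i : ℕ => ⋀[ℝ]^i V) (r + 2)
      (ExteriorAlgebra.ι ℝ a * ExteriorAlgebra.ι ℝ b * y) =
      ExteriorAlgebra.ι ℝ a * ExteriorAlgebra.ι ℝ b *
        GradedAlgebra.proj (fun i : ℕ => ⋀[ℝ]^i V) r y := by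
  have h : ExteriorAlgebra.ι ℝ a * ExteriorAlgebra.ι ℝ b ∈ ⋀[ℝ]^2 V := by
    have h1 : ∀ v : V, ExteriorAlgebra.ι ℝ v ∈ LinearMap.range (ExteriorAlgebra.ι ℝ (M := V)) :=
      fun v => ⟨v, rfl⟩
    have h2 := Submodule.mul_mem_mul (h1 a) (h1 b)
    rwa [← pow_two] at h2
  rw [GradedAlgebra.proj_apply, GradedAlgebra.proj_apply, add_comm]
  exact DirectSum.coe_decompose_mul_add_of_left_mem (fun i : ℕ => ⋀[ℝ]^i V) h

/-- Every factor has degree at most 2, so degree `2 k` arises only from taking the sine term in all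
of them. The vanishing above degree `2 k` is needed for the cosine term in the induction. -/
theorem proj_rotor {k : ℕ} (θ : Fin k → ℝ) (e : Fin k × Fin 2 → V) :
    (∀ r > k * 2, GradedAlgebra.proj (fun i : ℕ => ⋀[ℝ]^i V) r (rotor 0 θ e) = 0) ∧
    GradedAlgebra.proj (fun i : ℕ => ⋀[ℝ]^i V) (k * 2) (rotor 0 θ e) =
      (∏ j, Real.sin (θ j / 2)) • pairWedge e := by
  induction k with
  | zero =>
    have h1 : (1 : ExteriorAlgebra ℝ V) ∈ ⋀[ℝ]^0 V := by
      have h := Submodule.algebraMap_mem (A := ExteriorAlgebra ℝ V) (1 : ℝ)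
      rwa [map_one, ← pow_zero (LinearMap.range (ExteriorAlgebra.ι ℝ (M := V)))] at h
    have h2 : rotor 0 θ e = (1 : ExteriorAlgebra ℝ V) := by simp [rotor]
    constructor
    · intro r hr
      rw [h2, proj_of_mem r h1, if_neg (by omega)]
    · rw [h2, proj_of_mem _ h1]; simp [pairWedge]
  | succ k ih =>
    obtain ⟨h1, h2⟩ := ih (fun j => θ j.succ) (fun p => e (p.1.succ, p.2))
    have key : ∀ r, GradedAlgebra.proj (fun i : ℕ => ⋀[ℝ]^i V) (r + 2) (rotor 0 θ e) =
        Real.cos (θ 0 / 2) • GradedAlgebra.proj (fun i : ℕ => ⋀[ℝ]^i V) (r + 2)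
          (rotor 0 (fun j => θ j.succ) (fun p => e (p.1.succ, p.2))) +
        Real.sin (θ 0 / 2) • (ExteriorAlgebra.ι ℝ (e (0, 0)) * ExteriorAlgebra.ι ℝ (e (0, 1)) *
          GradedAlgebra.proj (fun i : ℕ => ⋀[ℝ]^i V) r
          (rotor 0 (fun j => θ j.succ) (fun p => e (p.1.succ, p.2)))) := by
      intro r
      rw [rotor_succ, add_mul, ← Algebra.smul_def, map_add, map_smul, smul_mul_assoc, map_smul,
        ← proj_pair_mul]
    constructor
    · intro r hr
      obtain ⟨r, rfl⟩ : ∃ r', r = r' + 2 := ⟨r - 2, by omega⟩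
      rw [key, h1 _ (by omega), h1 _ (by omega)]
      simp
    · rw [show (k + 1) * 2 = k * 2 + 2 by ring, key, h1 _ (by omega), h2, Fin.prod_univ_succ,
        smul_zero, zero_add, mul_smul_comm, smul_smul]
      conv_rhs => rw [pairWedge, List.ofFn_succ, List.prod_cons]
      rfl

/-- With all angles equal to `π` the rotor has this product as its symbol, and a rotor is
invertible. -/
theorem pairWedge_ne_zero (hB : ∀ v w, B v w = B w v) {k : ℕ} (e : Fin k × Fin 2 → V)
    (he : ∀ i j, B (e i) (e j) = if i = j then 1 else 0) : pairWedge e ≠ 0 := by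
  intro h0
  have h1 := rotor_mul_star hB (fun _ => Real.pi) e he
  have h2 := equivExterior_rotor hB (fun _ => Real.pi) e he
  have h3 : rotor (0 : QuadraticForm ℝ V) (fun _ => Real.pi) e = pairWedge e := by
    simp [rotor, pairWedge]
  rw [h3, h0, LinearEquiv.map_eq_zero_iff] at h2
  rw [h2, zero_mul] at h1
  exact zero_ne_one h1

/-- An alternating map in `r` variables on an `r`-dimensional space is a multiple of the
determinant, also when its values lie in the exterior algebra of a larger space. -/
theorem wedge_eq_det_smul {N : Submodule ℝ V} {r : ℕ} (b : Module.Basis (Fin r) ℝ N)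
    (f : Fin r → N) :
    wedge (fun i => (f i : V)) = b.det f • wedge (fun i => (b i : V)) := by
  let φ : N [⋀^Fin r]→ₗ[ℝ] ExteriorAlgebra ℝ V := (ExteriorAlgebra.ιMulti ℝ r).compLinearMap N.subtype
  have : φ = (LinearMap.toSpanSingleton ℝ _ (φ b)).compAlternatingMap b.det := by
    refine Module.Basis.ext_alternating b fun v hv => ?_
    let σ : Equiv.Perm (Fin r) := Equiv.ofBijective v (Finite.injective_iff_bijective.mp hv)
    have h1 : (fun i => b (v i)) = b ∘ σ := rfl
    simp only [h1, LinearMap.compAlternatingMap_apply, LinearMap.toSpanSingleton_apply]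
    rw [AlternatingMap.map_perm, AlternatingMap.map_perm, b.det_self]
    simp
  exact congrArg (fun ψ => ψ f) this

end Rotor

/-! ### Normal form of an isometry without fixed vectors -/

section NormalForm

open scoped InnerProductSpace

/-- `A` is the rotation by the angles `θ_j` in the planes spanned by `e_{j,0}, e_{j,1}`. -/
def IsBlock {V : Type*} [AddCommGroup V] [Module ℝ V] (A : V → V) {k : ℕ} (θ : Fin k → ℝ)
    (e : Fin k × Fin 2 → V) : Prop :=
  (∀ j, 0 < θ j ∧ θ j ≤ Real.pi) ∧
  (∀ j, A (e (j, 0)) = Real.cos (θ j) • e (j, 0) + Real.sin (θ j) • e (j, 1)) ∧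
  (∀ j, A (e (j, 1)) = -Real.sin (θ j) • e (j, 0) + Real.cos (θ j) • e (j, 1))

variable {V : Type*} [NormedAddCommGroup V] [InnerProductSpace ℝ V]

/-- `A + A⁻¹` is symmetric, so it has an eigenvector `a` in `K`. Then `A² a` is a combination of `A
a` and `a`, and `a`, `A a` span an invariant plane on which `A` is a rotation, unless `A a = -a`. -/
theorem exists_block_vector [FiniteDimensional ℝ V] (A : V ≃ₗᵢ[ℝ] V) (hfix : ∀ v, A v = v → v = 0) (K : Submodule ℝ V)
    (hK : ∀ v ∈ K, A v ∈ K) (hK' : ∀ v ∈ K, A.symm v ∈ K) (hne : K ≠ ⊥) :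
    (∃ u ∈ K, ‖u‖ = 1 ∧ A u = -u) ∨ ∃ a ∈ K, ∃ b ∈ K, ∃ t : ℝ, ‖a‖ = 1 ∧ ‖b‖ = 1 ∧ ⟪a, b⟫_ℝ = 0 ∧
      0 < t ∧ t ≤ Real.pi ∧ A a = Real.cos t • a + Real.sin t • b ∧
      A b = -Real.sin t • a + Real.cos t • b := by
  let S : V →ₗ[ℝ] V := A.toLinearEquiv.toLinearMap + A.symm.toLinearEquiv.toLinearMap
  have hSv : ∀ v, S v = A v + A.symm v := fun v => rfl
  have hadj : ∀ v w, ⟪A v, w⟫_ℝ = ⟪v, A.symm w⟫_ℝ := by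
    intro v w
    rw [← A.inner_map_map v (A.symm w), A.apply_symm_apply]
  have hadj' : ∀ v w, ⟪A.symm v, w⟫_ℝ = ⟪v, A w⟫_ℝ := by
    intro v w
    rw [← A.inner_map_map (A.symm v) w, A.apply_symm_apply]
  have hS : S.IsSymmetric := by
    intro v w
    rw [hSv, hSv, inner_add_left, inner_add_right, hadj, hadj', add_comm]
  have hSK : ∀ v ∈ K, S v ∈ K := fun v hv => K.add_mem (hK v hv) (hK' v hv)
  have hSr := hS.restrict_invariant hSK
  have : ∃ μ : ℝ, Module.End.HasEigenvalue (S.restrict hSK) μ := by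
    by_contra h
    push Not at h
    have := hSr.subsingleton_of_no_eigenvalue_finiteDimensional (fun μ => by
      by_contra hc
      exact h μ hc)
    exact hne (Submodule.subsingleton_iff_eq_bot.mp this)
  obtain ⟨μ, hμ⟩ := this
  obtain ⟨v, hv⟩ := hμ.exists_hasEigenvector
  have hv0 : (v : V) ≠ 0 := fun h => hv.2 (Subtype.ext h)
  have hv1 : S v = μ • (v : V) := congrArg Subtype.val hv.apply_eq_smul
  set a : V := ‖(v : V)‖⁻¹ • (v : V) with ha
  have haK : a ∈ K := K.smul_mem _ v.2
  have han : ‖a‖ = 1 := by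
    rw [ha, norm_smul, norm_inv, norm_norm, inv_mul_cancel₀ (norm_ne_zero_iff.mpr hv0)]
  have ha0 : a ≠ 0 := by
    intro h; rw [h, norm_zero] at han; exact zero_ne_one han
  have hSa : A a + A.symm a = μ • a := by
    rw [← hSv, ha, map_smul, hv1, smul_comm]
  clear_value a
  by_cases hneg : A a = -a
  · exact Or.inl ⟨a, haK, han, hneg⟩
  right
  set c : ℝ := ⟪a, A a⟫_ℝ with hc
  have hAan : ‖A a‖ = 1 := by rw [A.norm_map, han]
  have haa : ⟪a, a⟫_ℝ = 1 := by rw [real_inner_self_eq_norm_sq, han]; norm_num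
  have hAA : ⟪A a, A a⟫_ℝ = 1 := by rw [real_inner_self_eq_norm_sq, hAan]; norm_num
  have hμc : μ = 2 * c := by
    have h := congrArg (fun x => ⟪a, x⟫_ℝ) hSa
    simp only [inner_add_right, inner_smul_right, haa] at h
    have h' : ⟪a, A.symm a⟫_ℝ = c := by rw [← hadj, real_inner_comm]
    rw [h', ← hc] at h
    linarith
  have hc1 : c < 1 := by
    refine lt_of_le_of_ne ?_ ?_
    · have := real_inner_le_norm a (A a); rwa [han, hAan, mul_one] at this
    · intro h
      have h2 := (inner_eq_one_iff_of_norm_eq_one (𝕜 := ℝ) han hAan).mp h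
      exact ha0 (hfix a h2.symm)
  have hc2 : -1 < c := by
    refine lt_of_le_of_ne ?_ ?_
    · have := neg_le_of_abs_le (abs_real_inner_le_norm a (A a)); rwa [han, hAan, mul_one] at this
    · intro h
      have h2 := (inner_eq_one_iff_of_norm_eq_one (𝕜 := ℝ) han (by rwa [norm_neg])).mp
        (show ⟪a, -A a⟫_ℝ = 1 by rw [inner_neg_right, ← hc, ← h, neg_neg])
      exact hneg (neg_eq_iff_eq_neg.mpr h2).symm
  -- The cosine `c` is neither `1`, which would make `a` fixed, nor `-1`, which would give `A a =
  -- -a`; so the angle lies strictly between `0` and `π`.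
  set t := Real.arccos c with ht
  have hcos : Real.cos t = c := Real.cos_arccos hc2.le hc1.le
  have hsin : 0 < Real.sin t := by
    refine Real.sin_pos_of_pos_of_lt_pi (Real.arccos_pos.mpr hc1) ?_
    refine lt_of_le_of_ne (Real.arccos_le_pi c) fun h => ?_
    rw [h, Real.cos_pi] at hcos
    linarith
  have hsq := Real.sin_sq_add_cos_sq t
  set s := Real.sin t with hs
  set b : V := s⁻¹ • (A a - c • a) with hb
  have hsb : s • b = A a - c • a := by rw [hb, smul_inv_smul₀ hsin.ne']
  have hab : ⟪a, b⟫_ℝ = 0 := by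
    rw [hb, inner_smul_right, inner_sub_right, inner_smul_right, haa, ← hc]; simp
  have hbb : ‖b‖ = 1 := by
    have h : s ^ 2 * ‖b‖ ^ 2 = s ^ 2 := by
      have : ⟪s • b, s • b⟫_ℝ = s ^ 2 * ‖b‖ ^ 2 := by
        rw [inner_smul_left, inner_smul_right, real_inner_self_eq_norm_sq]; simp; ring
      rw [← this, hsb]
      simp only [inner_sub_left, inner_sub_right, inner_smul_left, inner_smul_right, haa, hAA]
      rw [real_inner_comm a (A a)] 
      simp only [← hc]
      rw [hcos] at hsq
      simp
      linarith
    have h2 : ‖b‖ ^ 2 = 1 := by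
      have := hsin.ne'
      field_simp at h
      exact h
    nlinarith [norm_nonneg b]
  refine ⟨a, haK, b, K.smul_mem _ (K.sub_mem (hK _ haK) (K.smul_mem _ haK)), t, han, hbb, hab,
    Real.arccos_pos.mpr hc1, Real.arccos_le_pi c, ?_, ?_⟩
  · rw [hcos, hsb]; abel
  · have hAAa : A (A a) = μ • A a - a := by
      have := congrArg A hSa
      rw [map_add, A.apply_symm_apply, map_smul] at this
      rw [← this]; abel
    -- After multiplication by `s` this follows from `A² a = 2 c A a - a`; the nonzero factor `s` is
    -- then cancelled.
    have h1 : s • A b = s • (-s • a + c • b) := by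
      rw [← map_smul, hsb, map_sub, map_smul, hAAa, smul_add, smul_comm s c, hsb, hμc]
      rw [hcos] at hsq
      have : s * s = 1 - c * c := by linarith
      match_scalars
      · ring
      · linear_combination this
    rw [hcos]
    exact smul_right_injective V hsin.ne' h1

theorem isBlock_cons {A : V → V} {k : ℕ} {θ : Fin k → ℝ} {e : Fin k × Fin 2 → V}
    (hA : IsBlock A θ e) (he : ∀ i j, ⟪e i, e j⟫_ℝ = if i = j then 1 else 0)
    {a b : V} {t : ℝ} (ha : ‖a‖ = 1) (hb : ‖b‖ = 1) (hab : ⟪a, b⟫_ℝ = 0)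
    (hea : ∀ i, ⟪e i, a⟫_ℝ = 0) (heb : ∀ i, ⟪e i, b⟫_ℝ = 0) (ht : 0 < t) (ht' : t ≤ Real.pi)
    (hAa : A a = Real.cos t • a + Real.sin t • b) (hAb : A b = -Real.sin t • a + Real.cos t • b) :
    ∃ (θ' : Fin (k + 1) → ℝ) (e' : Fin (k + 1) × Fin 2 → V), IsBlock A θ' e' ∧
      ∀ i j, ⟪e' i, e' j⟫_ℝ = if i = j then 1 else 0 := by
  let e' : Fin (k + 1) × Fin 2 → V := fun p => Fin.cases (![a, b] p.2) (fun j => e (j, p.2)) p.1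
  refine ⟨Fin.cons t θ, e', ⟨?_, ?_, ?_⟩, ?_⟩
  · exact fun j => Fin.cases ⟨ht, ht'⟩ (fun j => hA.1 j) j
  · exact fun j => Fin.cases hAa (fun j => hA.2.1 j) j
  · exact fun j => Fin.cases hAb (fun j => hA.2.2 j) j
  · have haa : ⟪a, a⟫_ℝ = 1 := by rw [real_inner_self_eq_norm_sq, ha]; norm_num
    have hbb : ⟪b, b⟫_ℝ = 1 := by rw [real_inner_self_eq_norm_sq, hb]; norm_num
    have hba : ⟪b, a⟫_ℝ = 0 := by rw [real_inner_comm, hab]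
    have h1 : ∀ i (x : Fin 2), ⟪e i, ![a, b] x⟫_ℝ = 0 := by
      intro i x; fin_cases x; exacts [hea i, heb i]
    rintro ⟨i, x⟩ ⟨j, y⟩
    refine Fin.cases ?_ (fun i => ?_) i <;> refine Fin.cases ?_ (fun j => ?_) j
    · fin_cases x <;> fin_cases y <;> simp [e', ha, hb, hab, hba]
    · rw [if_neg (by simp [(Fin.succ_ne_zero _).symm]), real_inner_comm]
      exact h1 (j, y) x
    · rw [if_neg (by simp)]
      exact h1 (i, x) y
    · have := he (i, x) (j, y)
      simpa [e', Prod.ext_iff] using this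

/-- Take as many orthonormal blocks as possible. The complement is invariant and contains no further
block, so it only yields eigenvectors for `-1`; two orthogonal ones would form a block of angle `π`.
What remains is at most a line. -/
theorem exists_isBlock [FiniteDimensional ℝ V] (A : V ≃ₗᵢ[ℝ] V) (hfix : ∀ v, A v = v → v = 0) :
    ∃ (k : ℕ) (θ : Fin k → ℝ) (e : Fin k × Fin 2 → V), IsBlock A θ e ∧
      (∀ i j, ⟪e i, e j⟫_ℝ = if i = j then 1 else 0) ∧
      ((∀ v, (∀ i, ⟪e i, v⟫_ℝ = 0) → v = 0) ∨
        ∃ u, ⟪u, u⟫_ℝ = 1 ∧ A u = -u ∧ (∀ i, ⟪e i, u⟫_ℝ = 0) ∧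
          ∀ v, (∀ i, ⟪e i, v⟫_ℝ = 0) → ⟪u, v⟫_ℝ = 0 → v = 0) := by
  classical
  let P : ℕ → Prop := fun k => ∃ (θ : Fin k → ℝ) (e : Fin k × Fin 2 → V), IsBlock A θ e ∧
      (∀ i j, ⟪e i, e j⟫_ℝ = if i = j then 1 else 0)
  have hP0 : P 0 := ⟨fun j => j.elim0, fun p => p.1.elim0,
    ⟨fun j => j.elim0, fun j => j.elim0, fun j => j.elim0⟩, fun p => p.1.elim0⟩
  have hbound : ∀ k, P k → k ≤ Module.finrank ℝ V := by
    rintro k ⟨θ, e, -, he⟩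
    have h := (orthonormal_iff_ite.mpr he).linearIndependent.fintype_card_le_finrank
    simp at h
    omega
  obtain ⟨θ, e, hA, he⟩ : P (Nat.findGreatest P (Module.finrank ℝ V)) :=
    Nat.findGreatest_spec (Nat.zero_le _) hP0
  have hmax : ¬ P (Nat.findGreatest P (Module.finrank ℝ V) + 1) := fun h =>
    Nat.findGreatest_is_greatest (Nat.lt_succ_self _) (hbound _ h) h
  generalize Nat.findGreatest P (Module.finrank ℝ V) = k at *
  refine ⟨k, θ, e, hA, he, ?_⟩
  by_cases hz : ∀ v, (∀ i, ⟪e i, v⟫_ℝ = 0) → v = 0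
  · exact Or.inl hz
  right
  have hsymm : ∀ j, A.symm (e (j, 0)) = Real.cos (θ j) • e (j, 0) - Real.sin (θ j) • e (j, 1) ∧
      A.symm (e (j, 1)) = Real.sin (θ j) • e (j, 0) + Real.cos (θ j) • e (j, 1) := by
    intro j
    have h := Real.sin_sq_add_cos_sq (θ j)
    constructor
    · rw [LinearIsometryEquiv.symm_apply_eq, map_sub, map_smul, map_smul, hA.2.1, hA.2.2]
      match_scalars
      · linear_combination -h
      · ring
    · rw [LinearIsometryEquiv.symm_apply_eq, map_add, map_smul, map_smul, hA.2.1, hA.2.2]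
      match_scalars
      · linear_combination -h
      · ring
  have hadj : ∀ v w, ⟪v, A w⟫_ℝ = ⟪A.symm v, w⟫_ℝ := by
    intro v w
    rw [← A.inner_map_map (A.symm v) w, A.apply_symm_apply]
  have hadj' : ∀ v w, ⟪v, A.symm w⟫_ℝ = ⟪A v, w⟫_ℝ := by
    intro v w
    rw [← A.inner_map_map v (A.symm w), A.apply_symm_apply]
  let K : Submodule ℝ V := (Submodule.span ℝ (Set.range e))ᗮ
  have memK : ∀ v, v ∈ K ↔ ∀ i, ⟪e i, v⟫_ℝ = 0 := by
    intro v
    rw [Submodule.mem_orthogonal]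
    constructor
    · exact fun h i => h _ (Submodule.subset_span ⟨i, rfl⟩)
    · intro h u hu
      induction hu using Submodule.span_induction with
      | mem x hx => obtain ⟨i, rfl⟩ := hx; exact h i
      | zero => simp
      | add x y _ _ hx hy => rw [inner_add_left, hx, hy, add_zero]
      | smul a x _ hx => rw [inner_smul_left, hx, mul_zero]
  have hAK : ∀ v ∈ K, A v ∈ K := by
    intro v hv
    rw [memK] at hv ⊢
    rintro ⟨j, x⟩
    rw [hadj]
    fin_cases x
    · simp only [Fin.zero_eta, (hsymm j).1, inner_sub_left, inner_smul_left, hv]; simp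
    · simp only [Fin.mk_one, (hsymm j).2, inner_add_left, inner_smul_left, hv]; simp
  have hAK' : ∀ v ∈ K, A.symm v ∈ K := by
    intro v hv
    rw [memK] at hv ⊢
    rintro ⟨j, x⟩
    rw [hadj']
    fin_cases x
    · simp only [Fin.zero_eta, hA.2.1 j, inner_add_left, inner_smul_left, hv]; simp
    · simp only [Fin.mk_one, hA.2.2 j, inner_add_left, inner_smul_left, hv]; simp
  have hKne : K ≠ ⊥ := by
    intro h
    refine hz fun v hv => ?_
    have := (memK v).mpr hv
    rwa [h, Submodule.mem_bot] at this
  have hno : ¬ ∃ a ∈ K, ∃ b ∈ K, ∃ t : ℝ, ‖a‖ = 1 ∧ ‖b‖ = 1 ∧ ⟪a, b⟫_ℝ = 0 ∧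
      0 < t ∧ t ≤ Real.pi ∧ A a = Real.cos t • a + Real.sin t • b ∧
      A b = -Real.sin t • a + Real.cos t • b := by
    rintro ⟨a, ha, b, hb, t, h1, h2, h3, h4, h5, h6, h7⟩
    exact hmax (isBlock_cons hA he h1 h2 h3 ((memK a).mp ha) ((memK b).mp hb) h4 h5 h6 h7)
  obtain ⟨u, huK, hun, hAu⟩ := (exists_block_vector A hfix K hAK hAK' hKne).resolve_right hno
  refine ⟨u, by rw [real_inner_self_eq_norm_sq, hun]; norm_num, hAu, (memK u).mp huK, ?_⟩
  by_contra hcon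
  push Not at hcon
  obtain ⟨v, hv1, hv2, hv3⟩ := hcon
  have hAu' : A.symm u = -u := by rw [LinearIsometryEquiv.symm_apply_eq, map_neg, hAu, neg_neg]
  -- If the complement were larger than the line of `u`, this invariant subspace would be nonzero
  -- and would supply either a block or a second eigenvector for `-1`.
  let K' : Submodule ℝ V := K ⊓ (ℝ ∙ u)ᗮ
  have memK' : ∀ v, v ∈ K' ↔ v ∈ K ∧ ⟪u, v⟫_ℝ = 0 := by
    intro v
    rw [Submodule.mem_inf, Submodule.mem_orthogonal_singleton_iff_inner_right]
  obtain h | h := exists_block_vector A hfix K'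
    (fun v hv => by
      rw [memK'] at hv ⊢
      exact ⟨hAK v hv.1, by rw [hadj, hAu', inner_neg_left, hv.2, neg_zero]⟩)
    (fun v hv => by
      rw [memK'] at hv ⊢
      exact ⟨hAK' v hv.1, by rw [hadj', hAu, inner_neg_left, hv.2, neg_zero]⟩)
    (fun h => by
      have := (memK' v).mpr ⟨(memK v).mpr hv1, hv2⟩
      rw [h, Submodule.mem_bot] at this
      exact hv3 this)
  · obtain ⟨b, hb, hbn, hAb⟩ := h
    rw [memK'] at hb
    exact hno ⟨u, huK, b, hb.1, Real.pi, hun, hbn, hb.2, Real.pi_pos, le_rfl, by simp [hAu],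
      by simp [hAb]⟩
  · obtain ⟨a, ha, b, hb, h⟩ := h
    exact hno ⟨a, ((memK' a).mp ha).1, b, ((memK' b).mp hb).1, h⟩

end NormalForm

/-! ### Lifts of an isometry to the Clifford algebra -/

section Lift

open CliffordAlgebra

/-- `exists_isBlock` for an abstract positive definite symmetric form. -/
theorem exists_isBlock_bilin {V : Type*} [AddCommGroup V] [Module ℝ V] [FiniteDimensional ℝ V]
    (B : V →ₗ[ℝ] V →ₗ[ℝ] ℝ) (hB : ∀ v w, B v w = B w v) (hpos : ∀ v, v ≠ 0 → 0 < B v v)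
    (A : V →ₗ[ℝ] V) (hA : ∀ v w, B (A v) (A w) = B v w) (hfix : ∀ v, A v = v → v = 0) :
    ∃ (k : ℕ) (θ : Fin k → ℝ) (e : Fin k × Fin 2 → V), IsBlock A θ e ∧
      (∀ i j, B (e i) (e j) = if i = j then 1 else 0) ∧
      ((∀ v, (∀ i, B (e i) v = 0) → v = 0) ∨
        ∃ u, B u u = 1 ∧ A u = -u ∧ (∀ i, B (e i) u = 0) ∧
          ∀ v, (∀ i, B (e i) v = 0) → B u v = 0 → v = 0) := by
  have hnonneg : ∀ v, 0 ≤ B v v := fun v => by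
    by_cases h : v = 0
    · simp [h]
    · exact (hpos v h).le
  -- Tangent spaces carry the metric only as a bilinear form; the inner product structure is
  -- installed for this proof alone.
  let c : InnerProductSpace.Core ℝ V :=
    { inner := fun v w => B v w
      conj_inner_symm := fun v w => hB w v
      re_inner_nonneg := fun v => hnonneg v
      add_left := by intro x y z; simp
      smul_left := by intro x y r; simp
      definite := fun v hv => by
        by_contra h
        exact (hpos v h).ne' hv }
  let : NormedAddCommGroup V := c.toNormedAddCommGroup
  let : InnerProductSpace ℝ V := InnerProductSpace.ofCore c.toCore
  have hinner : ∀ v w : V, inner ℝ v w = B v w := fun v w => rfl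
  have hnorm : ∀ v : V, ‖A v‖ = ‖v‖ := by
    intro v
    rw [← sq_eq_sq₀ (norm_nonneg _) (norm_nonneg _), ← real_inner_self_eq_norm_sq,
      ← real_inner_self_eq_norm_sq, hinner, hinner, hA]
  let A' : V →ₗᵢ[ℝ] V := ⟨A, hnorm⟩
  obtain ⟨k, θ, e, h⟩ := exists_isBlock (A'.toLinearIsometryEquiv rfl) hfix
  exact ⟨k, θ, e, h⟩

variable {V : Type*} [AddCommGroup V] [Module ℝ V]
  {B : V →ₗ[ℝ] V →ₗ[ℝ] ℝ}

/-- `y` is a unit even element of the Clifford algebra which covers `A`. -/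
structure IsLift (B : V →ₗ[ℝ] V →ₗ[ℝ] ℝ) (A : V → V) (y : CliffordAlgebra (negForm B)) :
    Prop where
  even : involute y = y
  mul_star : y * star y = 1
  star_mul : star y * y = 1
  mul_ι : ∀ v, y * ι (negForm B) v = ι (negForm B) (A v) * y

theorem IsLift.star_mul_ι {A : V → V} {y : CliffordAlgebra (negForm B)} (hy : IsLift B A y)
    (v : V) : star y * ι (negForm B) (A v) = ι (negForm B) v * star y := by
  calc star y * ι (negForm B) (A v) = star y * (ι (negForm B) (A v) * y) * star y := by
        rw [mul_assoc, mul_assoc, hy.mul_star, mul_one]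
    _ = _ := by rw [← hy.mul_ι, ← mul_assoc, hy.star_mul, one_mul]

theorem involute_star {Q : QuadraticForm ℝ V} {y : CliffordAlgebra Q} (hy : involute y = y) :
    involute (star y) = star y := by
  rw [star_def', involute_involute, ← reverse_involute, hy]

/-- The quotient `star y * y'` is even and commutes with all vectors, so it is a scalar; unitarity
makes its square `1`. -/
theorem IsLift.eq_or_eq_neg [FiniteDimensional ℝ V] (hB : ∀ v w, B v w = B w v)
    (hpos : ∀ v, v ≠ 0 → 0 < B v v) {A : V → V} {y y' : CliffordAlgebra (negForm B)}
    (hy : IsLift B A y) (hy' : IsLift B A y') : y' = y ∨ y' = -y := by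
  obtain ⟨c, hc⟩ := mem_range_algebraMap_of_twisted_commute hB hpos (y := star y * y') (by
    intro v
    rw [map_mul, involute_star hy.even, hy'.even, ← mul_assoc, ← hy.star_mul_ι, mul_assoc,
      ← hy'.mul_ι, mul_assoc])
  have h1 : y' = c • y := by
    rw [Algebra.smul_def, Algebra.commutes, ← hc, ← mul_assoc, hy.mul_star, one_mul]
  have h2 : c * c = 1 := by
    have h := hy'.mul_star
    rw [h1, CliffordAlgebra.star_smul, smul_mul_smul_comm, hy.mul_star,
      ← Algebra.algebraMap_eq_smul_one, ← map_one (algebraMap ℝ _)] at h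
    exact (algebraMap ℝ (CliffordAlgebra (negForm B))).injective h
  rcases mul_self_eq_one_iff.mp h2 with h | h
  · left; rw [h1, h, one_smul]
  · right; rw [h1, h, neg_smul, one_smul]

/-- The space of vectors orthogonal to the vectors fixed by `A`. -/
def IsNormal (B : V →ₗ[ℝ] V →ₗ[ℝ] ℝ) (A : V →ₗ[ℝ] V) (N : Submodule ℝ V) : Prop :=
  ∀ v, v ∈ N ↔ ∀ w, A w = w → B v w = 0

theorem IsNormal.isCompl [FiniteDimensional ℝ V] (hB : ∀ v w, B v w = B w v)
    (hpos : ∀ v, v ≠ 0 → 0 < B v v) {A : V →ₗ[ℝ] V} {N : Submodule ℝ V} (hN : IsNormal B A N) :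
    IsCompl (LinearMap.ker (A - LinearMap.id)) N := by
  have h1 : N = LinearMap.BilinForm.orthogonal B (LinearMap.ker (A - LinearMap.id)) := by
    ext v
    rw [hN v, LinearMap.BilinForm.mem_orthogonal_iff]
    simp only [LinearMap.mem_ker, LinearMap.sub_apply, LinearMap.id_apply, sub_eq_zero]
    exact forall₂_congr fun w _ => by rw [hB]
  rw [h1]
  refine (LinearMap.BilinForm.isCompl_orthogonal_iff_disjoint
    (fun v w (h : B v w = 0) => (hB w v).trans h)).mpr ?_
  rw [Submodule.disjoint_def]
  intro v hv hv'
  by_contra h0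
  exact (hpos v h0).ne' (LinearMap.BilinForm.mem_orthogonal_iff.mp hv' v hv)

/-- The setting of the local computation: an orthonormal basis of `N` adapted to `A`. -/
structure IsAdapted (B : V →ₗ[ℝ] V →ₗ[ℝ] ℝ) (A : V →ₗ[ℝ] V) (N : Submodule ℝ V) {k : ℕ}
    (θ : Fin k → ℝ) (e : Module.Basis (Fin k × Fin 2) ℝ N) : Prop where
  orthonormal : ∀ i j, B (e i) (e j) = if i = j then 1 else 0
  block : IsBlock A θ (fun i => (e i : V))

/-- Since `V = ker (A - 1) ⊕ N`, a linear condition need only be tested on fixed vectors and on `N`.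
-/
theorem forall_of_ker_of_basis [FiniteDimensional ℝ V] (hB : ∀ v w, B v w = B w v)
    (hpos : ∀ v, v ≠ 0 → 0 < B v v) {A : V →ₗ[ℝ] V} {N : Submodule ℝ V} (hN : IsNormal B A N)
    (M : Submodule ℝ V) (hker : ∀ v, A v = v → v ∈ M) (hNM : N ≤ M) (v : V) : v ∈ M := by
  have h := (hN.isCompl hB hpos).sup_eq_top
  have h2 : (⊤ : Submodule ℝ V) ≤ M := by
    rw [← h]
    refine sup_le (fun v hv => hker v ?_) hNM
    rwa [LinearMap.mem_ker, LinearMap.sub_apply, sub_eq_zero] at hv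
  exact h2 trivial

theorem IsAdapted.isLift_rotor [FiniteDimensional ℝ V] (hB : ∀ v w, B v w = B w v)
    (hpos : ∀ v, v ≠ 0 → 0 < B v v) {A : V →ₗ[ℝ] V} {N : Submodule ℝ V} (hN : IsNormal B A N)
    {k : ℕ} {θ : Fin k → ℝ} {e : Module.Basis (Fin k × Fin 2) ℝ N} (h : IsAdapted B A N θ e) :
    IsLift B A (rotor (negForm B) θ (fun i => (e i : V))) := by
  have hms := rotor_mul_star hB θ _ h.orthonormal
  have hsm : star (rotor (negForm B) θ (fun i => (e i : V))) *
      rotor (negForm B) θ (fun i => (e i : V)) = 1 := star_rotor_mul hB θ _ h.orthonormal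
  refine ⟨involute_rotor _ _ _, hms, hsm, ?_⟩
  set r := rotor (negForm B) θ (fun i => (e i : V))
  let M : Submodule ℝ V := LinearMap.ker
    (LinearMap.mulLeft ℝ r ∘ₗ ι (negForm B) - LinearMap.mulRight ℝ r ∘ₗ ι (negForm B) ∘ₗ A)
  have hM : ∀ v, v ∈ M ↔ r * ι (negForm B) v = ι (negForm B) (A v) * r := by
    intro v
    rw [LinearMap.mem_ker, LinearMap.sub_apply, sub_eq_zero]
    rfl
  intro v
  refine (hM v).mp (forall_of_ker_of_basis hB hpos hN M (fun v hv => ?_) ?_ v)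
  · rw [hM, hv]
    refine (commute_rotor hB θ _ fun i => ?_).symm
    rw [hB]
    exact (hN _).mp (e i).2 v hv
  · have : N = Submodule.span ℝ (Set.range fun i => (e i : V)) := by
      have h := congrArg (Submodule.map N.subtype) e.span_eq
      rw [Submodule.map_span, Submodule.map_top, Submodule.range_subtype, ← Set.range_comp] at h
      exact h.symm
    rw [this, Submodule.span_le]
    rintro _ ⟨⟨j, x⟩, rfl⟩
    have := rotor_mul_ι hB θ _ h.orthonormal j
    simp only [SetLike.mem_coe, hM]
    fin_cases x
    · simp only [Fin.zero_eta, h.block.2.1 j]; exact this.1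
    · simp only [Fin.mk_one, h.block.2.2 j]; exact this.2

theorem isometry_restrict {A : V →ₗ[ℝ] V} {N : Submodule ℝ V}
    (hA : ∀ v w, B (A v) (A w) = B v w) (hN : IsNormal B A N) : ∀ v ∈ N, A v ∈ N := by
  intro v hv
  rw [hN] at hv ⊢
  intro w hw
  rw [← hw, hA, hv w hw]

/-- The normal form may leave a unit vector `u` with `A u = -u`, which would make `A` orientation
reversing. A lift, being even, excludes this: dividing it by the rotor of the blocks would give a
lift of the reflection in `u`, and no even element covers a reflection. -/
theorem exists_isAdapted [FiniteDimensional ℝ V] (hB : ∀ v w, B v w = B w v)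
    (hpos : ∀ v, v ≠ 0 → 0 < B v v) {A : V →ₗ[ℝ] V} (hA : ∀ v w, B (A v) (A w) = B v w)
    {N : Submodule ℝ V} (hN : IsNormal B A N) {y : CliffordAlgebra (negForm B)}
    (hy : IsLift B A y) :
    ∃ (k : ℕ) (θ : Fin k → ℝ) (e : Module.Basis (Fin k × Fin 2) ℝ N), IsAdapted B A N θ e := by
  obtain ⟨k, θ, e, hbl, he, hfin⟩ := exists_isBlock_bilin (B.domRestrict₁₂ N N)
    (fun v w => hB v w) (fun v hv => hpos v fun h => hv (Subtype.ext h))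
    (A.restrict (isometry_restrict hA hN)) (fun v w => hA v w) (fun v hv => by
      have h1 : A v = v := congrArg Subtype.val hv
      have h2 := (hN v).mp v.2 v h1
      by_contra h
      exact (hpos v fun h' => h (Subtype.ext h')).ne' h2)
  have he' : ∀ i j, B (e i) (e j) = if i = j then 1 else 0 := he
  have hbl' : IsBlock A θ (fun i => (e i : V)) :=
    ⟨hbl.1, fun j => congrArg Subtype.val (hbl.2.1 j), fun j => congrArg Subtype.val (hbl.2.2 j)⟩
  have hli : LinearIndependent ℝ e := by
    rw [Fintype.linearIndependent_iff]
    intro g hg i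
    have h := congrArg (fun x : N => B (e i) x) hg
    simpa [he'] using h
  have hsub : ∀ n : N, ∀ i, B (e i) (n - ∑ j, B (e j) n • (e j : V)) = 0 := by
    intro n i
    simp [map_sub, map_sum, he']
  rcases hfin with hfin | ⟨u, huu, hAu, heu, hfin⟩
  · have hfin' : ∀ v : N, (∀ i, B (e i) v = 0) → v = 0 := hfin
    refine ⟨k, θ, Module.Basis.mk hli ?_, ?_, ?_⟩
    · rintro n -
      have h := hfin' (n - ∑ j, B (e j) n • e j) (fun i => by
        have := hsub n i
        simpa using this)
      rw [sub_eq_zero] at h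
      rw [h]
      exact Submodule.sum_mem _ fun j _ => Submodule.smul_mem _ _ (Submodule.subset_span ⟨j, rfl⟩)
    · simpa using he'
    · simpa using hbl'
  · exfalso
    have heu' : ∀ i, B (e i) u = 0 := heu
    have huu' : B u u = 1 := huu
    have hfin' : ∀ v : N, (∀ i, B (e i) v = 0) → B u v = 0 → v = 0 := hfin
    have hAu' : A u = -u := congrArg Subtype.val hAu
    set r := rotor (negForm B) θ (fun i => (e i : V)) with hr
    have hrs : r * star r = 1 := rotor_mul_star hB θ _ he'
    have hsr : star r * r = 1 := star_rotor_mul hB θ _ he'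
    have hre : involute r = r := involute_rotor _ _ _
    -- commutation of `star r`
    have hsc : ∀ v w : V, r * ι (negForm B) v = ι (negForm B) w * r →
        star r * ι (negForm B) w = ι (negForm B) v * star r := by
      intro v w h
      calc star r * ι (negForm B) w = star r * (ι (negForm B) w * r) * star r := by
            rw [mul_assoc, mul_assoc, hrs, mul_one]
        _ = _ := by rw [← h, ← mul_assoc, hsr, one_mul]
    -- `q` is even, commutes with the fixed vectors and with the block vectors, and anticommutes
    -- with `u`.
    set q := star r * y with hq
    have hqe : involute q = q := by rw [hq, map_mul, involute_star hre, hy.even]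
    have hqv : ∀ v : V, r * ι (negForm B) v = ι (negForm B) (A v) * r →
        q * ι (negForm B) v = ι (negForm B) v * q := by
      intro v h
      rw [hq, mul_assoc, hy.mul_ι, ← mul_assoc, hsc _ _ h, mul_assoc]
    have hru : r * ι (negForm B) (u : V) = ι (negForm B) u * r :=
      (commute_rotor hB θ _ fun i => by rw [hB]; exact heu' i).symm
    have hqu : q * ι (negForm B) (u : V) = -(ι (negForm B) u * q) := by
      rw [hq, mul_assoc, hy.mul_ι, ← mul_assoc, hAu', map_neg, mul_neg, hsc _ _ hru, neg_mul,
        mul_assoc]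
    -- The extra factor `u` makes `z` odd and anticommuting with every vector, including `u`. So `z`
    -- lies in the twisted centre and is a scalar; being odd, it is zero.
    set z := q * ι (negForm B) (u : V) with hz
    let M : Submodule ℝ V := LinearMap.ker
      (LinearMap.mulLeft ℝ z ∘ₗ ι (negForm B) + LinearMap.mulRight ℝ z ∘ₗ ι (negForm B))
    have hM : ∀ v, v ∈ M ↔ z * ι (negForm B) v + ι (negForm B) v * z = 0 := fun v => Iff.rfl
    have hMv : ∀ v : V, r * ι (negForm B) v = ι (negForm B) (A v) * r → B u v = 0 → v ∈ M := by
      intro v h1 h2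
      rw [hM, hz, mul_assoc, ι_anticomm hB h2, mul_neg, ← mul_assoc, hqv v h1, mul_assoc]
      simp
    have hMu : (u : V) ∈ M := by
      have h1 : z * ι (negForm B) (u : V) = -q := by
        rw [hz, mul_assoc, ι_mul_self_negForm, huu']; simp
      have h2 : ι (negForm B) (u : V) * z = q := by
        rw [hqu, mul_neg, ← mul_assoc, ι_mul_self_negForm, huu']; simp
      rw [hM, h1, h2, neg_add_cancel]
    have hMe : ∀ i, (e i : V) ∈ M := by
      rintro ⟨j, x⟩
      refine hMv _ ?_ (by rw [hB]; exact heu' _)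
      have := rotor_mul_ι hB θ _ he' j
      fin_cases x
      · simp only [Fin.zero_eta, hbl'.2.1 j]; exact this.1
      · simp only [Fin.mk_one, hbl'.2.2 j]; exact this.2
    have hall : ∀ v, v ∈ M := by
      refine forall_of_ker_of_basis hB hpos hN M (fun v hv => hMv v ?_ ((hN u).mp u.2 v hv)) ?_
      · rw [hv]
        refine (commute_rotor hB θ _ fun i => ?_).symm
        rw [hB]
        exact (hN _).mp (e i).2 v hv
      · intro n hn
        let n' : N := ⟨n, hn⟩
        have h := hfin' (n' - ∑ j, B (e j) n • e j - B u n • u) (fun i => by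
          have := hsub n' i
          simpa [heu'] using this) (by
          simp [huu', hB u (e _), heu', n'])
        have h' : n = ∑ j, B (e j) n • (e j : V) + B u n • (u : V) := by
          have := congrArg Subtype.val h
          simp [n'] at this
          rw [sub_sub, sub_eq_zero] at this
          exact this
        rw [h']
        exact M.add_mem (M.sum_mem fun j _ => M.smul_mem _ (hMe j)) (M.smul_mem _ hMu)
    have hzo : involute z = -z := by rw [hz, map_mul, hqe, involute_ι, mul_neg]
    obtain ⟨c, hc⟩ := mem_range_algebraMap_of_twisted_commute hB hpos (y := z) (fun v => by
      have := (hM v).mp (hall v)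
      rw [hzo, neg_mul, eq_neg_iff_add_eq_zero, add_comm, this])
    have hz0 : z = 0 := by
      have h1 : involute z = z := by rw [hc, AlgHom.commutes]
      rw [hzo] at h1
      have h2 : (2 : ℝ) • z = 0 := by rw [two_smul]; nth_rw 1 [← h1]; exact neg_add_cancel z
      exact (smul_eq_zero.mp h2).resolve_left two_ne_zero
    -- As `u` squares to `-1`, the vanishing of `z` forces `y = 0`, although `y` is a unit.
    have h1 : y * ι (negForm B) (u : V) * ι (negForm B) (u : V) = 0 := by
      have : y = r * q := by rw [hq, ← mul_assoc, hrs, one_mul]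
      rw [this, mul_assoc r, ← hz, hz0, mul_zero, zero_mul]
    rw [mul_assoc, ι_mul_self_negForm, huu', ← Algebra.commutes, ← Algebra.smul_def] at h1
    have h2 : y = 0 := (smul_eq_zero.mp h1).resolve_left (by norm_num)
    have h3 := hy.mul_star
    rw [h2, zero_mul] at h3
    exact zero_ne_one h3

end Lift

/-! ### Existence and comparison of phases -/

section Phase

open CliffordAlgebra

theorem prod_ofFn_smul {R : Type*} [Ring R] [Algebra ℝ R] {k : ℕ} (c : Fin k → ℝ)
    (f : Fin k → R) :
    (List.ofFn fun j => c j • f j).prod = (∏ j, c j) • (List.ofFn f).prod := by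
  induction k with
  | zero => simp
  | succ k ih =>
    rw [List.ofFn_succ, List.prod_cons, ih, List.ofFn_succ, List.prod_cons, Fin.prod_univ_succ,
      smul_mul_smul_comm]

variable {V : Type*} [AddCommGroup V] [Module ℝ V]
  {B : V →ₗ[ℝ] V →ₗ[ℝ] ℝ} {A : V →ₗ[ℝ] V} {N : Submodule ℝ V}

theorem tmul_eq_zero_of_right_ne_zero {W : Type*} [AddCommGroup W] [Module ℝ W] {c : ℂ} {w : W}
    (hw : w ≠ 0) (h : c ⊗ₜ[ℝ] w = 0) : c = 0 := by
  obtain ⟨φ, hφ⟩ : ∃ φ : Module.Dual ℝ W, φ w ≠ 0 := by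
    by_contra hcon
    push Not at hcon
    exact hw ((Module.forall_dual_apply_eq_zero_iff ℝ w).mp hcon)
  have h1 := congrArg (fun x => TensorProduct.rid ℝ ℂ (LinearMap.lTensor ℂ φ x)) h
  simp only [LinearMap.lTensor_tmul, TensorProduct.rid_tmul, map_zero] at h1
  exact (smul_eq_zero.mp h1).resolve_left hφ

theorem tmul_left_injective {W : Type*} [AddCommGroup W] [Module ℝ W] {c c' : ℂ} {w : W}
    (hw : w ≠ 0) (h : c ⊗ₜ[ℝ] w = c' ⊗ₜ[ℝ] w) : c = c' := by
  rw [← sub_eq_zero, ← TensorProduct.sub_tmul] at h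
  exact sub_eq_zero.mp (tmul_eq_zero_of_right_ne_zero hw h)

theorem IsLift.ne_zero {A : V → V} {y : CliffordAlgebra (negForm B)} (hy : IsLift B A y) :
    y ≠ 0 := by
  intro h
  have := hy.mul_star
  rw [h, zero_mul] at this
  exact zero_ne_one this

/-- A block of angle `θ` has the eigenvalue `-1` only when `cos θ = -1`, and eigenvectors for `-1`
lie in `N`, where the blocks exhaust everything. -/
theorem IsAdapted.exists_angle_eq_pi (hA : ∀ v w, B (A v) (A w) = B v w)
    (hpos : ∀ v, v ≠ 0 → 0 < B v v) (hN : IsNormal B A N) {k : ℕ} {θ : Fin k → ℝ} {e : Module.Basis (Fin k × Fin 2) ℝ N}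
    (h : IsAdapted B A N θ e) : Module.End.HasEigenvalue A (-1) ↔ ∃ j, θ j = Real.pi := by
  constructor
  · intro hev
    by_contra hcon
    push Not at hcon
    obtain ⟨v, hv⟩ := hev.exists_hasEigenvector
    have hv1 : A v = -v := by rw [hv.apply_eq_smul]; simp
    -- Eigenvectors of an isometry for `1` and `-1` are orthogonal.
    have hvN : v ∈ N := by
      rw [hN]
      intro w hw
      have := hA v w
      rw [hw, hv1] at this
      simp at this
      linarith
    have h0 : ∀ i, B v (e i) = 0 := by
      rintro ⟨j, x⟩
      have e0 := hA v (e (j, 0))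
      have e1 := hA v (e (j, 1))
      have b0 := h.block.2.1 j
      have b1 := h.block.2.2 j
      simp only at b0 b1
      rw [hv1, b0] at e0
      rw [hv1, b1] at e1
      simp only [map_neg, map_add, map_smul, LinearMap.neg_apply, smul_eq_mul] at e0 e1
      have hsc := Real.sin_sq_add_cos_sq (θ j)
      have hc : -1 < Real.cos (θ j) := by
        have hlt := lt_of_le_of_ne (h.block.1 j).2 (hcon j)
        rw [← Real.cos_pi]
        exact Real.cos_lt_cos_of_nonneg_of_le_pi (h.block.1 j).1.le le_rfl hlt
      set c := Real.cos (θ j)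
      set s := Real.sin (θ j)
      have h2 : 0 < 2 * (1 + c) := by linarith
      -- The two components of `v` in the block solve a homogeneous linear system of determinant `(1
      -- + c)² + s² = 2 (1 + c)`, nonzero for angles below `π`.
      have k0 : 2 * (1 + c) * B v (e (j, 0)) = 0 := by
        linear_combination (-(1 + c)) * e0 + s * e1 - B v (e (j, 0)) * hsc
      have k1 : 2 * (1 + c) * B v (e (j, 1)) = 0 := by
        linear_combination (-(1 + c)) * e1 - s * e0 - B v (e (j, 1)) * hsc
      fin_cases x
      · exact (mul_eq_zero.mp k0).resolve_left h2.ne'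
      · exact (mul_eq_zero.mp k1).resolve_left h2.ne'
    refine (hpos v hv.2).ne' ?_
    have hs : (B v) ∘ₗ N.subtype = 0 := e.ext fun i => h0 i
    exact LinearMap.congr_fun hs ⟨v, hvN⟩
  · rintro ⟨j, hj⟩
    refine Module.End.hasEigenvalue_of_hasEigenvector (x := (e (j, 0) : V)) ⟨?_, ?_⟩
    · rw [Module.End.mem_eigenspace_iff, h.block.2.1 j, hj]; simp
    · intro h0
      have := h.orthonormal (j, 0) (j, 0)
      rw [h0] at this
      simp at this

/-- Without the angle `π` all half-angles lie in `(0, π / 2)`, where the cosine is positive. -/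
theorem IsAdapted.scalarPart_pos (hB : ∀ v w, B v w = B w v) {k : ℕ} {θ : Fin k → ℝ}
    {e : Module.Basis (Fin k × Fin 2) ℝ N} (h : IsAdapted B A N θ e) (hθ : ¬ ∃ j, θ j = Real.pi) :
    0 < scalarPart (negForm B) (rotor (negForm B) θ fun i => (e i : V)) := by
  rw [scalarPart_rotor hB θ _ h.orthonormal]
  refine Finset.prod_pos fun j _ => Real.cos_pos_of_mem_Ioo ⟨?_, ?_⟩
  · have := (h.block.1 j).1
    linarith [Real.pi_pos]
  · have := lt_of_le_of_ne (h.block.1 j).2 fun hj => hθ ⟨j, hj⟩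
    linarith

/-- If `-1` is an eigenvalue, the sign of the rotor can be changed. -/
theorem IsAdapted.exists_neg (hB : ∀ v w, B v w = B w v) {k : ℕ} {θ : Fin k → ℝ}
    {e : Module.Basis (Fin k × Fin 2) ℝ N} (h : IsAdapted B A N θ e) {j₀ : Fin k}
    (hj : θ j₀ = Real.pi) :
    ∃ e' : Module.Basis (Fin k × Fin 2) ℝ N, IsAdapted B A N θ e' ∧
      rotor (negForm B) θ (fun i => (e' i : V)) = -rotor (negForm B) θ (fun i => (e i : V)) := by
  -- On a block of angle `π` the map is `-1`, so swapping the two vectors keeps the basis adapted.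
  -- As `cos (π / 2) = 0`, the factor is just their Clifford product, which changes sign.
  let τ : Equiv.Perm (Fin k × Fin 2) := Equiv.swap (j₀, 0) (j₀, 1)
  have hτ0 : τ (j₀, 0) = (j₀, 1) := Equiv.swap_apply_left _ _
  have hτ1 : τ (j₀, 1) = (j₀, 0) := Equiv.swap_apply_right _ _
  have hτ : ∀ j x, j ≠ j₀ → τ (j, x) = (j, x) := fun j x hjj =>
    Equiv.swap_apply_of_ne_of_ne (by simp [hjj]) (by simp [hjj])
  have hsymm : τ.symm = τ := Equiv.symm_swap _ _
  have he' : ∀ i, e.reindex τ i = e (τ i) := by intro i; rw [Module.Basis.reindex_apply, hsymm]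
  refine ⟨e.reindex τ, ⟨?_, h.block.1, ?_, ?_⟩, ?_⟩
  · intro i j
    rw [he', he', h.orthonormal]
    simp
  · intro j
    simp only [he']
    by_cases hjj : j = j₀
    · subst hjj
      have := h.block.2.2 j
      simp only at this
      rw [hτ0, hτ1, this, hj]; simp
    · rw [hτ _ _ hjj, hτ _ _ hjj]; exact h.block.2.1 j
  · intro j
    simp only [he']
    by_cases hjj : j = j₀
    · subst hjj
      have := h.block.2.1 j
      simp only at this
      rw [hτ0, hτ1, this, hj]; simp
    · rw [hτ _ _ hjj, hτ _ _ hjj]; exact h.block.2.2 j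
  · have key := prod_ofFn_smul (fun j => if j = j₀ then (-1 : ℝ) else 1) (fun j : Fin k =>
      algebraMap ℝ (CliffordAlgebra (negForm B)) (Real.cos (θ j / 2)) +
      Real.sin (θ j / 2) • (ι (negForm B) (e (j, 0)) * ι (negForm B) (e (j, 1))))
    rw [Finset.prod_ite_eq' Finset.univ j₀, if_pos (Finset.mem_univ _), neg_smul, one_smul] at key
    rw [rotor, rotor, ← key]
    congr 2
    ext j
    simp only [he']
    by_cases hjj : j = j₀
    · subst hjj
      rw [hτ0, hτ1, hj, if_pos rfl, ι_anticomm hB (v := (e (j, 1) : V)) (w := (e (j, 0) : V))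
        (by rw [h.orthonormal]; simp)]
      simp
    · rw [hτ _ _ hjj, hτ _ _ hjj, if_neg hjj, one_smul]

/-- Existence of a phase. -/
theorem exists_phase [FiniteDimensional ℝ V] (hB : ∀ v w, B v w = B w v)
    (hpos : ∀ v, v ≠ 0 → 0 < B v v) (hA : ∀ v w, B (A v) (A w) = B v w) (hN : IsNormal B A N)
    {y : CliffordAlgebra (negForm B)} (hy : IsLift B A y) (ζ : Circle) :
    ∃ α : Circle, ∃ (k : ℕ) (θ : Fin k → ℝ) (e : Module.Basis (Fin k × Fin 2) ℝ N),
      IsAdapted B A N θ e ∧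
      (ζ : ℂ) ⊗ₜ[ℝ] y = (α : ℂ) ⊗ₜ[ℝ] rotor (negForm B) θ (fun i => (e i : V)) := by
  obtain ⟨k, θ, e, h⟩ := exists_isAdapted hB hpos hA hN hy
  rcases (h.isLift_rotor hB hpos hN).eq_or_eq_neg hB hpos hy with h1 | h1
  · exact ⟨ζ, k, θ, e, h, by rw [h1]⟩
  · exact ⟨-ζ, k, θ, e, h, by rw [h1]; simp [TensorProduct.neg_tmul, TensorProduct.tmul_neg]⟩

/-- Comparison of two phases. -/
theorem phase_eq_or_neg [FiniteDimensional ℝ V] (hB : ∀ v w, B v w = B w v)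
    (hpos : ∀ v, v ≠ 0 → 0 < B v v) (hA : ∀ v w, B (A v) (A w) = B v w) (hN : IsNormal B A N)
    {k k' : ℕ} {θ : Fin k → ℝ} {e : Module.Basis (Fin k × Fin 2) ℝ N} (h : IsAdapted B A N θ e)
    {θ' : Fin k' → ℝ} {e' : Module.Basis (Fin k' × Fin 2) ℝ N} (h' : IsAdapted B A N θ' e')
    {α β : ℂ} (hαβ : α ⊗ₜ[ℝ] rotor (negForm B) θ (fun i => (e i : V)) =
      β ⊗ₜ[ℝ] rotor (negForm B) θ' (fun i => (e' i : V))) :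
    β = α ∨ (β = -α ∧ Module.End.HasEigenvalue A (-1)) := by
  have hl := h.isLift_rotor hB hpos hN
  have hl' := h'.isLift_rotor hB hpos hN
  rcases hl.eq_or_eq_neg hB hpos hl' with h1 | h1
  · left
    rw [h1] at hαβ
    exact (tmul_left_injective hl.ne_zero hαβ).symm
  · right
    constructor
    · rw [h1, TensorProduct.tmul_neg, ← TensorProduct.neg_tmul] at hαβ
      rw [tmul_left_injective hl.ne_zero hαβ, neg_neg]
    · by_contra hev
      -- If `-1` is not an eigenvalue, both rotors have positive scalar part and cannot be opposite
      -- to each other.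
      have p1 := h.scalarPart_pos hB fun hc => hev ((h.exists_angle_eq_pi hA hpos hN).mpr hc)
      have p2 := h'.scalarPart_pos hB fun hc => hev ((h'.exists_angle_eq_pi hA hpos hN).mpr hc)
      rw [h1, map_neg] at p2
      linarith

end Phase

/-! ### The group `Spin^c(n)` and the rotations it covers -/

section SpincGroup

open CliffordAlgebra

theorem star_map {V W : Type*} [AddCommGroup V] [Module ℝ V] [AddCommGroup W] [Module ℝ W]
    {Q : QuadraticForm ℝ V} {Q' : QuadraticForm ℝ W} (f : Q →qᵢ Q') (x : CliffordAlgebra Q) :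
    star (CliffordAlgebra.map f x) = CliffordAlgebra.map f (star x) := by
  induction x using CliffordAlgebra.left_induction with
  | algebraMap r => rw [AlgHom.commutes, CliffordAlgebra.star_algebraMap,
      CliffordAlgebra.star_algebraMap, AlgHom.commutes]
  | add x y hx hy => simp only [map_add, star_add, hx, hy]
  | ι_mul x m hx => simp [star_mul, hx]

theorem involute_map {V W : Type*} [AddCommGroup V] [Module ℝ V] [AddCommGroup W] [Module ℝ W]
    {Q : QuadraticForm ℝ V} {Q' : QuadraticForm ℝ W} (f : Q →qᵢ Q') (x : CliffordAlgebra Q) :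
    involute (CliffordAlgebra.map f x) = CliffordAlgebra.map f (involute x) := by
  induction x using CliffordAlgebra.left_induction with
  | algebraMap r => simp only [AlgHom.commutes]
  | add x y hx hy => simp only [map_add, hx, hy]
  | ι_mul x m hx => simp [hx]

theorem IsLift.map {V W : Type*} [AddCommGroup V] [Module ℝ V] [AddCommGroup W] [Module ℝ W]
    {B : V →ₗ[ℝ] V →ₗ[ℝ] ℝ} {B' : W →ₗ[ℝ] W →ₗ[ℝ] ℝ} {A : V → V} {A' : W → W}
    {y : CliffordAlgebra (negForm B)} (hy : IsLift B A y) (f : negForm B →qᵢ negForm B')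
    (hf : Function.Surjective f) (hA : ∀ v, A' (f v) = f (A v)) :
    IsLift B' A' (CliffordAlgebra.map f y) := by
  refine ⟨by rw [involute_map, hy.even], ?_, ?_, fun v => ?_⟩
  · rw [star_map, ← map_mul, hy.mul_star, map_one]
  · rw [star_map, ← map_mul, hy.star_mul, map_one]
  · obtain ⟨v, rfl⟩ := hf v
    rw [hA, ← map_apply_ι, ← map_apply_ι, ← map_mul, ← map_mul, hy.mul_ι]

theorem includeRight_injective {V : Type*} [AddCommGroup V] [Module ℝ V]
    {Q : QuadraticForm ℝ V} {x y : CliffordAlgebra Q}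
    (h : (1 : ℂ) ⊗ₜ[ℝ] x = (1 : ℂ) ⊗ₜ[ℝ] y) : x = y := by
  by_contra hne
  have h1 : (1 : ℂ) ⊗ₜ[ℝ] (x - y) = 0 := by rw [TensorProduct.tmul_sub, h, sub_self]
  exact one_ne_zero (tmul_eq_zero_of_right_ne_zero (sub_ne_zero.mpr hne) h1)

theorem cliff_injective {V : Type*} [AddCommGroup V] [Module ℝ V] (Q : QuadraticForm ℝ V) :
    Function.Injective (cliff Q) := by
  intro v w h
  have h1 := congrArg (equivExterior Q) (includeRight_injective h)
  simp only [equivExterior, changeFormEquiv_apply, changeForm_ι] at h1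
  exact ExteriorAlgebra.ι_leftInverse.injective h1

variable {n : ℕ}

theorem rotation_spec (s : Spinc n) (v : Euc n) :
    ((s : (CliffC (stdForm n))ˣ) : CliffC (stdForm n)) * cliff (stdForm n) v *
      ((s⁻¹ : Spinc n) : (CliffC (stdForm n))ˣ) = cliff (stdForm n) (rotation s v) :=
  Classical.choose_spec (exists_rotation s v)

/-- The rotation of `ℝ^n` covered by `s ∈ Spin^c(n)`, as a linear map. -/
def rotationₗ (s : Spinc n) : Euc n →ₗ[ℝ] Euc n where
  toFun := rotation s
  map_add' v w := by
    apply cliff_injective (stdForm n)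
    rw [← rotation_spec]
    have h : ∀ v w, cliff (stdForm n) (v + w) = cliff (stdForm n) v + cliff (stdForm n) w := by
      intro v w
      simp [cliff, TensorProduct.tmul_add]
    rw [h, h, mul_add, add_mul, rotation_spec, rotation_spec]
  map_smul' c v := by
    apply cliff_injective (stdForm n)
    rw [← rotation_spec]
    have h : ∀ v, cliff (stdForm n) (c • v) = c • cliff (stdForm n) v := by
      intro v
      simp [cliff, TensorProduct.tmul_smul]
    rw [h, mul_smul_comm, smul_mul_assoc, rotation_spec, RingHom.id_apply, h]

/-- The square of `c(v)` is the scalar `-|v|²`, which conjugation by `s` leaves unchanged. -/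
theorem inner_rotation (s : Spinc n) (v w : Euc n) :
    inner ℝ (rotation s v) (rotation s w) = inner ℝ v w := by
  have hsq : ∀ v : Euc n, cliff (stdForm n) v * cliff (stdForm n) v =
      algebraMap ℝ _ (-(inner ℝ v v)) := by
    intro v
    rw [cliff, Algebra.TensorProduct.tmul_mul_tmul, ι_sq_scalar, one_mul]
    exact (Algebra.TensorProduct.includeRight (R := ℝ) (A := ℂ)).commutes _
  have hnorm : ∀ v : Euc n, ‖rotationₗ s v‖ = ‖v‖ := by
    intro v
    have h : cliff (stdForm n) (rotation s v) * cliff (stdForm n) (rotation s v) =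
        cliff (stdForm n) v * cliff (stdForm n) v := by
      have hi : (((s⁻¹ : Spinc n) : (CliffC (stdForm n))ˣ) : CliffC (stdForm n)) *
          ((s : (CliffC (stdForm n))ˣ) : CliffC (stdForm n)) = 1 := by
        simp
      have hi' : ((s : (CliffC (stdForm n))ˣ) : CliffC (stdForm n)) *
          (((s⁻¹ : Spinc n) : (CliffC (stdForm n))ˣ) : CliffC (stdForm n)) = 1 := by
        simp
      rw [← rotation_spec]
      generalize (((s⁻¹ : Spinc n) : (CliffC (stdForm n))ˣ) : CliffC (stdForm n)) = b at *
      generalize ((s : (CliffC (stdForm n))ˣ) : CliffC (stdForm n)) = a at *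
      calc a * cliff (stdForm n) v * b * (a * cliff (stdForm n) v * b)
          = a * cliff (stdForm n) v * (b * a) * cliff (stdForm n) v * b := by
            simp only [mul_assoc]
        _ = a * (cliff (stdForm n) v * cliff (stdForm n) v) * b := by
            rw [hi, mul_one, mul_assoc a]
        _ = _ := by rw [hsq, ← Algebra.commutes, mul_assoc, hi', mul_one]
    rw [hsq, hsq] at h
    have h2 := (algebraMap ℝ (CliffC (stdForm n))).injective h
    rw [← sq_eq_sq₀ (norm_nonneg _) (norm_nonneg _), ← real_inner_self_eq_norm_sq,
      ← real_inner_self_eq_norm_sq]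
    exact neg_injective h2
  exact (LinearIsometry.mk (rotationₗ s) hnorm).inner_map_map v w

/-- An element of `Spin^c(n)` is the product of a phase and a lift of the rotation it covers. -/
theorem spinc_exists_eq_tmul (s : Spinc n) : ∃ (ζ : Circle) (x : CliffordAlgebra (stdForm n)),
    ((s : (CliffC (stdForm n))ˣ) : CliffC (stdForm n)) = (ζ : ℂ) ⊗ₜ[ℝ] x ∧
    IsLift (innerₗ (Euc n)) (rotation s) x := by
  obtain ⟨ζ, x, hx, hs⟩ := s.2
  have h1 : x * star x = 1 := spinGroup.mul_star_self_of_mem hx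
  have h2 : star x * x = 1 := spinGroup.star_mul_self_of_mem hx
  refine ⟨ζ, x, hs, spinGroup.involute_eq hx, h1, h2, fun v => ?_⟩
  have hinv : (((s⁻¹ : Spinc n) : (CliffC (stdForm n))ˣ) : CliffC (stdForm n)) =
      ((ζ⁻¹ : Circle) : ℂ) ⊗ₜ star x := by
    rw [InvMemClass.coe_inv]
    refine Units.inv_eq_of_mul_eq_one_right ?_
    rw [hs, Algebra.TensorProduct.tmul_mul_tmul, h1,
      ← Circle.coe_mul, mul_inv_cancel, Circle.coe_one, Algebra.TensorProduct.one_def]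
  have h := rotation_spec s v
  rw [hinv, hs, cliff, cliff, Algebra.TensorProduct.tmul_mul_tmul,
    Algebra.TensorProduct.tmul_mul_tmul, mul_one, ← Circle.coe_mul, mul_inv_cancel,
    Circle.coe_one] at h
  have h3 := includeRight_injective h
  calc x * ι (stdForm n) v = x * ι (stdForm n) v * star x * x := by
        rw [mul_assoc _ (star x), h2, mul_one]
    _ = _ := by rw [h3]; rfl

/-- Conjugation by `s` is an algebra automorphism which acts on vectors as the rotation, and algebra
homomorphisms are determined by their values on vectors. This is the source of the independence of
the spinor action from the chosen frame. -/
theorem cliffMap_conj {W : Type*} [AddCommGroup W] [Module ℝ W] {Q : QuadraticForm ℝ W}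
    (f f' : stdForm n →qᵢ Q) (s : Spinc n) (hf : ∀ v, f' v = f (rotation s v))
    (a : CliffC (stdForm n)) :
    cliffMap f' a = cliffMap f (((s : (CliffC (stdForm n))ˣ) : CliffC (stdForm n)) * a *
        (((s⁻¹ : Spinc n) : (CliffC (stdForm n))ˣ) : CliffC (stdForm n))) := by
  have hi : (((s⁻¹ : Spinc n) : (CliffC (stdForm n))ˣ) : CliffC (stdForm n)) *
      ((s : (CliffC (stdForm n))ˣ) : CliffC (stdForm n)) = 1 := by simp
  have hi' : ((s : (CliffC (stdForm n))ˣ) : CliffC (stdForm n)) *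
      (((s⁻¹ : Spinc n) : (CliffC (stdForm n))ˣ) : CliffC (stdForm n)) = 1 := by simp
  have hspec := rotation_spec s
  generalize (((s⁻¹ : Spinc n) : (CliffC (stdForm n))ˣ) : CliffC (stdForm n)) = b at *
  generalize ((s : (CliffC (stdForm n))ˣ) : CliffC (stdForm n)) = c at *
  induction a using TensorProduct.induction_on with
  | zero => simp
  | add x y hx hy => rw [map_add, mul_add, add_mul, map_add, hx, hy]
  | tmul ζ x =>
    have hζ : ζ ⊗ₜ[ℝ] x = ζ • ((1 : ℂ) ⊗ₜ[ℝ] x : CliffC (stdForm n)) := by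
      rw [TensorProduct.smul_tmul', smul_eq_mul, mul_one]
    rw [hζ, mul_smul_comm, smul_mul_assoc, map_smul, map_smul]
    congr 1
    clear hζ
    induction x using CliffordAlgebra.left_induction with
    | algebraMap r =>
      have h1 : ((1 : ℂ) ⊗ₜ[ℝ] algebraMap ℝ (CliffordAlgebra (stdForm n)) r : CliffC (stdForm n)) =
        algebraMap ℝ _ r := (Algebra.TensorProduct.includeRight (R := ℝ) (A := ℂ)).commutes r
      have h4 : ∀ f : stdForm n →qᵢ Q, cliffMap f (algebraMap ℝ _ r) = algebraMap ℝ _ r :=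
        fun f => ((cliffMap f).restrictScalars ℝ).commutes r
      rw [h1, ← Algebra.commutes, mul_assoc, hi', mul_one, h4, h4]
    | add x y hx hy => simp only [TensorProduct.tmul_add, map_add, mul_add, add_mul, hx, hy]
    | ι_mul x v hx =>
      have h1 : ((1 : ℂ) ⊗ₜ[ℝ] (ι (stdForm n) v * x) : CliffC (stdForm n)) =
          cliff (stdForm n) v * ((1 : ℂ) ⊗ₜ[ℝ] x) := by
        rw [cliff, Algebra.TensorProduct.tmul_mul_tmul, one_mul]
      have h2 : ∀ y : CliffC (stdForm n), c * (cliff (stdForm n) v * y) * b =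
          (c * cliff (stdForm n) v * b) * (c * y * b) := by
        intro y
        calc c * (cliff (stdForm n) v * y) * b = c * cliff (stdForm n) v * 1 * y * b := by
              simp only [mul_assoc, mul_one]
          _ = _ := by rw [← hi]; simp only [mul_assoc]
      have h3 : ∀ (f : stdForm n →qᵢ Q) (v : Euc n), cliffMap f (cliff (stdForm n) v) =
          cliff Q (f v) := by
        intro f v
        simp [cliffMap, cliff]
      rw [h1, h2, hspec, map_mul, map_mul, h3, h3, hx, hf]

end SpincGroup

/-! ### The spinor action and its phases at one fixed point -/

section Pointwise

open CliffordAlgebra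

variable {n : ℕ} {Z : Type u} [TopologicalSpace Z] [ChartedSpace (Euc n) Z]
  [IsManifold (𝓡 n) ∞ Z] {m : Metric n Z} {oZ : ManifoldOrientation n Z}

theorem Metric.bilin_comm (m : Metric n Z) (z : Z) (v w : Tan n z) :
    m.bilin z v w = m.bilin z w v := m.symm z v w

theorem Metric.bilin_pos (m : Metric n Z) (z : Z) (v : Tan n z) (hv : v ≠ 0) :
    0 < m.bilin z v v := m.pos z v hv

instance (z : Z) : FiniteDimensional ℝ (Tan n z) :=
  inferInstanceAs (FiniteDimensional ℝ (Euc n))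

theorem isNormal_normalSpace {G : Type v} [Group G] [MulAction G Z] (m : Metric n Z) (g : G)
    (z : MulAction.fixedBy Z g) :
    IsNormal (m.bilin (z : Z)) (fixedDiff g z) (normalSpace m g z) := by
  intro v
  refine forall_congr' fun w => imp_congr_left ?_
  rw [fixedTangent, LinearMap.mem_ker, LinearMap.sub_apply, sub_eq_zero, LinearMap.id_apply]

variable (S : SpincStructure.{u, w} m oZ)

theorem SpincStructure.exists_proj_eq (z : Z) : ∃ p, S.proj p = z := by
  obtain ⟨e, he, -⟩ := S.locally_trivial z
  exact ⟨e.toOpenPartialHomeomorph.symm (z, 1), e.proj_symm_apply' he⟩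

variable {S}

theorem SpincStructure.exists_act_eq {p p' : S.P} (h : S.proj p' = S.proj p) :
    ∃ s : Spinc n, p' = MulOpposite.op s • p := by
  obtain ⟨e, he, hact⟩ := S.locally_trivial (S.proj p)
  refine ⟨(e p).2⁻¹ * (e p').2, ?_⟩
  have h1 : p' ∈ e.source := e.mem_source.mpr (h ▸ he)
  have h2 : MulOpposite.op ((e p).2⁻¹ * (e p').2) • p ∈ e.source :=
    e.mem_source.mpr (by rw [S.proj_act]; exact he)
  refine e.injOn h1 h2 (Prod.ext ?_ ?_)
  · change (e _).1 = (e _).1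
    rw [e.coe_fst h1, e.coe_fst h2, S.proj_act, h]
  · change (e _).2 = (e _).2
    rw [hact _ _ he, mul_inv_cancel_left]

theorem SpincStructure.act_injective {p : S.P} {s t : Spinc n}
    (h : MulOpposite.op s • p = MulOpposite.op t • p) : s = t := by
  obtain ⟨e, he, hact⟩ := S.locally_trivial (S.proj p)
  have h1 := hact p s he
  rw [h, hact p t he] at h1
  exact (mul_left_cancel h1).symm

theorem SpincStructure.frame_act' (p : S.P) (s : Spinc n) (v : Euc n) :
    (S.frame (MulOpposite.op s • p) v : Euc n) = (S.frame p (rotation s v) : Euc n) :=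
  congrArg (fun q : TangentBundle (𝓡 n) Z => (q.2 : Euc n)) (S.frame_act p s v)

/-- The base points of two frames are equal only propositionally, so the comparison is made in the
total space of the Clifford algebras. -/
theorem sigma_cliffMap_conj {z z' : Z} (h : z' = z) (f : stdForm n →qᵢ m.form z)
    (f' : stdForm n →qᵢ m.form z') (s : Spinc n)
    (hf : ∀ v, (f' v : Euc n) = (f (rotation s v) : Euc n)) (a : CliffC (stdForm n)) :
    (⟨z', cliffMap f' a⟩ : Σ y : Z, CliffC (m.form y)) =
      ⟨z, cliffMap f (((s : (CliffC (stdForm n))ˣ) : CliffC (stdForm n)) * a *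
        (((s⁻¹ : Spinc n) : (CliffC (stdForm n))ˣ) : CliffC (stdForm n)))⟩ := by
  subst h
  exact Sigma.ext rfl (heq_of_eq (cliffMap_conj f f' s hf a))

variable {G : Type v} [Group G] [TopologicalSpace G] [MulAction G Z]
  {S : EquivariantSpincStructure.{u, v, w} G m oZ}

/-- Any other point over `z` is `p · t`; its group element is `t⁻¹ s t` and its frame is that of `p`
after the rotation by `t`. The two changes cancel, so a single `p` computes the action. -/
theorem isSpinorAction_iff {g : G} {p : S.P} {s : Spinc n} (hs : g • p = MulOpposite.op s • p)
    (hz : S.proj p ∈ MulAction.fixedBy Z g) (a : CliffC (m.form (S.proj p))) :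
    S.IsSpinorAction g ⟨S.proj p, hz⟩ a ↔
      a = cliffMap (S.toSpincStructure.isometry p)
        ((s : (CliffC (stdForm n))ˣ) : CliffC (stdForm n)) := by
  constructor
  · rintro ⟨p', s', hs', h⟩
    have hproj : S.proj p' = S.proj p := congrArg Sigma.fst h
    obtain ⟨t, rfl⟩ := SpincStructure.exists_act_eq hproj
    have h1 : t * s' = s * t := by
      have h2 : g • (MulOpposite.op t • p) = MulOpposite.op (s * t) • p := by
        rw [S.comm_actG, hs, smul_smul, MulOpposite.op_mul]
      rw [hs', smul_smul, ← MulOpposite.op_mul] at h2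
      exact SpincStructure.act_injective h2
    have h3 : s' = t⁻¹ * s * t := by rw [mul_assoc, ← h1, inv_mul_cancel_left]
    have h4 := sigma_cliffMap_conj hproj (S.toSpincStructure.isometry p)
      (S.toSpincStructure.isometry (MulOpposite.op t • p)) t
      (fun v => SpincStructure.frame_act' p t v)
      ((s' : (CliffC (stdForm n))ˣ) : CliffC (stdForm n))
    rw [h4] at h
    have h5 := eq_of_heq (Sigma.mk.inj_iff.mp h).2
    rw [← h5, ← Units.val_mul, ← Units.val_mul, ← Subgroup.coe_mul, ← Subgroup.coe_mul, h3]
    congr 3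
    group
  · rintro rfl
    exact ⟨p, s, hs, rfl⟩

theorem exists_act_eq_of_fixed {g : G} {p : S.P} (hz : S.proj p ∈ MulAction.fixedBy Z g) :
    ∃ s : Spinc n, g • p = MulOpposite.op s • p :=
  SpincStructure.exists_act_eq (by rw [S.proj_actG]; exact hz)

/-- The frame at `g p = p s` is computed twice, by equivariance under `G` and under `Spin^c(n)`. So
`dg` is the rotation by `s` in the frame of `p`, which is why it is an isometry covered by `s`. -/
theorem fixedDiff_frame {g : G} {p : S.P} {s : Spinc n} (hs : g • p = MulOpposite.op s • p)
    (hz : S.proj p ∈ MulAction.fixedBy Z g) (v : Euc n) :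
    fixedDiff g ⟨S.proj p, hz⟩ (S.frame p v) = S.frame p (rotation s v) := by
  have h := S.frame_actG g p v
  rw [hs, S.frame_act] at h
  exact (congrArg (fun q : TangentBundle (𝓡 n) Z => (q.2 : Euc n)) h).symm

theorem bilin_frame (p : S.P) (v w : Euc n) :
    m.bilin (S.proj p) (S.frame p v) (S.frame p w) = inner ℝ v w := S.frame_inner p v w

theorem bilin_fixedDiff (S : EquivariantSpincStructure.{u, v, w} G m oZ) {g : G}
    (z : MulAction.fixedBy Z g) (v w : Tan n (z : Z)) :
    m.bilin (z : Z) (fixedDiff g z v) (fixedDiff g z w) = m.bilin (z : Z) v w := by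
  obtain ⟨z, hz⟩ := z
  obtain ⟨p, rfl⟩ := S.toSpincStructure.exists_proj_eq z
  obtain ⟨s, hs⟩ := exists_act_eq_of_fixed hz
  obtain ⟨v, rfl⟩ := (S.frame p).surjective v
  obtain ⟨w, rfl⟩ := (S.frame p).surjective w
  rw [fixedDiff_frame hs hz, fixedDiff_frame hs hz, bilin_frame, bilin_frame, inner_rotation]

theorem isLift_fixedDiff {g : G} {p : S.P} {s : Spinc n} (hs : g • p = MulOpposite.op s • p)
    (hz : S.proj p ∈ MulAction.fixedBy Z g) {x : CliffordAlgebra (stdForm n)}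
    (hx : IsLift (innerₗ (Euc n)) (rotation s) x) :
    IsLift (m.bilin (S.proj p)) (fixedDiff g ⟨S.proj p, hz⟩)
      (CliffordAlgebra.map (S.toSpincStructure.isometry p) x) :=
  hx.map (B' := m.bilin (S.proj p)) (S.toSpincStructure.isometry p) (S.frame p).surjective
    (fixedDiff_frame hs hz)

/-- A phase of the spinor action, in terms of a rotor. -/
theorem isPhase_iff {g : G} {p : S.P} {s : Spinc n} (hs : g • p = MulOpposite.op s • p)
    (hz : S.proj p ∈ MulAction.fixedBy Z g) {ζ : Circle} {x : CliffordAlgebra (stdForm n)}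
    (hx : ((s : (CliffC (stdForm n))ˣ) : CliffC (stdForm n)) = (ζ : ℂ) ⊗ₜ[ℝ] x) (α : Circle) :
    S.IsPhase g ⟨S.proj p, hz⟩ α ↔ ∃ (k : ℕ) (θ : Fin k → ℝ)
      (e : Module.Basis (Fin k × Fin 2) ℝ (normalSpace m g ⟨S.proj p, hz⟩)),
      IsAdapted (m.bilin (S.proj p)) (fixedDiff g ⟨S.proj p, hz⟩)
        (normalSpace m g ⟨S.proj p, hz⟩) θ e ∧
      (ζ : ℂ) ⊗ₜ[ℝ] (CliffordAlgebra.map (S.toSpincStructure.isometry p) x) =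
        (α : ℂ) ⊗ₜ[ℝ] rotor (m.form (S.proj p)) θ (fun i => (e i : Tan n (S.proj p))) := by
  have key : ∀ (k : ℕ) (θ : Fin k → ℝ)
      (e : Module.Basis (Fin k × Fin 2) ℝ (normalSpace m g ⟨S.proj p, hz⟩)),
      S.IsSpinorAction g ⟨S.proj p, hz⟩ ((α : ℂ) • (List.ofFn fun j : Fin k =>
      algebraMap ℝ (CliffC (m.form (S.proj p))) (Real.cos (θ j / 2)) +
        Real.sin (θ j / 2) • (cliff (m.form (S.proj p)) (e (j, 0)) *
          cliff (m.form (S.proj p)) (e (j, 1)))).prod) ↔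
      (ζ : ℂ) ⊗ₜ[ℝ] (CliffordAlgebra.map (S.toSpincStructure.isometry p) x) =
        (α : ℂ) ⊗ₜ[ℝ] rotor (m.form (S.proj p)) θ (fun i => (e i : Tan n (S.proj p))) := by
    intro k θ e
    rw [isSpinorAction_iff hs hz, hx,
      tmul_rotor (m.form (S.proj p)) θ (fun i => (e i : Tan n (S.proj p))),
      TensorProduct.smul_tmul', smul_eq_mul, mul_one, eq_comm]
    rfl
  constructor
  · rintro ⟨k, θ, e, h1, h2, h3, h4, h5⟩
    exact ⟨k, θ, e, ⟨h1, h2, h3, h4⟩, (key k θ e).mp h5⟩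
  · rintro ⟨k, θ, e, ⟨h1, h2, h3, h4⟩, h5⟩
    exact ⟨k, θ, e, h1, h2, h3, h4, (key k θ e).mpr h5⟩

theorem existsUnique_isSpinorAction (S : EquivariantSpincStructure.{u, v, w} G m oZ) (g : G)
    (z : MulAction.fixedBy Z g) : ∃! a, S.IsSpinorAction g z a := by
  obtain ⟨z, hz⟩ := z
  obtain ⟨p, rfl⟩ := S.toSpincStructure.exists_proj_eq z
  obtain ⟨s, hs⟩ := exists_act_eq_of_fixed hz
  exact ⟨_, (isSpinorAction_iff hs hz _).mpr rfl, fun a ha => (isSpinorAction_iff hs hz a).mp ha⟩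

theorem exists_isPhase (S : EquivariantSpincStructure.{u, v, w} G m oZ) (g : G)
    (z : MulAction.fixedBy Z g) : ∃ α, S.IsPhase g z α := by
  have hA := bilin_fixedDiff S z
  obtain ⟨z, hz⟩ := z
  obtain ⟨p, rfl⟩ := S.toSpincStructure.exists_proj_eq z
  obtain ⟨s, hs⟩ := exists_act_eq_of_fixed hz
  obtain ⟨ζ, x, hx, hl⟩ := spinc_exists_eq_tmul s
  obtain ⟨α, h⟩ := exists_phase (m.bilin_comm _) (m.bilin_pos _) hA
    (isNormal_normalSpace m g ⟨S.proj p, hz⟩) (isLift_fixedDiff hs hz hl) ζ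
  exact ⟨α, (isPhase_iff hs hz hx α).mpr h⟩

theorem isPhase_iff_of_isPhase {g : G} {z : MulAction.fixedBy Z g} {α : Circle}
    (h : S.IsPhase g z α) (β : Circle) : S.IsPhase g z β ↔ β = α ∨
        ((β : ℂ) = -(α : ℂ) ∧ (fixedDiff (n := n) g z).HasEigenvalue (-1)) := by
  have hA := bilin_fixedDiff S z
  have hN := isNormal_normalSpace m g z
  obtain ⟨z, hz⟩ := z
  obtain ⟨p, rfl⟩ := S.toSpincStructure.exists_proj_eq z
  obtain ⟨s, hs⟩ := exists_act_eq_of_fixed hz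
  obtain ⟨ζ, x, hx, hl⟩ := spinc_exists_eq_tmul s
  have hB := m.bilin_comm (S.proj p)
  have hpos := m.bilin_pos (S.proj p)
  have hα := (isPhase_iff hs hz hx α).mp h
  rw [isPhase_iff hs hz hx]
  constructor
  · rintro ⟨k', θ', e', h', hβ⟩
    obtain ⟨k, θ, e, h, hα⟩ := hα
    rcases phase_eq_or_neg hB hpos hA hN h h' (hα.symm.trans hβ) with h1 | h1
    · exact Or.inl (Circle.ext h1)
    · exact Or.inr h1
  · rintro (rfl | ⟨hβ, hev⟩)
    · exact hα
    · obtain ⟨k, θ, e, h, hα⟩ := hα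
      obtain ⟨j, hj⟩ := (h.exists_angle_eq_pi hA hpos hN).mp hev
      obtain ⟨e', h', hr⟩ := h.exists_neg hB hj
      refine ⟨k, θ, e', h', ?_⟩
      rw [hα, hβ, TensorProduct.neg_tmul, ← TensorProduct.tmul_neg]
      exact congrArg (fun r => (α : ℂ) ⊗ₜ[ℝ] r) (neg_eq_iff_eq_neg.mpr hr).symm

end Pointwise

/-! ### A chart which straightens the fixed-point set -/

section FixedPointChart

variable {E : Type*} [NormedAddCommGroup E] [NormedSpace ℝ E] [FiniteDimensional ℝ E]

/-- Near a fixed point `x₀` of a smooth map `F`, there is a smooth chart which maps the fixed points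
of `F` to a linear subspace, provided that `x` is a fixed point as soon as `F x - x` is fixed by the
derivative of `F` at `x₀`. The subspace is the kernel of a projection `P` which commutes with this
derivative. -/
theorem exists_chart_of_fixed {F : E → E} {x₀ : E} {A P : E →L[ℝ] E} {Ω V : Set E}
    (hΩ : IsOpen Ω) (hx₀ : x₀ ∈ Ω) (hF : ContDiffOn ℝ ∞ F Ω) (hA : HasFDerivAt F A x₀)
    (hfix : F x₀ = x₀) (hV : V ∈ 𝓝 x₀) (hVF : ∀ x ∈ V, F x ∈ V → P (F x - x) = 0 → F x = x)
    (hP : ∀ v, P v = 0 ↔ A v = v) (hPP : ∀ v, P (P v) = P v) (hPA : ∀ v, P (A v) = A (P v)) :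
    ∃ e : OpenPartialHomeomorph E E, x₀ ∈ e.source ∧ e.source ⊆ Ω ∧
      ContDiffOn ℝ ∞ e e.source ∧ ContDiffOn ℝ ∞ e.symm e.target ∧
      (∀ x ∈ e.source, F x = x ↔ P (e x) = 0) ∧
      ∀ x ∈ e.source, F x = x → ∀ u, fderiv ℝ F x u = u ↔ P (fderiv ℝ e x u) = 0 := by
  -- The component in the image of `P` measures the failure of `x` to be fixed; the component in the
  -- kernel of `P` is a coordinate along the fixed vectors.
  set ψ : E → E := fun x => P (x - F x) + ((x - x₀) - P (x - x₀)) with hψ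
  have hne : (∞ : ℕ∞ω) ≠ 0 := by simp
  have hψd : ∀ x D, HasFDerivAt F D x → HasFDerivAt ψ
      (P.comp (ContinuousLinearMap.id ℝ E - D) + (ContinuousLinearMap.id ℝ E - P)) x := by
    intro x D hD
    have h1 : HasFDerivAt (fun x : E => x - x₀) (ContinuousLinearMap.id ℝ E) x :=
      (hasFDerivAt_id x).sub_const x₀
    have h2 := P.hasFDerivAt.comp x ((hasFDerivAt_id x).sub hD)
    have h3 := P.hasFDerivAt.comp x h1
    exact h2.add (h1.sub h3)
  have hFd : ∀ x ∈ Ω, HasFDerivAt F (fderiv ℝ F x) x := fun x hx =>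
    ((hF.contDiffAt (hΩ.mem_nhds hx)).differentiableAt hne).hasFDerivAt
  have hψs : ContDiffOn ℝ ∞ ψ Ω := by
    have h1 : ContDiffOn ℝ ∞ (fun x : E => x - x₀) Ω := (contDiff_id.sub contDiff_const).contDiffOn
    exact (P.contDiff.comp_contDiffOn (contDiffOn_id.sub hF)).add
      (h1.sub (P.contDiff.comp_contDiffOn h1))
  have hPd : ∀ x ∈ Ω, ∀ u, P (fderiv ℝ ψ x u) = P (u - fderiv ℝ F x u) := by
    intro x hx u
    rw [(hψd x _ (hFd x hx)).fderiv]
    simp [hPP]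
  have hPψ : ∀ x, P (ψ x) = P (x - F x) := by
    intro x
    simp [hψ, hPP]
  -- the derivative of `ψ` at `x₀` is invertible
  set T : E →L[ℝ] E := P.comp (ContinuousLinearMap.id ℝ E - A) +
    (ContinuousLinearMap.id ℝ E - P) with hT
  -- Applying `P` to `T v = 0` gives `P (v - A v) = 0`, hence `v = P v`. As `P` commutes with `A`,
  -- then `A v = v`, so `P v = 0` and `v = 0`.
  have hTinj : Function.Injective T := by
    rw [injective_iff_map_eq_zero]
    intro v hv
    have h1 : P (v - A v) + (v - P v) = 0 := by simpa [hT] using hv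
    have h2 : P (v - A v) = 0 := by
      have := congrArg P h1
      simpa [hPP] using this
    have h3 : v = P v := by
      rw [h2, zero_add, sub_eq_zero] at h1
      exact h1
    have h4 : A v = v := by
      rw [map_sub, hPA, ← h3, sub_eq_zero] at h2
      exact h2.symm
    rw [h3]
    exact (hP v).mpr h4
  let Te : E ≃L[ℝ] E :=
    (LinearEquiv.ofInjectiveEndo T.toLinearMap hTinj).toContinuousLinearEquiv
  have hTe : (Te : E →L[ℝ] E) = T := by
    ext v
    rfl
  have hψ₀ : HasFDerivAt ψ (Te : E →L[ℝ] E) x₀ := by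
    rw [hTe]
    exact hψd x₀ A hA
  have hψc : ContDiffAt ℝ ∞ ψ x₀ := hψs.contDiffAt (hΩ.mem_nhds hx₀)
  let e₀ := hψc.toOpenPartialHomeomorph ψ hψ₀ hne
  have he₀ : (e₀ : E → E) = ψ := hψc.toOpenPartialHomeomorph_coe hψ₀ hne
  have hmem₀ : x₀ ∈ e₀.source := hψc.mem_toOpenPartialHomeomorph_source hψ₀ hne
  -- The domain is shrunk so that the derivative of `ψ` is invertible throughout, which makes the
  -- inverse smooth on the whole target, and so that the criterion for fixed points applies.
  set s : Set E := {x | x ∈ Ω ∧ x ∈ V ∧ F x ∈ V ∧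
    fderiv ℝ ψ x ∈ Set.range fun f : E ≃L[ℝ] E => (f : E →L[ℝ] E)} with hs
  have hFcont : ContinuousAt F x₀ := hA.continuousAt
  have hds : ContinuousAt (fderiv ℝ ψ) x₀ := (hψc.continuousAt_fderiv (by simp))
  have hs₀ : s ∈ 𝓝 x₀ := by
    filter_upwards [hΩ.mem_nhds hx₀, hV, hFcont (show V ∈ 𝓝 (F x₀) by rwa [hfix]),
      hds (show _ ∈ 𝓝 (fderiv ℝ ψ x₀) by rw [hψ₀.fderiv]; exact Te.nhds)] with x h1 h2 h3 h4
    exact ⟨h1, h2, h3, h4⟩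
  let e := e₀.restr s
  have hes : ∀ x ∈ e.source, x ∈ s := fun x hx =>
    interior_subset ((e₀.restr_source s ▸ hx : x ∈ e₀.source ∩ interior s).2)
  have hec : (e : E → E) = ψ := he₀
  have hinv : ∀ y ∈ e.target, ContDiffAt ℝ ∞ e.symm y := by
    intro y hy
    have hx := e.map_target hy
    obtain ⟨f', hf'⟩ := (hes _ hx).2.2.2
    have hΩx := (hes _ hx).1
    refine e.contDiffAt_symm (f₀' := f') hy ?_ ?_
    · rw [show (f' : E →L[ℝ] E) = _ from hf', hec]
      exact (hψd _ _ (hFd _ hΩx)).differentiableAt.hasFDerivAt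
    · rw [hec]
      exact hψs.contDiffAt (hΩ.mem_nhds hΩx)
  have hiff : ∀ x ∈ e.source, F x = x ↔ P (e x) = 0 := by
    intro x hx
    rw [hec, hPψ]
    constructor
    · intro h
      rw [h, sub_self, map_zero]
    · intro h
      refine hVF x (hes x hx).2.1 (hes x hx).2.2.1 ?_
      rw [← neg_sub, map_neg, h, neg_zero]
  refine ⟨e, ?_, fun x hx => (hes x hx).1, ?_, fun y hy => (hinv y hy).contDiffWithinAt, hiff, ?_⟩
  · rw [e₀.restr_source]
    exact ⟨hmem₀, mem_interior_iff_mem_nhds.mpr hs₀⟩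
  · rw [hec]
    exact hψs.mono fun x hx => (hes x hx).1
  · intro x hx hFx u
    have hΩx := (hes x hx).1
    rw [hec, hPd x hΩx]
    constructor
    · intro h
      rw [h, sub_self, map_zero]
    · intro h
      have hdψ := (hψd _ _ (hFd _ hΩx)).differentiableAt.hasFDerivAt
      set w := fderiv ℝ ψ x u with hw
      have hPw : P w = 0 := by rw [hw, hPd x hΩx, h]
      -- the curve `t ↦ e⁻¹ (e x + t w)` consists of fixed points
      have hcurve : HasDerivAt (fun t : ℝ => ψ x + t • w) w 0 := by
        simpa using ((hasDerivAt_id (0 : ℝ)).smul_const w).const_add (ψ x)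
      have hsymm : HasFDerivAt e.symm (fderiv ℝ e.symm (ψ x)) (ψ x) := by
        have : ψ x ∈ e.target := hec ▸ e.map_source hx
        exact ((hinv _ this).differentiableAt hne).hasFDerivAt
      have hsx : e.symm (ψ x) = x := hec ▸ e.left_inv hx
      have hc : HasDerivAt (fun t : ℝ => e.symm (ψ x + t • w)) (fderiv ℝ e.symm (ψ x) w) 0 := by
        refine HasFDerivAt.comp_hasDerivAt (0 : ℝ) ?_ hcurve
        simpa using hsymm
      have hleft : fderiv ℝ e.symm (ψ x) w = u := by
        have h1 : HasFDerivAt (fun y => e.symm (ψ y)) ((fderiv ℝ e.symm (ψ x)).comp (fderiv ℝ ψ x))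
          x := hsymm.comp x hdψ
        have h2 : (fun y => e.symm (ψ y)) =ᶠ[𝓝 x] id := by
          filter_upwards [e.open_source.mem_nhds hx] with y hy
          exact hec ▸ e.left_inv hy
        have h3 := (h1.congr_of_eventuallyEq h2.symm).unique (hasFDerivAt_id x)
        exact congrArg (fun f : E →L[ℝ] E => f u) h3
      rw [hleft] at hc
      have hFc : HasDerivAt (fun t : ℝ => F (e.symm (ψ x + t • w))) (fderiv ℝ F x u) 0 := by
        refine HasFDerivAt.comp_hasDerivAt (0 : ℝ) ?_ hc
        simpa [hsx] using hFd x hΩx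
      have heq : (fun t : ℝ => F (e.symm (ψ x + t • w))) =ᶠ[𝓝 0]
          fun t : ℝ => e.symm (ψ x + t • w) := by
        have h1 : ∀ᶠ t : ℝ in 𝓝 0, ψ x + t • w ∈ e.target := by
          refine hcurve.continuousAt.eventually_mem (e.open_target.mem_nhds ?_)
          simpa using (hec ▸ e.map_source hx : ψ x ∈ e.target)
        filter_upwards [h1] with t ht
        rw [hiff _ (e.map_target ht), e.right_inv ht, map_add, map_smul, hPw, smul_zero, add_zero,
          hPψ, hFx, sub_self, map_zero]
      exact (hFc.congr_of_eventuallyEq heq.symm).unique hc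

end FixedPointChart

/-- After `k` steps the sequence is within `k ‖l‖ / 2` of `a 0 + k l`, so it has moved at least `k
‖l‖ / 2`; boundedness leaves only `l = 0`. -/
theorem eq_zero_of_bounded_drift {E : Type*} [NormedAddCommGroup E] [NormedSpace ℝ E] {a : ℕ → E}
    {l : E} {C : ℝ} (hC : ∀ k, ‖a k‖ ≤ C) (h : ∀ k, ‖a (k + 1) - a k - l‖ ≤ 1 / 2 * ‖l‖) :
    l = 0 := by
  have h1 : ∀ k : ℕ, ‖a k - a 0 - (k : ℝ) • l‖ ≤ k * (1 / 2 * ‖l‖) := by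
    intro k
    induction k with
    | zero => simp
    | succ k ih =>
      have : a (k + 1) - a 0 - ((k + 1 : ℕ) : ℝ) • l =
          (a (k + 1) - a k - l) + (a k - a 0 - (k : ℝ) • l) := by
        push_cast
        rw [add_smul, one_smul]
        abel
      rw [this]
      refine (norm_add_le _ _).trans ?_
      push_cast
      linarith [h k]
  have h2 : ∀ k : ℕ, k * ‖l‖ ≤ 4 * C := by
    intro k
    have h3 : ‖(k : ℝ) • l‖ ≤ ‖a k‖ + ‖a 0‖ + ‖a k - a 0 - (k : ℝ) • l‖ := by
      calc ‖(k : ℝ) • l‖ = ‖a k - a 0 - (a k - a 0 - (k : ℝ) • l)‖ := by congr 1; abel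
        _ ≤ ‖a k - a 0‖ + ‖a k - a 0 - (k : ℝ) • l‖ := norm_sub_le _ _
        _ ≤ _ := by gcongr; exact norm_sub_le _ _
    rw [norm_smul, Real.norm_natCast] at h3
    linarith [h1 k, hC k, hC 0]
  by_contra hl
  have hl' : 0 < ‖l‖ := norm_pos_iff.mpr hl
  obtain ⟨k, hk⟩ := exists_nat_gt (4 * C / ‖l‖)
  rw [div_lt_iff₀ hl'] at hk
  exact absurd (h2 k) (not_le.mpr hk)

/-! ### Uniform estimates for the isotropy group in a chart -/

section ChartAction

variable {n : ℕ} {Z : Type u} [TopologicalSpace Z] [ChartedSpace (Euc n) Z] {G : Type v} [Group G]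
  [MulAction G Z]

variable (n) in
/-- The action of a group element in the chart around `z₀`. -/
def chartAct (z₀ : Z) (h : G) (x : Euc n) : Euc n :=
  chartAt (Euc n) z₀ (h • (chartAt (Euc n) z₀).symm x)

theorem chartAct_base {z₀ : Z} {h : G} (hh : h • z₀ = z₀) :
    chartAct n z₀ h (chartAt (Euc n) z₀ z₀) = chartAt (Euc n) z₀ z₀ := by
  rw [chartAct, (chartAt (Euc n) z₀).left_inv (mem_chart_source _ z₀), hh]

variable [IsManifold (𝓡 n) ∞ Z]

/-- Joint smoothness in group element and point gives strict differentiability at `(k, z₀)` in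
charts. Comparing two pairs with the same group element leaves only the derivative in the point, so
a single `D` serves for all `h` near `k`, as the compactness argument requires. -/
theorem exists_strict_chartAct (d : ℕ) [TopologicalSpace G] [ChartedSpace (Euc d) G]
    [LieGroup (𝓡 d) ∞ G] [ContMDiffSMul (𝓡 d) (𝓡 n) ∞ G Z] {z₀ : Z} {k : G} (hk : k • z₀ = z₀) {ε : ℝ} (hε : 0 < ε) :
    ∃ D : Euc n →L[ℝ] Euc n, ∃ U ∈ 𝓝 k, ∃ W ∈ 𝓝 (chartAt (Euc n) z₀ z₀), ∀ h ∈ U, ∀ x ∈ W,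
      ∀ y ∈ W, ‖chartAct n z₀ h x - chartAct n z₀ h y - D (x - y)‖ ≤ ε * ‖x - y‖ := by
  set φ := chartAt (Euc n) z₀
  set χ := chartAt (Euc d) k
  have hne : (∞ : ℕ∞ω) ≠ 0 := by simp
  have : IsManifold (𝓡 d) ∞ G := ContMDiffMul.toIsManifold
  let H : Euc d × Euc n → Euc n := fun q => φ (χ.symm q.1 • φ.symm q.2)
  have h1 : ContMDiffAt 𝓘(ℝ, Euc d × Euc n) (𝓡 d) ∞ (fun q : Euc d × Euc n => χ.symm q.1)
      (χ k, φ z₀) :=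
    ((contMDiffOn_chart_symm (I := 𝓡 d) (n := ∞) (x := k)).contMDiffAt
      (χ.open_target.mem_nhds (mem_chart_target _ k))).comp (χ k, φ z₀)
        contDiffAt_fst.contMDiffAt
  have h2 : ContMDiffAt 𝓘(ℝ, Euc d × Euc n) (𝓡 n) ∞ (fun q : Euc d × Euc n => φ.symm q.2)
      (χ k, φ z₀) :=
    ((contMDiffOn_chart_symm (I := 𝓡 n) (n := ∞) (x := z₀)).contMDiffAt
      (φ.open_target.mem_nhds (mem_chart_target _ z₀))).comp (χ k, φ z₀)
        contDiffAt_snd.contMDiffAt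
  have h3 := h1.smul h2
  have hval : ((fun q : Euc d × Euc n => χ.symm q.1) • fun q : Euc d × Euc n => φ.symm q.2)
      (χ k, φ z₀) = z₀ := by
    change χ.symm (χ k) • φ.symm (φ z₀) = z₀
    rw [χ.left_inv (mem_chart_source _ k), φ.left_inv (mem_chart_source _ z₀), hk]
  have h4 : ContMDiffAt 𝓘(ℝ, Euc d × Euc n) (𝓡 n) ∞ H (χ k, φ z₀) := by
    refine ContMDiffAt.comp (χ k, φ z₀) ?_ h3
    change ContMDiffAt _ _ _ _ (((fun q : Euc d × Euc n => χ.symm q.1) •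
      fun q : Euc d × Euc n => φ.symm q.2) (χ k, φ z₀))
    rw [hval]
    exact (contMDiffOn_chart (I := 𝓡 n) (n := ∞) (x := z₀)).contMDiffAt
      (φ.open_source.mem_nhds (mem_chart_source _ z₀))
  have h5 := (contMDiffAt_iff_contDiffAt.mp h4).hasStrictFDerivAt hne
  set D' := fderiv ℝ H (χ k, φ z₀)
  have h6 := h5.isLittleO.def hε
  rw [nhds_prod_eq, nhds_prod_eq, Filter.eventually_prod_iff] at h6
  obtain ⟨p₁, hp₁, p₂, hp₂, hp⟩ := h6
  obtain ⟨a₁, ha₁, b₁, hb₁, hab₁⟩ := Filter.eventually_prod_iff.mp hp₁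
  obtain ⟨a₂, ha₂, b₂, hb₂, hab₂⟩ := Filter.eventually_prod_iff.mp hp₂
  have hχ : ContinuousAt χ k := χ.continuousAt (mem_chart_source _ k)
  refine ⟨D'.comp (ContinuousLinearMap.inr ℝ (Euc d) (Euc n)),
    {h | h ∈ χ.source ∧ a₁ (χ h) ∧ a₂ (χ h)}, ?_, {x | b₁ x ∧ b₂ x}, hb₁.and hb₂, ?_⟩
  · filter_upwards [χ.open_source.mem_nhds (mem_chart_source _ k), hχ.eventually ha₁,
      hχ.eventually ha₂] with h hh1 hh2 hh3
    exact ⟨hh1, hh2, hh3⟩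
  · rintro h ⟨hh, hh1, hh2⟩ x ⟨hx, -⟩ y ⟨-, hy⟩
    have h7 := hp (hab₁ hh1 hx) (hab₂ hh2 hy)
    have h8 : ∀ y, H (χ h, y) = chartAct n z₀ h y := by
      intro y
      change φ (χ.symm (χ h) • φ.symm y) = _
      rw [χ.left_inv hh]
      rfl
    rw [h8, h8, Prod.mk_sub_mk, sub_self] at h7
    simpa [Prod.norm_def] using h7

/-- Near `z₀`, the elements of the isotropy group whose derivative at `z₀` fixes `P = 0` move
differences in `P = 0` uniformly little. -/
theorem eventually_chartAct_sub (d : ℕ) [TopologicalSpace G] [ChartedSpace (Euc d) G]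
    [LieGroup (𝓡 d) ∞ G] [ContMDiffSMul (𝓡 d) (𝓡 n) ∞ G Z] [T2Space Z] [CompactSpace G] (z₀ : Z) (P : Euc n →L[ℝ] Euc n) :
    ∃ V ∈ 𝓝 (chartAt (Euc n) z₀ z₀), ∀ h : G, h • z₀ = z₀ →
      (∀ x ∈ V, ‖chartAct n z₀ h x - chartAt (Euc n) z₀ z₀‖ ≤ 1) ∧
      ((∃ M : Euc n →L[ℝ] Euc n, HasFDerivAt (chartAct n z₀ h) M (chartAt (Euc n) z₀ z₀) ∧
        ∀ l, P l = 0 → M l = l) → ∀ x ∈ V, ∀ y ∈ V, P (x - y) = 0 →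
        ‖chartAct n z₀ h x - chartAct n z₀ h y - (x - y)‖ ≤ 1 / 2 * ‖x - y‖) := by
  set x₀ := chartAt (Euc n) z₀ z₀ with hx₀
  have := ContMDiffSMul.continuousSMul (I := 𝓡 d) (I' := 𝓡 n) (G := G) (M := Z) ∞
  have hK : IsCompact {h : G | h • z₀ = z₀} :=
    (isClosed_eq (continuous_id.smul continuous_const) continuous_const).isCompact
  let Q : Euc n × Euc n → G → Prop := fun q h => h • z₀ = z₀ → 
    (‖chartAct n z₀ h q.1 - x₀‖ ≤ 1) ∧
      ((∃ M : Euc n →L[ℝ] Euc n, HasFDerivAt (chartAct n z₀ h) M x₀ ∧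
        ∀ l, P l = 0 → M l = l) → P (q.1 - q.2) = 0 →
        ‖chartAct n z₀ h q.1 - chartAct n z₀ h q.2 - (q.1 - q.2)‖ ≤ 1 / 2 * ‖q.1 - q.2‖)
  have key : ∀ᶠ q in 𝓝 (x₀, x₀), ∀ h ∈ {h : G | h • z₀ = z₀}, Q q h := by
    refine hK.eventually_forall_of_forall_eventually fun k hk => ?_
    -- The bound `1 / 2` is the sum of two errors of `1 / 4`: that of `D` as an approximation of the
    -- action of `h`, and the distance from `D` to the derivative `M` of `h` itself.
    obtain ⟨D, U, hU, W, hW, hD⟩ := exists_strict_chartAct (n := n) d hk (ε := 1 / 4) (by norm_num)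
    have hb : ∀ᶠ x in 𝓝 x₀, (1 / 4 + ‖D‖) * ‖x - x₀‖ ≤ 1 := by
      have : Filter.Tendsto (fun x => (1 / 4 + ‖D‖) * ‖x - x₀‖) (𝓝 x₀)
          (𝓝 ((1 / 4 + ‖D‖) * ‖x₀ - x₀‖)) := by
        exact Continuous.tendsto (by fun_prop) x₀
      rw [sub_self, norm_zero, mul_zero] at this
      exact this.eventually (ge_mem_nhds zero_lt_one)
    rw [nhds_prod_eq, nhds_prod_eq]
    filter_upwards [((hb.and hW).prod_mk hW).prod_mk hU]
    rintro ⟨⟨x, y⟩, h⟩ ⟨⟨⟨hx1, hx⟩, hy⟩, hh⟩ hfix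
    have hx₀W : x₀ ∈ W := mem_of_mem_nhds hW
    have hbase : chartAct n z₀ h x₀ = x₀ := chartAct_base hfix
    refine ⟨?_, ?_⟩
    · have h1 := hD h hh x hx x₀ hx₀W
      rw [hbase] at h1
      calc ‖chartAct n z₀ h x - x₀‖
          = ‖(chartAct n z₀ h x - x₀ - D (x - x₀)) + D (x - x₀)‖ := by congr 1; abel
        _ ≤ 1 / 4 * ‖x - x₀‖ + ‖D‖ * ‖x - x₀‖ :=
          (norm_add_le _ _).trans (add_le_add h1 (D.le_opNorm _))
        _ ≤ 1 := by rw [← add_mul]; exact hx1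
    · rintro ⟨M, hM, hMl⟩ hP
      have h1 : HasFDerivAt (fun x => chartAct n z₀ h x - D x) (M - D) x₀ :=
        hM.sub D.hasFDerivAt
      have h2 : ‖M - D‖ ≤ 1 / 4 := by
        refine h1.le_of_lip' (by norm_num) ?_
        filter_upwards [hW] with x hx
        have := hD h hh x hx x₀ hx₀W
        rwa [map_sub, sub_sub_sub_comm] at this
      have h3 := hD h hh x hx y hy
      have h4 := (M - D).le_of_opNorm_le h2 (x - y)
      rw [sub_apply, hMl _ hP] at h4
      dsimp only
      calc ‖chartAct n z₀ h x - chartAct n z₀ h y - (x - y)‖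
          = ‖(chartAct n z₀ h x - chartAct n z₀ h y - D (x - y)) - (x - y - D (x - y))‖ := by
            congr 1; abel
        _ ≤ 1 / 4 * ‖x - y‖ + 1 / 4 * ‖x - y‖ := (norm_sub_le _ _).trans (add_le_add h3 h4)
        _ = _ := by ring
  rw [nhds_prod_eq, Filter.eventually_prod_iff] at key
  obtain ⟨p, hp, q, hq, hpq⟩ := key
  refine ⟨{x | p x ∧ q x}, hp.and hq, fun h hh => ⟨fun x hx => (hpq hx.1 hx.2 h hh hh).1,
    fun hM x hx y hy hP => (hpq hx.1 hy.2 h hh hh).2 hM hP⟩⟩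

end ChartAction

/-! ### The fixed-point set is a submanifold -/

section FixedSubmanifold

variable {n : ℕ} {Z : Type u} [TopologicalSpace Z] [ChartedSpace (Euc n) Z]
  {G : Type v} [Group G] [MulAction G Z]

theorem chartAct_mul {z₀ : Z} (h : G) {g : G} {x : Euc n}
    (hx : g • (chartAt (Euc n) z₀).symm x ∈ (chartAt (Euc n) z₀).source) :
    chartAct n z₀ (h * g) x = chartAct n z₀ h (chartAct n z₀ g x) := by
  rw [chartAct, chartAct, chartAct, (chartAt (Euc n) z₀).left_inv hx, mul_smul]

/-- The differential at a fixed point, as a continuous linear map. -/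
def fixedDiffL (g : G) (z : MulAction.fixedBy Z g) : Euc n →L[ℝ] Euc n :=
  mfderiv (𝓡 n) (𝓡 n) (fun y : Z => g • y) (z : Z)

theorem fixedDiffL_apply (g : G) (z : MulAction.fixedBy Z g) (v : Tan n (z : Z)) :
    fixedDiffL g z v = fixedDiff g z v := rfl

theorem mem_fixedTangent {g : G} {z : MulAction.fixedBy Z g} {v : Tan n (z : Z)} :
    v ∈ fixedTangent n g z ↔ fixedDiff g z v = v := by
  rw [fixedTangent, LinearMap.mem_ker, LinearMap.sub_apply, sub_eq_zero, LinearMap.id_apply]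

theorem hasFDerivAt_chartAct {g : G} (hg : MDifferentiable (𝓡 n) (𝓡 n) fun y : Z => g • y)
    (z : MulAction.fixedBy Z g) :
    HasFDerivAt (chartAct n (z : Z) g) (fixedDiffL g z) (chartAt (Euc n) (z : Z) z) := by
  have h := (hg (z : Z)).hasMFDerivAt.2
  have hz : g • (z : Z) = z := z.2
  simp only [writtenInExtChartAt, hz] at h
  have h' : HasFDerivWithinAt (chartAct n (z : Z) g) (fixedDiffL g z) (Set.range (𝓡 n))
      (chartAt (Euc n) (z : Z) z) := h
  rwa [ModelWithCorners.range_eq_univ, hasFDerivWithinAt_univ] at h'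

theorem hasFDerivAt_chartAct_pow {g : G} (hg : ContMDiff (𝓡 n) (𝓡 n) ∞ fun y : Z => g • y)
    (z : MulAction.fixedBy Z g) (k : ℕ) :
    HasFDerivAt (chartAct n (z : Z) (g ^ k)) (fixedDiffL g z ^ k) (chartAt (Euc n) (z : Z) z) := by
  set φ := chartAt (Euc n) (z : Z)
  have hne : (∞ : ℕ∞ω) ≠ 0 := by simp
  have hz : g • (z : Z) = z := z.2
  induction k with
  | zero =>
    refine (hasFDerivAt_id (φ z)).congr_of_eventuallyEq ?_
    filter_upwards [φ.open_target.mem_nhds (mem_chart_target _ (z : Z))] with x hx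
    rw [pow_zero, chartAct, one_smul]
    exact φ.right_inv hx
  | succ k ih =>
    have h1 := hasFDerivAt_chartAct (hg.mdifferentiable hne) z
    have h2 : HasFDerivAt (chartAct n (z : Z) (g ^ k)) (fixedDiffL g z ^ k)
        (chartAct n (z : Z) g (φ z)) := by
      rw [chartAct_base hz]
      exact ih
    rw [pow_succ]
    refine (h2.comp (φ z) h1).congr_of_eventuallyEq ?_
    have h3 : ContinuousAt (fun x => g • φ.symm x) (φ z) :=
      hg.continuous.continuousAt.comp (φ.symm.continuousAt (mem_chart_target _ (z : Z)))
    have h4 : ∀ᶠ x in 𝓝 (φ z), g • φ.symm x ∈ φ.source := by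
      refine h3.eventually_mem (φ.open_source.mem_nhds ?_)
      rw [φ.left_inv (mem_chart_source _ (z : Z)), hz]
      exact mem_chart_source _ (z : Z)
    filter_upwards [h4] with x hx
    exact chartAct_mul (g ^ k) hx

variable [IsManifold (𝓡 n) ∞ Z]

/-- The projection onto the normal space along `ker (dg - 1)`. -/
theorem exists_normal_projection (m : Metric n Z) (g : G) (z : MulAction.fixedBy Z g)
    (hiso : ∀ v w, m.bilin (z : Z) (fixedDiff g z v) (fixedDiff g z w) = m.bilin (z : Z) v w) :
    ∃ P : Euc n →L[ℝ] Euc n, (∀ v, P v = 0 ↔ fixedDiffL g z v = v) ∧ (∀ v, P (P v) = P v) ∧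
      ∀ v, P (fixedDiffL g z v) = fixedDiffL g z (P v) := by
  have hN := isNormal_normalSpace m g z
  have hc := hN.isCompl (m.bilin_comm (z : Z)) (m.bilin_pos (z : Z))
  let P : Tan n (z : Z) →ₗ[ℝ] Tan n (z : Z) := (normalSpace m g z).projection
    (fixedTangent n g z) hc.symm
  have hPker : ∀ v : Tan n (z : Z), P v = 0 ↔ fixedDiff g z v = v := fun v =>
    (Submodule.projection_apply_eq_zero_iff hc.symm).trans mem_fixedTangent
  have hPN : ∀ v ∈ normalSpace m g z, P v = v := fun v hv =>
    Submodule.projection_apply_left hc.symm ⟨v, hv⟩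
  have hPmem : ∀ v, P v ∈ normalSpace m g z := Submodule.projection_apply_mem hc.symm
  have hAN : ∀ v ∈ normalSpace m g z, fixedDiff g z v ∈ normalSpace m g z := by
    intro v hv
    rw [hN]
    intro w hw
    rw [← hw, hiso]
    exact (hN v).mp hv w hw
  have hPA : ∀ v, P (fixedDiff g z v) = fixedDiff g z (P v) := by
    intro v
    have h1 : P (v - P v) = 0 := by rw [map_sub, hPN _ (hPmem v), sub_self]
    have h2 := (hPker _).mp h1
    have h3 : fixedDiff g z v = fixedDiff g z (P v) + (v - P v) := by
      rw [← h2, ← map_add, add_sub_cancel]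
    rw [h3, map_add, h1, add_zero, hPN _ (hAN _ (hPmem v))]
  exact ⟨LinearMap.toContinuousLinearMap (E := Euc n) (F' := Euc n) P, hPker,
    fun v => hPN _ (hPmem v), hPA⟩

/-- The isometry property splits the tangent space into fixed and normal vectors, and compactness of
the isotropy group gives the criterion for fixed points that `exists_chart_of_fixed` asks for. -/
theorem isFixedSubmanifold_of_isometry {d : ℕ} [TopologicalSpace G] [ChartedSpace (Euc d) G]
    [LieGroup (𝓡 d) ∞ G] [ContMDiffSMul (𝓡 d) (𝓡 n) ∞ G Z] [T2Space Z] [CompactSpace G]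
    (m : Metric n Z) (g : G) (hiso : ∀ (z : MulAction.fixedBy Z g) v w,
      m.bilin (z : Z) (fixedDiff g z v) (fixedDiff g z w) = m.bilin (z : Z) v w) :
    IsFixedSubmanifold n Z g := by
  intro z₀
  have hne : (∞ : ℕ∞ω) ≠ 0 := by simp
  have hg : ContMDiff (𝓡 n) (𝓡 n) ∞ fun y : Z => g • y :=
    ContMDiffSMul.contMDiff_const_smul (I := 𝓡 d) g
  set φ := chartAt (Euc n) (z₀ : Z) with hφ
  set F := chartAct n (z₀ : Z) g with hF
  have hz₀ : g • (z₀ : Z) = z₀ := z₀.2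
  obtain ⟨P, hP, hPP, hPA⟩ := exists_normal_projection m g z₀ (hiso z₀)
  obtain ⟨V, hV, hVh⟩ := eventually_chartAct_sub d (G := G) (z₀ : Z) P
  have hFφ : ContMDiffOn (𝓡 n) (𝓡 n) ∞ (fun x => g • φ.symm x) φ.target :=
    hg.comp_contMDiffOn contMDiffOn_chart_symm
  set Ω : Set (Euc n) := φ.target ∩ (fun x => g • φ.symm x) ⁻¹' φ.source with hΩ
  have hΩo : IsOpen Ω := hFφ.continuousOn.isOpen_inter_preimage φ.open_target φ.open_source
  have hx₀ : φ z₀ ∈ Ω := by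
    refine ⟨mem_chart_target _ (z₀ : Z), ?_⟩
    change g • φ.symm (φ z₀) ∈ φ.source
    rw [φ.left_inv (mem_chart_source _ (z₀ : Z)), hz₀]
    exact mem_chart_source _ (z₀ : Z)
  have hFs : ContDiffOn ℝ ∞ F Ω := by
    rw [← contMDiffOn_iff_contDiffOn]
    exact contMDiffOn_chart.comp (hFφ.mono fun x hx => hx.1) fun x hx => hx.2
  have hfixk : ∀ k : ℕ, g ^ k • (z₀ : Z) = z₀ := fun k =>
    pow_mem (show g ∈ MulAction.stabilizer G (z₀ : Z) from hz₀) k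
  -- With `l = F x - x`, the derivative of every `g ^ k` fixes `l`, so `g ^ k` carries `x` and `F x`
  -- to points whose difference is within `‖l‖ / 2` of `l`. All `g ^ k x` stay within distance `1`
  -- of the fixed point in the chart, and the bounded drift gives `l = 0`.
  have hVF : ∀ x ∈ V ∩ Ω, F x ∈ V ∩ Ω → P (F x - x) = 0 → F x = x := by
    intro x hx hFx hPl
    refine sub_eq_zero.mp (eq_zero_of_bounded_drift
      (a := fun k => chartAct n (z₀ : Z) (g ^ k) x - φ z₀) (C := 1) ?_ ?_)
    · exact fun k => (hVh (g ^ k) (hfixk k)).1 x hx.1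
    · intro k
      have h1 := (hVh (g ^ k) (hfixk k)).2 ⟨_, hasFDerivAt_chartAct_pow hg z₀ k, ?_⟩ (F x) hFx.1 x
        hx.1 hPl
      · rw [sub_sub_sub_cancel_right, pow_succ, chartAct_mul _ hx.2.2]
        exact h1
      · intro l hl
        have h2 := (hP l).mp hl
        induction k with
        | zero => simp
        | succ k ih => rw [pow_succ, mul_apply_eq_comp, h2, ih]
  obtain ⟨e, he₀, heΩ, hes, hes', hefix, hed⟩ := exists_chart_of_fixed hΩo hx₀ hFs
    (hasFDerivAt_chartAct (hg.mdifferentiable hne) z₀) (chartAct_base hz₀)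
    (Filter.inter_mem hV (hΩo.mem_nhds hx₀)) hVF hP hPP hPA
  refine ⟨φ ≫ₕ e, ?_, ?_, LinearMap.ker P.toLinearMap, ?_, ?_⟩
  · refine (φ ≫ₕ e).mem_maximalAtlas_of_contMDiffOn ?_ ?_
    · exact (contMDiffOn_iff_contDiffOn.mpr hes).comp
        (contMDiffOn_chart.mono fun x hx => (OpenPartialHomeomorph.trans_source φ e ▸ hx).1)
        fun x hx => (OpenPartialHomeomorph.trans_source φ e ▸ hx).2
    · exact contMDiffOn_chart_symm.comp ((contMDiffOn_iff_contDiffOn.mpr hes').mono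
        fun x hx => (OpenPartialHomeomorph.trans_target φ e ▸ hx).1)
        fun x hx => (OpenPartialHomeomorph.trans_target φ e ▸ hx).2
  · rw [OpenPartialHomeomorph.trans_source]
    exact ⟨mem_chart_source _ (z₀ : Z), he₀⟩
  · intro y hy
    rw [OpenPartialHomeomorph.trans_source] at hy
    have h1 := hefix _ hy.2
    have h2 := (heΩ hy.2).2
    change g • φ.symm (φ y) ∈ φ.source at h2
    rw [φ.left_inv hy.1] at h2
    change g • y = y ↔ P (e (φ y)) = 0
    rw [← h1, hF, chartAct, ← hφ, φ.left_inv hy.1]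
    exact (φ.injOn.eq_iff h2 hy.1).symm
  · intro z hz v
    rw [OpenPartialHomeomorph.trans_source] at hz
    have hzg : g • (z : Z) = z := z.2
    have hzφ : φ.symm (φ z) = z := φ.left_inv hz.1
    have hx : φ z ∈ Ω := heΩ hz.2
    have hfixz : F (φ z) = φ z := by
      rw [hF, chartAct, ← hφ, hzφ, hzg]
    have hφd : φ.MDifferentiable (𝓡 n) (𝓡 n) := mdifferentiable_chart (z₀ : Z)
    have hφz := (hφd.mdifferentiableAt hz.1).hasMFDerivAt
    set D : Euc n →L[ℝ] Euc n := mfderiv (𝓡 n) (𝓡 n) φ (z : Z) with hD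
    have hDinj : Function.Injective D := hφd.mfderiv_injective hz.1
    have hφgz : HasMFDerivAt (𝓡 n) (𝓡 n) φ (g • (z : Z)) D := by
      have : ∀ y : Z, y = z → HasMFDerivAt (𝓡 n) (𝓡 n) φ y D := by
        rintro _ rfl
        exact hφz
      exact this _ hzg
    have hFz : HasFDerivAt F (fderiv ℝ F (φ z)) (φ z) :=
      ((hFs.contDiffAt (hΩo.mem_nhds hx)).differentiableAt hne).hasFDerivAt
    have hez : HasFDerivAt e (fderiv ℝ e (φ z)) (φ z) :=
      ((hes.contDiffAt (e.open_source.mem_nhds hz.2)).differentiableAt hne).hasFDerivAt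
    have h1 : HasMFDerivAt (𝓡 n) (𝓡 n) (fun y : Z => φ (g • y)) (z : Z)
        (D.comp (fixedDiffL g z)) :=
      HasMFDerivAt.comp (z : Z) hφgz (hg.mdifferentiable hne (z : Z)).hasMFDerivAt
    have h2 : HasMFDerivAt (𝓡 n) (𝓡 n) (fun y : Z => F (φ y)) (z : Z)
        ((fderiv ℝ F (φ z)).comp D) :=
      HasMFDerivAt.comp (I' := 𝓡 n) (g := F) (f := φ) (z : Z) hFz.hasMFDerivAt hφz
    have h3 : (fun y : Z => F (φ y)) =ᶠ[𝓝 (z : Z)] fun y => φ (g • y) := by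
      filter_upwards [φ.open_source.mem_nhds hz.1] with y hy
      rw [hF, chartAct, ← hφ, φ.left_inv hy]
    -- Both sides differentiate the same map at `z`. Thus the differential of the chart intertwines
    -- `dg` with the derivative of `F` at every fixed point in the domain, not only at the centre.
    have h4 : D.comp (fixedDiffL g z) = (fderiv ℝ F (φ z)).comp D :=
      hasMFDerivAt_unique (h1.congr_of_eventuallyEq h3) h2
    have h5 : HasMFDerivAt (𝓡 n) (𝓡 n) (φ ≫ₕ e) (z : Z) ((fderiv ℝ e (φ z)).comp D) :=
      HasMFDerivAt.comp (I' := 𝓡 n) (g := e) (f := φ) (z : Z) hez.hasMFDerivAt hφz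
    rw [h5.mfderiv, mem_fixedTangent]
    refine Iff.trans ?_ (hed _ hz.2 hfixz (D v))
    refine hDinj.eq_iff.symm.trans ?_
    rw [← fixedDiffL_apply]
    change (D.comp (fixedDiffL g z)) v = D v ↔ _
    rw [h4]
    rfl

end FixedSubmanifold

/-! ### Local constancy of the rank and of the eigenvalue `-1` -/

section FixedRank

variable {n : ℕ} {Z : Type u} [TopologicalSpace Z] [ChartedSpace (Euc n) Z]
  {G : Type v} [Group G] [MulAction G Z]

theorem fixedDiff_pow {g : G} (hg : ContMDiff (𝓡 n) (𝓡 n) ∞ fun y : Z => g • y)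
    (k : ℕ) (z : MulAction.fixedBy Z g) (hgk : ContMDiff (𝓡 n) (𝓡 n) ∞ fun y : Z => g ^ k • y)
    (hz : (z : Z) ∈ MulAction.fixedBy Z (g ^ k)) (v : Tan n (z : Z)) :
    fixedDiff (Z := Z) (g ^ k) ⟨z, hz⟩ v = (fixedDiff g z ^ k) v := by
  have h1 := hasFDerivAt_chartAct (hgk.mdifferentiable (by simp)) ⟨(z : Z), hz⟩
  have h2 := h1.unique (hasFDerivAt_chartAct_pow hg z k)
  rw [← fixedDiffL_apply, h2]
  have key : ∀ (j : ℕ) (v : Tan n (z : Z)), (fixedDiffL g z ^ j) v = (fixedDiff g z ^ j) v := by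
    intro j
    induction j with
    | zero => exact fun v => rfl
    | succ j ih => exact fun v => by rw [pow_succ, pow_succ]; exact ih _
  exact key k v

variable [IsManifold (𝓡 n) ∞ Z]

theorem IsFixedSubmanifold.eventually_finrank {g : G} (h : IsFixedSubmanifold n Z g)
    (z₀ : MulAction.fixedBy Z g) : ∀ᶠ z in 𝓝 z₀,
      Module.finrank ℝ (fixedTangent n g z) = Module.finrank ℝ (fixedTangent n g z₀) := by
  obtain ⟨e, he, hz₀, L, -, hL⟩ := h z₀
  have hne : (∞ : ℕ∞ω) ≠ 0 := by simp
  have hed : e.MDifferentiable (𝓡 n) (𝓡 n) :=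
    ⟨(contMDiffOn_of_mem_maximalAtlas he).mdifferentiableOn hne,
      (contMDiffOn_symm_of_mem_maximalAtlas he).mdifferentiableOn hne⟩
  have key : ∀ z : MulAction.fixedBy Z g, (z : Z) ∈ e.source →
      Module.finrank ℝ (fixedTangent n g z) = Module.finrank ℝ L := by
    intro z hz
    let D : Tan n (z : Z) ≃ₗ[ℝ] Euc n := (hed.mfderiv hz).toLinearEquiv
    have h1 : fixedTangent n g z = L.comap D.toLinearMap := by
      ext v
      exact hL z hz v
    rw [h1]
    exact (D.ofSubmodule' L).finrank_eq
  have h1 : ∀ᶠ z : MulAction.fixedBy Z g in 𝓝 z₀, (z : Z) ∈ e.source :=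
    continuous_subtype_val.continuousAt.eventually_mem (e.open_source.mem_nhds hz₀)
  filter_upwards [h1] with z hz
  rw [key z hz, key z₀ hz₀]

/-- If `A² v = v` but `A v ≠ v`, then `A v - v` is an eigenvector for `-1`. This expresses the
eigenvalue through dimensions of spaces of fixed vectors. -/
theorem hasEigenvalue_neg_one_iff {V : Type*} [AddCommGroup V] [Module ℝ V]
    [FiniteDimensional ℝ V] (A : Module.End ℝ V) : A.HasEigenvalue (-1) ↔
      Module.finrank ℝ (LinearMap.ker (A - LinearMap.id)) <
        Module.finrank ℝ (LinearMap.ker (A ^ 2 - LinearMap.id)) := by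
  have hmem : ∀ v, v ∈ LinearMap.ker (A ^ 2 - LinearMap.id) ↔ A (A v) = v := by
    intro v
    rw [LinearMap.mem_ker, LinearMap.sub_apply, sub_eq_zero, pow_two]
    rfl
  have hmem1 : ∀ v, v ∈ LinearMap.ker (A - LinearMap.id) ↔ A v = v := by
    intro v
    rw [LinearMap.mem_ker, LinearMap.sub_apply, sub_eq_zero]
    rfl
  have hle : LinearMap.ker (A - LinearMap.id) ≤ LinearMap.ker (A ^ 2 - LinearMap.id) := by
    intro v hv
    rw [hmem1] at hv
    rw [hmem, hv, hv]
  constructor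
  · intro h
    obtain ⟨v, hv⟩ := h.exists_hasEigenvector
    have hv1 : A v = -v := by simpa using hv.apply_eq_smul
    refine Submodule.finrank_lt_finrank_of_lt (lt_of_le_of_ne hle fun heq => ?_)
    have h2 : v ∈ LinearMap.ker (A - LinearMap.id) := by
      rw [heq, hmem, hv1, map_neg, hv1, neg_neg]
    rw [hmem1, hv1] at h2
    have h3 : (2 : ℝ) • v = 0 := by rw [two_smul]; nth_rewrite 1 [← h2]; exact neg_add_cancel v
    exact hv.2 ((smul_eq_zero.mp h3).resolve_left two_ne_zero)
  · intro h
    by_contra hev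
    refine absurd h (not_lt.mpr (Submodule.finrank_mono fun v hv => ?_))
    rw [hmem] at hv
    rw [hmem1]
    by_contra hne
    refine hev (Module.End.hasEigenvalue_of_hasEigenvector (x := A v - v)
      ⟨Module.End.mem_eigenspace_iff.mpr ?_, sub_ne_zero.mpr hne⟩)
    rw [map_sub, hv, neg_one_smul, neg_sub]

/-- The two dimensions in the criterion are the ranks of the fixed submanifolds of `g` and of `g ^
2`, both locally constant. -/
theorem eventually_hasEigenvalue_neg_one {g : G} (hg : ContMDiff (𝓡 n) (𝓡 n) ∞ fun y : Z => g • y)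
    (hg2 : ContMDiff (𝓡 n) (𝓡 n) ∞ fun y : Z => g ^ 2 • y)
    (h : IsFixedSubmanifold n Z g) (h2 : IsFixedSubmanifold n Z (g ^ 2))
    (z₀ : MulAction.fixedBy Z g) : ∀ᶠ z in 𝓝 z₀,
      ((fixedDiff (n := n) g z).HasEigenvalue (-1) ↔
        (fixedDiff (n := n) g z₀).HasEigenvalue (-1)) := by
  have hmem : ∀ z : MulAction.fixedBy Z g, (z : Z) ∈ MulAction.fixedBy Z (g ^ 2) := fun z =>
    pow_mem (show g ∈ MulAction.stabilizer G (z : Z) from z.2) 2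
  let i : MulAction.fixedBy Z g → MulAction.fixedBy Z (g ^ 2) := fun z => ⟨z, hmem z⟩
  have hi : Continuous i := continuous_subtype_val.subtype_mk _
  have hdiff : ∀ z, fixedDiff (n := n) (g ^ 2) (i z) = fixedDiff g z ^ 2 := fun z =>
    LinearMap.ext (fixedDiff_pow hg 2 z hg2 (hmem z))
  have key : ∀ z, (fixedDiff (n := n) g z).HasEigenvalue (-1) ↔
      Module.finrank ℝ (fixedTangent n g z) < Module.finrank ℝ (fixedTangent n (g ^ 2) (i z)) := by
    intro z
    have h3 : fixedTangent n (g ^ 2) (i z) = LinearMap.ker (fixedDiff g z ^ 2 - LinearMap.id) :=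
      congrArg (fun A => LinearMap.ker (A - LinearMap.id)) (hdiff z)
    rw [h3]
    exact hasEigenvalue_neg_one_iff _
  filter_upwards [h.eventually_finrank z₀, hi.continuousAt.eventually (h2.eventually_finrank (i z₀))]
    with z h3 h4
  rw [key, key, h3, h4]

end FixedRank

/-! ### Continuous functions on `Spin^c(n)` -/

section SpincTopology

open CliffordAlgebra

variable {V : Type*} [AddCommGroup V] [Module ℝ V]

instance finite_cliffordAlgebra [FiniteDimensional ℝ V] (Q : QuadraticForm ℝ V) :
    Module.Finite ℝ (CliffordAlgebra Q) := by
  have := Module.Finite.of_basis (Module.finBasis ℝ V).ExteriorAlgebra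
  exact Module.Finite.equiv (equivExterior Q).symm

/-- The `ℂ`-linear extension of the anti-automorphism `star` of the Clifford algebra. -/
def starC (Q : QuadraticForm ℝ V) : CliffC Q →ₗ[ℝ] CliffC Q :=
  TensorProduct.map LinearMap.id (reverse ∘ₗ involute.toLinearMap)

theorem starC_tmul (Q : QuadraticForm ℝ V) (ζ : ℂ) (x : CliffordAlgebra Q) :
    starC Q (ζ ⊗ₜ[ℝ] x) = ζ ⊗ₜ[ℝ] star x := rfl

/-- The `ℂ`-antilinear extension of the anti-automorphism `star` of the Clifford algebra. -/
def conjStarC (Q : QuadraticForm ℝ V) : CliffC Q →ₗ[ℝ] CliffC Q :=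
  TensorProduct.map Complex.conjAe.toLinearMap (reverse ∘ₗ involute.toLinearMap)

theorem conjStarC_tmul (Q : QuadraticForm ℝ V) (ζ : ℂ) (x : CliffordAlgebra Q) :
    conjStarC Q (ζ ⊗ₜ[ℝ] x) = (starRingEnd ℂ ζ) ⊗ₜ[ℝ] star x := rfl

/-- The scalar part of an element of the complex Clifford algebra. -/
def scalarC (Q : QuadraticForm ℝ V) : CliffC Q →ₗ[ℝ] ℂ :=
  (TensorProduct.rid ℝ ℂ).toLinearMap ∘ₗ TensorProduct.map LinearMap.id (scalarPart Q)

theorem scalarC_tmul (Q : QuadraticForm ℝ V) (ζ : ℂ) (x : CliffordAlgebra Q) :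
    scalarC Q (ζ ⊗ₜ[ℝ] x) = scalarPart Q x • ζ := rfl

theorem scalarPart_one (Q : QuadraticForm ℝ V) : scalarPart Q 1 = 1 := by
  simp [scalarPart, equivExterior, changeForm_one]

/-- The vector part of an element of the complex Clifford algebra, with real coefficient. -/
def vectorPart (Q : QuadraticForm ℝ V) : CliffC Q →ₗ[ℝ] V :=
  TensorProduct.lift (LinearMap.mk₂ ℝ
    (fun (ζ : ℂ) x => ζ.re • ExteriorAlgebra.ιInv (equivExterior Q x))
    (by simp [add_smul]) (by simp [mul_smul]) (by simp)
    (fun c ζ x => by rw [map_smul, map_smul, smul_comm]))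

variable {n : ℕ}

theorem continuous_spinc_apply {F : Type*} [AddCommGroup F] [Module ℝ F] [TopologicalSpace F]
    [ContinuousAdd F] [ContinuousSMul ℝ F] (f : CliffC (stdForm n) →ₗ[ℝ] F) :
    Continuous fun s : Spinc n => f ((s : (CliffC (stdForm n))ˣ) : CliffC (stdForm n)) := by
  let _ : TopologicalSpace (CliffC (stdForm n)) := moduleTopology ℝ _
  have : IsModuleTopology ℝ (CliffC (stdForm n)) := ⟨rfl⟩
  exact (IsModuleTopology.continuous_of_linearMap f).comp continuous_induced_dom

theorem continuous_spinc_mul {F : Type*} [AddCommGroup F] [Module ℝ F] [TopologicalSpace F]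
    [ContinuousAdd F] [ContinuousSMul ℝ F] (f : CliffC (stdForm n) →ₗ[ℝ] F)
    (τ : CliffC (stdForm n) →ₗ[ℝ] CliffC (stdForm n)) (a : CliffC (stdForm n)) :
    Continuous fun s : Spinc n => f (((s : (CliffC (stdForm n))ˣ) : CliffC (stdForm n)) * a *
      τ ((s : (CliffC (stdForm n))ˣ) : CliffC (stdForm n))) := by
  let _ : TopologicalSpace (CliffC (stdForm n)) := moduleTopology ℝ _
  have : IsModuleTopology ℝ (CliffC (stdForm n)) := ⟨rfl⟩
  have hadd := IsModuleTopology.toContinuousAdd ℝ (CliffC (stdForm n))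
  have hmul := IsModuleTopology.continuous_mul_of_finite ℝ (CliffC (stdForm n))
  have hval : Continuous fun s : Spinc n => ((s : (CliffC (stdForm n))ˣ) : CliffC (stdForm n)) :=
    continuous_induced_dom
  have hτ := (IsModuleTopology.continuous_of_linearMap τ).comp hval
  have hm : Continuous fun s : Spinc n => ((s : (CliffC (stdForm n))ˣ) : CliffC (stdForm n)) * a :=
    hmul.comp (hval.prodMk continuous_const)
  exact (IsModuleTopology.continuous_of_linearMap f).comp (hmul.comp (hm.prodMk hτ))

/-- On `Spin^c(n)` inversion is the restriction of a real-linear map of the Clifford algebra, hence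
continuous; the continuity of rotations rests on this. -/
theorem coe_inv_spinc (s : Spinc n) :
    (((s⁻¹ : Spinc n) : (CliffC (stdForm n))ˣ) : CliffC (stdForm n)) =
      conjStarC (stdForm n) ((s : (CliffC (stdForm n))ˣ) : CliffC (stdForm n)) := by
  obtain ⟨ζ, x, hx, hl⟩ := spinc_exists_eq_tmul s
  have hxx : x * star x = 1 := hl.mul_star
  rw [InvMemClass.coe_inv]
  refine Units.inv_eq_of_mul_eq_one_right ?_
  rw [hx, conjStarC_tmul, Algebra.TensorProduct.tmul_mul_tmul, hxx, Complex.mul_conj,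
    Circle.normSq_coe, Complex.ofReal_one, Algebra.TensorProduct.one_def]

theorem vectorPart_cliff (Q : QuadraticForm ℝ V) (v : V) : vectorPart Q (cliff Q v) = v := by
  simp [vectorPart, cliff, ExteriorAlgebra.ι_leftInverse v]

theorem continuous_rotation (v : Euc n) : Continuous fun s : Spinc n => rotation s v := by
  have h := continuous_spinc_mul (vectorPart (stdForm n)) (conjStarC (stdForm n))
    (cliff (stdForm n) v)
  refine h.congr fun s => ?_
  rw [← coe_inv_spinc, rotation_spec, vectorPart_cliff]

/-- The character `ζ x ↦ ζ²` of `Spin^c(n)`. -/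
def detChar (n : ℕ) : Spinc n →* ℂ where
  -- With the `ℂ`-linear `star`, the product of `ζ x` and its image is `ζ²`. No decomposition has to
  -- be chosen, and the factor `1` brings the formula into the shape of `continuous_spinc_mul`.
  toFun s := scalarC (stdForm n) (((s : (CliffC (stdForm n))ˣ) : CliffC (stdForm n)) * 1 *
      starC (stdForm n) ((s : (CliffC (stdForm n))ˣ) : CliffC (stdForm n)))
  map_one' := by
    simp [Algebra.TensorProduct.one_def, starC_tmul, scalarC_tmul, scalarPart_one]
  map_mul' s t := by
    obtain ⟨ζ, x, hx, hl⟩ := spinc_exists_eq_tmul s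
    obtain ⟨ξ, y, hy, hl'⟩ := spinc_exists_eq_tmul t
    have hxx : x * star x = 1 := hl.mul_star
    have hyy : y * star y = 1 := hl'.mul_star
    have hxy : x * y * (star y * star x) = 1 := by
      rw [show x * y * (star y * star x) = x * (y * star y) * star x by simp only [mul_assoc],
        hyy, mul_one, hxx]
    rw [Subgroup.coe_mul, Units.val_mul, hx, hy]
    simp only [mul_one, starC_tmul, Algebra.TensorProduct.tmul_mul_tmul, scalarC_tmul,
      hxx, hyy, star_mul, hxy, scalarPart_one, one_smul]
    ring

theorem detChar_eq {s : Spinc n} {ζ : Circle} {x : CliffordAlgebra (stdForm n)}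
    (hx : ((s : (CliffC (stdForm n))ˣ) : CliffC (stdForm n)) = (ζ : ℂ) ⊗ₜ[ℝ] x)
    (hl : x * star x = 1) : detChar n s = (ζ : ℂ) ^ 2 := by
  change scalarC _ _ = _
  rw [hx, mul_one, starC_tmul, Algebra.TensorProduct.tmul_mul_tmul, hl, scalarC_tmul,
    scalarPart_one, one_smul, pow_two]

theorem continuous_detChar : Continuous (detChar n) :=
  continuous_spinc_mul (scalarC (stdForm n)) (starC (stdForm n)) 1

theorem norm_detChar (s : Spinc n) : ‖detChar n s‖ = 1 := by
  obtain ⟨ζ, x, hx, hl⟩ := spinc_exists_eq_tmul s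
  rw [detChar_eq hx hl.mul_star, norm_pow, Circle.norm_coe, one_pow]

/-- The circle has no small subgroups: if `‖v‖ = 1` and `‖v - 1‖ < 1`, then `‖v + 1‖ ≥ 3 / 2`, so
squaring increases the distance to `1` by this factor, and repeated squaring would exceed the bound.
-/
theorem eq_one_of_norm_pow_sub_one_lt {u : ℂ} (hu : ‖u‖ = 1) (h : ∀ j : ℕ, ‖u ^ j - 1‖ < 1) :
    u = 1 := by
  have h1 : ∀ k : ℕ, (3 / 2 : ℝ) ^ k * ‖u - 1‖ ≤ ‖u ^ 2 ^ k - 1‖ := by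
    intro k
    induction k with
    | zero => simp
    | succ k ih =>
      set v := u ^ 2 ^ k with hv
      have hv1 : ‖v‖ = 1 := by rw [hv, norm_pow, hu, one_pow]
      have h2 := parallelogram_law_with_norm ℝ v 1
      rw [hv1, norm_one] at h2
      have h3 := h (2 ^ k)
      have h4 : (3 / 2 : ℝ) ≤ ‖v + 1‖ := by
        nlinarith [norm_nonneg (v + 1), norm_nonneg (v - 1)]
      have h5 : u ^ 2 ^ (k + 1) - 1 = (v + 1) * (v - 1) := by
        rw [pow_succ, pow_mul]
        ring
      rw [h5, norm_mul, pow_succ, mul_comm _ (3 / 2 : ℝ), mul_assoc]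
      exact mul_le_mul h4 ih (by positivity) (norm_nonneg _)
  by_contra hne
  have h2 : 0 < ‖u - 1‖ := norm_pos_iff.mpr (sub_ne_zero.mpr hne)
  obtain ⟨k, hk⟩ := pow_unbounded_of_one_lt (1 / ‖u - 1‖) (show (1 : ℝ) < 3 / 2 by norm_num)
  rw [div_lt_iff₀ h2] at hk
  linarith [h1 k, h (2 ^ k)]

end SpincTopology

/-! ### Local constancy of the normalized phase -/

section LocalConstancy

open CliffordAlgebra

variable {n : ℕ} {Z : Type u} [TopologicalSpace Z] [ChartedSpace (Euc n) Z]
  [IsManifold (𝓡 n) ∞ Z] {m : Metric n Z} {oZ : ManifoldOrientation n Z}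

/-- Local sections of the principal bundle, and the fibre coordinates which they define. -/
theorem SpincStructure.exists_local_section (S : SpincStructure.{u, w} m oZ) (z₀ : Z) :
    ∃ (U : Set Z) (p : Z → S.P) (τ : S.P → Spinc n), IsOpen U ∧ z₀ ∈ U ∧ ContinuousOn p U ∧
      (∀ z ∈ U, S.proj (p z) = z) ∧ (∀ q, S.proj q ∈ U → ContinuousAt τ q) ∧
      ∀ z ∈ U, ∀ s, τ (MulOpposite.op s • p z) = s := by
  obtain ⟨e, he, hact⟩ := S.locally_trivial z₀
  refine ⟨e.baseSet, fun z => e.toOpenPartialHomeomorph.symm (z, 1), fun q => (e q).2,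
    e.open_baseSet, he, ?_, fun z hz => e.proj_symm_apply' hz, fun q hq => ?_, fun z hz s => ?_⟩
  · refine e.toOpenPartialHomeomorph.continuousOn_symm.comp (by fun_prop) fun z hz => ?_
    exact e.mem_target.mpr hz
  · exact (e.continuousAt (e.mem_source.mpr hq)).snd
  · have h1 := e.proj_symm_apply' (x := (1 : Spinc n)) hz
    have h2 : e (e.toOpenPartialHomeomorph.symm (z, 1)) = (z, 1) := e.apply_symm_apply' hz
    have h3 := hact (e.toOpenPartialHomeomorph.symm (z, 1)) s (by rw [h1]; exact hz)
    dsimp only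
    rw [h3, h2, one_mul]

variable {G : Type v} [Group G] [TopologicalSpace G] [MulAction G Z]
  {S : EquivariantSpincStructure.{u, v, w} G m oZ}

theorem pow_smul_eq {g : G} {p : S.P} {s : Spinc n} (hs : g • p = MulOpposite.op s • p) (j : ℕ) :
    g ^ j • p = MulOpposite.op (s ^ j) • p := by
  induction j with
  | zero => simp
  | succ j ih =>
    rw [pow_succ, mul_smul, hs, S.comm_actG, ih, smul_smul, ← MulOpposite.op_mul, ← pow_succ]

/-- A rotor times its `star` is `1`, so the character of `ζ x` reads off the square of the phase and
does not see the sign ambiguity. -/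
theorem IsPhase.sq_eq_detChar {g : G} {p : S.P} {s : Spinc n}
    (hs : g • p = MulOpposite.op s • p) (hz : S.proj p ∈ MulAction.fixedBy Z g) {α : Circle}
    (h : S.IsPhase g ⟨S.proj p, hz⟩ α) : (α : ℂ) ^ 2 = detChar n s := by
  obtain ⟨ζ, x, hx, hl⟩ := spinc_exists_eq_tmul s
  obtain ⟨k, θ, e, he, hα⟩ := (isPhase_iff hs hz hx α).mp h
  rw [detChar_eq hx hl.mul_star]
  have h1 := congrArg (fun a => a * starC _ a) hα
  have h2 : CliffordAlgebra.map (S.toSpincStructure.isometry p) x *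
      star (CliffordAlgebra.map (S.toSpincStructure.isometry p) x) = 1 :=
    (isLift_fixedDiff hs hz hl).mul_star
  have h3 : rotor (m.form (S.proj p)) θ (fun i => (e i : Tan n (S.proj p))) *
      star (rotor (m.form (S.proj p)) θ (fun i => (e i : Tan n (S.proj p)))) = 1 :=
    rotor_mul_star (m.bilin_comm _) θ _ he.orthonormal
  simp only [starC_tmul, Algebra.TensorProduct.tmul_mul_tmul] at h1
  rw [h2, h3, ← pow_two, ← pow_two] at h1
  have h4 := congrArg (scalarC _) h1
  rw [scalarC_tmul, scalarC_tmul, scalarPart_one, one_smul, one_smul] at h4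
  exact h4.symm

/-- The scalar part of `s` is `α ∏ cos (θ_j / 2)`, and the product is positive when no angle is `π`.
-/
theorem IsPhase.exists_pos_scalarC {g : G} {p : S.P} {s : Spinc n}
    (hs : g • p = MulOpposite.op s • p) (hz : S.proj p ∈ MulAction.fixedBy Z g) {α : Circle}
    (h : S.IsPhase g ⟨S.proj p, hz⟩ α)
    (hev : ¬ (fixedDiff (n := n) g ⟨S.proj p, hz⟩).HasEigenvalue (-1)) :
    ∃ r : ℝ, 0 < r ∧
      scalarC (stdForm n) ((s : (CliffC (stdForm n))ˣ) : CliffC (stdForm n)) = r • (α : ℂ) := by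
  have hA := bilin_fixedDiff S ⟨S.proj p, hz⟩
  have hN := isNormal_normalSpace m g ⟨S.proj p, hz⟩
  obtain ⟨ζ, x, hx, hl⟩ := spinc_exists_eq_tmul s
  obtain ⟨k, θ, e, he, hα⟩ := (isPhase_iff hs hz hx α).mp h
  rw [he.exists_angle_eq_pi hA (m.bilin_pos _) hN] at hev
  refine ⟨_, he.scalarPart_pos (m.bilin_comm _) hev, ?_⟩
  have h1 := congrArg (scalarC _) hα
  rw [scalarC_tmul, scalarC_tmul, scalarPart_map] at h1
  rw [hx, scalarC_tmul, h1]
  rfl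

/-- Continuity alone does not make `α²` locally constant. The estimate is made for all powers of `g`
at once, uniformly over a compact group, and a ratio whose powers all stay near `1` equals `1`. -/
theorem eventually_phase_sq_eq [CompactSpace G] [T2Space Z] [ContinuousSMul G Z] (g : G)
    (z₀ : MulAction.fixedBy Z g) :
    ∀ᶠ z in 𝓝 z₀, ∀ α α₀ : Circle, S.IsPhase g z α → S.IsPhase g z₀ α₀ →
      (α : ℂ) ^ 2 = (α₀ : ℂ) ^ 2 := by
  obtain ⟨U, p, τ, hU, hz₀, hp, hproj, hτ, hτp⟩ :=
    S.toSpincStructure.exists_local_section (z₀ : Z)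
  -- The elements fixing all of `Z^g` pointwise form a compact set containing every power of `g`.
  let K : Set G := {h | ∀ z : MulAction.fixedBy Z g, h • (z : Z) = z}
  have hK : IsCompact K := by
    refine IsClosed.isCompact ?_
    rw [show K = ⋂ z : MulAction.fixedBy Z g, {h : G | h • (z : Z) = z} by ext; simp [K]]
    exact isClosed_iInter fun z =>
      isClosed_eq (continuous_id.smul continuous_const) continuous_const
  let Φ : MulAction.fixedBy Z g → G → ℂ := fun z h => detChar n (τ (h • p z))
  have hΦ : ∀ k ∈ K, ContinuousAt (fun q : MulAction.fixedBy Z g × G => Φ q.1 q.2) (z₀, k) := by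
    intro k hk
    have h1 : ContinuousAt (fun q : MulAction.fixedBy Z g × G => p q.1) (z₀, k) := by
      have h2 : ContinuousAt p ((z₀, k) : MulAction.fixedBy Z g × G).1 :=
        hp.continuousAt (hU.mem_nhds hz₀)
      exact ContinuousAt.comp (f := fun q : MulAction.fixedBy Z g × G => (q.1 : Z)) h2
        (continuous_subtype_val.comp continuous_fst).continuousAt
    have h3 : ContinuousAt (fun q : MulAction.fixedBy Z g × G => q.2 • p q.1) (z₀, k) :=
      S.continuous_actG.continuousAt.comp (continuousAt_snd.prodMk h1)
    have h4 : ContinuousAt τ (k • p z₀) := by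
      refine hτ _ ?_
      rw [S.proj_actG, hproj _ hz₀, hk]
      exact hz₀
    exact continuous_detChar.continuousAt.comp (ContinuousAt.comp
      (f := fun q : MulAction.fixedBy Z g × G => q.2 • p q.1) h4 h3)
  have hclose : ∀ᶠ z in 𝓝 z₀, ∀ h ∈ K, ‖Φ z h - Φ z₀ h‖ < 1 := by
    refine hK.eventually_forall_of_forall_eventually fun k hk => ?_
    have h1 : ContinuousAt (fun q : MulAction.fixedBy Z g × G => Φ z₀ q.2) (z₀, k) :=
      ContinuousAt.comp (g := fun q : MulAction.fixedBy Z g × G => Φ q.1 q.2)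
        (f := fun q : MulAction.fixedBy Z g × G => (z₀, q.2)) (x := (z₀, k)) (hΦ k hk)
        (continuous_const.prodMk continuous_snd).continuousAt
    have h2 := ((hΦ k hk).sub h1).norm
    refine h2.eventually_lt_const ?_
    simp
  have hUz : ∀ᶠ z : MulAction.fixedBy Z g in 𝓝 z₀, (z : Z) ∈ U :=
    continuous_subtype_val.continuousAt.eventually_mem (hU.mem_nhds hz₀)
  have hgK : ∀ j : ℕ, g ^ j ∈ K := fun j z =>
    pow_mem (show g ∈ MulAction.stabilizer G (z : Z) from z.2) j
  have key : ∀ z : MulAction.fixedBy Z g, (z : Z) ∈ U → ‖Φ z g‖ = 1 ∧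
      (∀ j, Φ z (g ^ j) = Φ z g ^ j) ∧ ∀ α : Circle, S.IsPhase g z α → (α : ℂ) ^ 2 = Φ z g := by
    intro z hz
    obtain ⟨s, hs⟩ := exists_act_eq_of_fixed (S := S) (g := g) (p := p z)
      (by rw [hproj _ hz]; exact z.2)
    have h1 : Φ z g = detChar n s := by
      change detChar n (τ (g • p z)) = _
      rw [hs, hτp _ hz]
    refine ⟨by rw [h1, norm_detChar], fun j => ?_, fun α hα => ?_⟩
    · change detChar n (τ (g ^ j • p z)) = _
      rw [pow_smul_eq hs, hτp _ hz, map_pow, h1]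
    · rw [h1]
      have hz' : S.proj (p z) ∈ MulAction.fixedBy Z g := by rw [hproj _ hz]; exact z.2
      refine IsPhase.sq_eq_detChar hs hz' ?_
      have h2 : (⟨S.proj (p z), hz'⟩ : MulAction.fixedBy Z g) = z := Subtype.ext (hproj _ hz)
      rw [h2]
      exact hα
  filter_upwards [hclose, hUz] with z h1 h2 α α₀ hα hα₀
  obtain ⟨hn, hpow, hsq⟩ := key z h2
  obtain ⟨hn₀, hpow₀, hsq₀⟩ := key z₀ hz₀
  rw [hsq α hα, hsq₀ α₀ hα₀]
  have hne : Φ z₀ g ≠ 0 := by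
    rw [← norm_ne_zero_iff, hn₀]
    exact one_ne_zero
  -- The `j`-th power of the ratio is the ratio of the values at `g ^ j`; as the denominator has
  -- norm `1`, its distance to `1` is the one already bounded.
  refine (div_eq_one_iff_eq hne).mp (eq_one_of_norm_pow_sub_one_lt ?_ fun j => ?_)
  · rw [norm_div, hn, hn₀, div_one]
  · have h3 := h1 (g ^ j) (hgK j)
    rw [hpow, hpow₀] at h3
    have h4 : (Φ z g / Φ z₀ g) ^ j - 1 = (Φ z g ^ j - Φ z₀ g ^ j) / Φ z₀ g ^ j := by
      rw [sub_div, div_self (pow_ne_zero _ hne), div_pow]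
    rwa [h4, norm_div, norm_pow, hn₀, one_pow, div_one]

/-- Near a fixed point, a continuous choice of frames and of the elements of `Spin^c(n)` by which
`g` acts on them. -/
theorem exists_local_spinor (S : EquivariantSpincStructure.{u, v, w} G m oZ) (g : G)
    (z₀ : MulAction.fixedBy Z g) : ∃ (U : Set (MulAction.fixedBy Z g))
      (p : MulAction.fixedBy Z g → S.P) (s : MulAction.fixedBy Z g → Spinc n),
      IsOpen U ∧ z₀ ∈ U ∧ ContinuousOn p U ∧ ContinuousOn s U ∧
      (∀ z ∈ U, S.proj (p z) = z) ∧ ∀ z ∈ U, g • p z = MulOpposite.op (s z) • p z := by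
  obtain ⟨U, p, τ, hU, hz₀, hp, hproj, hτ, hτp⟩ :=
    S.toSpincStructure.exists_local_section (z₀ : Z)
  have hp' : ContinuousOn (fun z : MulAction.fixedBy Z g => p z) (Subtype.val ⁻¹' U) :=
    hp.comp continuous_subtype_val.continuousOn fun z hz => hz
  have hg : ∀ z : MulAction.fixedBy Z g, (z : Z) ∈ U → S.proj (g • p z) = z := by
    intro z hz
    rw [S.proj_actG, hproj _ hz]
    exact z.2
  refine ⟨Subtype.val ⁻¹' U, fun z => p z, fun z => τ (g • p z),
    hU.preimage continuous_subtype_val, hz₀, hp', fun z hz => ?_, fun z hz => hproj z hz,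
    fun z hz => ?_⟩
  · have h1 : ContinuousAt τ (g • p z) := hτ _ (by rw [hg z hz]; exact hz)
    have h2 : ContinuousWithinAt (fun z : MulAction.fixedBy Z g => g • p z) (Subtype.val ⁻¹' U) z :=
      S.continuous_actG.continuousAt.comp_continuousWithinAt
        (continuousWithinAt_const.prodMk (hp' z hz))
    exact ContinuousAt.comp_continuousWithinAt (f := fun z : MulAction.fixedBy Z g => g • p z) h1 h2
  · obtain ⟨s, hs⟩ := exists_act_eq_of_fixed (S := S) (g := g) (p := p z)
      (by rw [hproj _ hz]; exact z.2)
    dsimp only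
    rw [hs, hτp _ hz]

/-- The scalar part of `s` is continuous and a positive multiple of the phase, so a jump from `α₀`
to `-α₀` would reverse its direction. -/
theorem eventually_phase_eq_of_not_hasEigenvalue (g : G) (z₀ : MulAction.fixedBy Z g)
    (hev₀ : ¬ (fixedDiff (n := n) g z₀).HasEigenvalue (-1)) :
    ∀ᶠ z in 𝓝 z₀, ∀ α α₀ : Circle, S.IsPhase g z α → S.IsPhase g z₀ α₀ →
      ¬ (fixedDiff (n := n) g z).HasEigenvalue (-1) → (α : ℂ) ^ 2 = (α₀ : ℂ) ^ 2 → α = α₀ := by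
  obtain ⟨U, p, s, hU, hz₀, -, hs, hproj, hact⟩ := exists_local_spinor S g z₀
  let f : MulAction.fixedBy Z g → ℂ := fun z =>
    scalarC (stdForm n) ((s z : (CliffC (stdForm n))ˣ) : CliffC (stdForm n))
  have hf : ContinuousAt f z₀ := (continuous_spinc_apply (scalarC (stdForm n))).continuousAt.comp
    (hs.continuousAt (hU.mem_nhds hz₀))
  have key : ∀ z ∈ U, ∀ α : Circle, S.IsPhase g z α →
      ¬ (fixedDiff (n := n) g z).HasEigenvalue (-1) → ∃ r : ℝ, 0 < r ∧ f z = r • (α : ℂ) := by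
    intro z hz α hα hev
    have hz' : S.proj (p z) ∈ MulAction.fixedBy Z g := by rw [hproj _ hz]; exact z.2
    have h2 : z = (⟨S.proj (p z), hz'⟩ : MulAction.fixedBy Z g) := Subtype.ext (hproj _ hz).symm
    rw [h2] at hα hev
    exact IsPhase.exists_pos_scalarC (hact z hz) hz' hα hev
  obtain ⟨β, hβ⟩ := exists_isPhase S g z₀
  have hpos : ∀ᶠ z in 𝓝 z₀, 0 < (f z * starRingEnd ℂ (β : ℂ)).re := by
    have h1 : ContinuousAt (fun z => (f z * starRingEnd ℂ (β : ℂ)).re) z₀ :=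
      Complex.continuous_re.continuousAt.comp (hf.mul continuousAt_const)
    refine h1.eventually_const_lt ?_
    obtain ⟨r, hr, hfr⟩ := key z₀ hz₀ β hβ hev₀
    dsimp only
    rw [hfr, smul_mul_assoc, Complex.mul_conj, Circle.normSq_coe]
    simpa using hr
  filter_upwards [hU.mem_nhds hz₀, hpos] with z hz h1 α α₀ hα hα₀ hev hsq
  have h2 : α₀ = β := by
    rcases (isPhase_iff_of_isPhase hβ α₀).mp hα₀ with h | h
    · exact h
    · exact absurd h.2 hev₀
  subst h2
  rcases sq_eq_sq_iff_eq_or_eq_neg.mp hsq with h | h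
  · exact Circle.ext h
  · obtain ⟨r, hr, hfr⟩ := key z hz α hα hev
    rw [hfr, h, smul_neg, neg_mul, smul_mul_assoc, Complex.mul_conj, Circle.normSq_coe] at h1
    have : 0 < -r := by simpa using h1
    linarith

/-- The arguments in `[0, π)` form a fundamental domain for the sign change. -/
theorem eq_of_arg_mem {z w : ℂ} (hz : z ≠ 0) (h : w = z ∨ w = -z)
    (hz1 : 0 ≤ Complex.arg z) (hz2 : Complex.arg z < Real.pi) (hw1 : 0 ≤ Complex.arg w)
    (hw2 : Complex.arg w < Real.pi) : w = z := by
  rcases h with h | h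
  · exact h
  · exfalso
    rw [Complex.arg_nonneg_iff] at hz1 hw1
    rw [Complex.arg_lt_pi_iff] at hz2 hw2
    rw [h, Complex.neg_im] at hw1 hw2
    rw [Complex.neg_re] at hw2
    have him : z.im = 0 := le_antisymm (by linarith) hz1
    rw [him] at hz2 hw2
    simp only [neg_zero, ne_eq, not_true_eq_false, or_false] at hz2 hw2
    exact hz (Complex.ext (le_antisymm (by simpa using hw2) hz2) him)

theorem arg_mem_or_neg (z : ℂ) :
    (0 ≤ Complex.arg z ∧ Complex.arg z < Real.pi) ∨
      (0 ≤ Complex.arg (-z) ∧ Complex.arg (-z) < Real.pi) := by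
  simp only [Complex.arg_nonneg_iff, Complex.arg_lt_pi_iff, Complex.neg_im, Complex.neg_re]
  rcases lt_trichotomy z.im 0 with h | h | h
  · exact Or.inr ⟨by linarith, Or.inr (by simpa using h.ne)⟩
  · rcases le_total 0 z.re with h' | h'
    · exact Or.inl ⟨h.ge, Or.inl h'⟩
    · exact Or.inr ⟨by simp [h], Or.inl (by simpa using h')⟩
  · exact Or.inl ⟨h.le, Or.inr h.ne'⟩

/-- The phase is locally constant once its sign is normalized. -/
theorem existsUnique_phase [CompactSpace G] [T2Space Z] [ContinuousSMul G Z]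
    (S : EquivariantSpincStructure.{u, v, w} G m oZ) (g : G) (hev : ∀ z₀ : MulAction.fixedBy Z g, ∀ᶠ z in 𝓝 z₀,
      ((fixedDiff (n := n) g z).HasEigenvalue (-1) ↔
        (fixedDiff (n := n) g z₀).HasEigenvalue (-1))) :
    ∃! α : MulAction.fixedBy Z g → Circle, IsLocallyConstant α ∧ ∀ z, S.IsPhase g z (α z) ∧
      ((fixedDiff (n := n) g z).HasEigenvalue (-1) →
        0 ≤ Complex.arg (α z) ∧ Complex.arg (α z) < Real.pi) := by
  have hex : ∀ z : MulAction.fixedBy Z g, ∃ α : Circle, S.IsPhase g z α ∧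
      ((fixedDiff (n := n) g z).HasEigenvalue (-1) →
        0 ≤ Complex.arg α ∧ Complex.arg α < Real.pi) := by
    intro z
    obtain ⟨α, hα⟩ := exists_isPhase S g z
    by_cases h : (fixedDiff (n := n) g z).HasEigenvalue (-1)
    · rcases arg_mem_or_neg α with h1 | h1
      · exact ⟨α, hα, fun _ => h1⟩
      · have h2 : ((-1 : ℂ) * α) ∈ Submonoid.unitSphere ℂ := by
          simpa [Submonoid.unitSphere] using Circle.norm_coe α
        refine ⟨⟨_, h2⟩, (isPhase_iff_of_isPhase hα _).mpr (Or.inr ⟨?_, h⟩), fun _ => ?_⟩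
        · exact neg_one_mul _
        · change 0 ≤ Complex.arg (-1 * α) ∧ Complex.arg (-1 * α) < Real.pi
          rwa [neg_one_mul]
    · exact ⟨α, hα, fun h' => absurd h' h⟩
  choose α hα hαn using hex
  refine ⟨α, ⟨?_, fun z => ⟨hα z, hαn z⟩⟩, ?_⟩
  · rw [IsLocallyConstant.iff_eventually_eq]
    intro z₀
    by_cases h : (fixedDiff (n := n) g z₀).HasEigenvalue (-1)
    · filter_upwards [hev z₀, eventually_phase_sq_eq (S := S) g z₀] with z h1 h2
      exact Circle.ext (eq_of_arg_mem (Circle.coe_ne_zero _)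
        (sq_eq_sq_iff_eq_or_eq_neg.mp (h2 _ _ (hα z) (hα z₀))) (hαn z₀ h).1 (hαn z₀ h).2
        (hαn z (h1.mpr h)).1 (hαn z (h1.mpr h)).2)
    · filter_upwards [hev z₀, eventually_phase_sq_eq (S := S) g z₀,
        eventually_phase_eq_of_not_hasEigenvalue (S := S) g z₀ h] with z h1 h2 h3
      exact h3 _ _ (hα z) (hα z₀) (fun h' => h (h1.mp h')) (h2 _ _ (hα z) (hα z₀))
  · rintro β ⟨-, hβ⟩
    funext z
    rcases (isPhase_iff_of_isPhase (hα z) (β z)).mp (hβ z).1 with h | ⟨h, h'⟩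
    · exact h
    · exact Circle.ext (eq_of_arg_mem (Circle.coe_ne_zero _) (Or.inr h) (hαn z h').1
        (hαn z h').2 ((hβ z).2 h').1 ((hβ z).2 h').2)

end LocalConstancy

/-! ### The top-degree part of the symbol -/

section TopSymbol

variable {V : Type*} [AddCommGroup V] [Module ℝ V]

theorem symbolPart_tmul (Q : QuadraticForm ℝ V) (r : ℕ) (ζ : ℂ) (x : CliffordAlgebra Q) :
    symbolPart Q r (ζ ⊗ₜ[ℝ] x) =
      ζ ⊗ₜ[ℝ] GradedAlgebra.proj (fun i : ℕ => ⋀[ℝ]^i V) r (CliffordAlgebra.equivExterior Q x) :=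
  rfl

theorem wedge_cast {r r' : ℕ} (h : r' = r) (f : Fin r → V) :
    wedge (fun i : Fin r' => f (Fin.cast h i)) = wedge f := by
  subst h
  rfl

/-- The top-degree part of a rotor on `N`. -/
theorem IsAdapted.exists_top_symbol {B : V →ₗ[ℝ] V →ₗ[ℝ] ℝ} (hB : ∀ v w, B v w = B w v)
    {A : V →ₗ[ℝ] V} {N : Submodule ℝ V} {k : ℕ} {θ : Fin k → ℝ}
    {e : Module.Basis (Fin k × Fin 2) ℝ N} (he : IsAdapted B A N θ e) :
    ∃ (f : Module.Basis (Fin (Module.finrank ℝ N)) ℝ N) (c : ℝ), 0 < c ∧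
      wedge (fun i => (f i : V)) ≠ 0 ∧
      GradedAlgebra.proj (fun i : ℕ => ⋀[ℝ]^i V) (Module.finrank ℝ N)
        (CliffordAlgebra.equivExterior (negForm B) (rotor (negForm B) θ fun i => (e i : V))) =
        c • wedge (fun i => (f i : V)) := by
  have hr : Module.finrank ℝ N = k * 2 := by
    rw [Module.finrank_eq_card_basis e]
    simp
  have hw : wedge (fun i : Fin (Module.finrank ℝ N) =>
      (e (finProdFinEquiv.symm (Fin.cast hr i)) : V)) = pairWedge fun i => (e i : V) := by
    rw [pairWedge_eq]
    exact wedge_cast hr fun i => (e (finProdFinEquiv.symm i) : V)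
  -- The basis is the adapted one, listed pair by pair. The half-angles lie in `(0, π / 2]`, so the
  -- product of sines is positive even where `-1` is an eigenvalue.
  refine ⟨(e.reindex finProdFinEquiv).reindex (finCongr hr.symm), ∏ j, Real.sin (θ j / 2),
    Finset.prod_pos fun j _ => ?_, ?_, ?_⟩
  · have := he.block.1 j
    exact Real.sin_pos_of_pos_of_lt_pi (by linarith) (by linarith [Real.pi_pos])
  · simp only [Module.Basis.reindex_apply, finCongr_symm, finCongr_apply]
    rw [hw]
    exact pairWedge_ne_zero hB _ he.orthonormal
  · simp only [Module.Basis.reindex_apply, finCongr_symm, finCongr_apply]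
    rw [hw, equivExterior_rotor hB θ _ he.orthonormal, hr]
    exact (proj_rotor θ _).2

end TopSymbol

/-! ### The top symbol in terms of bases of the normal space -/

section Orientation

variable {n : ℕ} {Z : Type u} [TopologicalSpace Z] [ChartedSpace (Euc n) Z]
  [IsManifold (𝓡 n) ∞ Z] {m : Metric n Z} {oZ : ManifoldOrientation n Z}

theorem finrank_add_finrank {G : Type v} [Group G] [MulAction G Z] (m : Metric n Z) (g : G)
    (z : MulAction.fixedBy Z g) :
    Module.finrank ℝ (fixedTangent n g z) + Module.finrank ℝ (normalSpace m g z) = n := by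
  have h := (isNormal_normalSpace m g z).isCompl (m.bilin_comm _) (m.bilin_pos _)
  have h1 := Submodule.finrank_add_eq_of_isCompl h
  have h2 : Module.finrank ℝ (Tan n (z : Z)) = n := by
    change Module.finrank ℝ (Euc n) = n
    simp
  exact h1.trans h2

variable {G : Type v} [Group G] [TopologicalSpace G] [MulAction G Z]
  {S : EquivariantSpincStructure.{u, v, w} G m oZ}

theorem IsPhase.exists_topSymbolIs {g : G} {z : MulAction.fixedBy Z g} {α : Circle}
    (h : S.IsPhase g z α) :
    ∃ (f : Module.Basis (Fin (Module.finrank ℝ (normalSpace m g z))) ℝ (normalSpace m g z))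
      (c : ℝ), 0 < c ∧ wedge (fun i => (f i : Tan n (z : Z))) ≠ 0 ∧ S.TopSymbolIs g z α f c := by
  obtain ⟨z, hz⟩ := z
  obtain ⟨p, rfl⟩ := S.toSpincStructure.exists_proj_eq z
  obtain ⟨s, hs⟩ := exists_act_eq_of_fixed hz
  obtain ⟨ζ, x, hx, hl⟩ := spinc_exists_eq_tmul s
  obtain ⟨k, θ, e, he, hα⟩ := (isPhase_iff hs hz hx α).mp h
  obtain ⟨f, c, hc, hw, hf⟩ := he.exists_top_symbol (m.bilin_comm _)
  refine ⟨f, c, hc, hw, _, (isSpinorAction_iff hs hz _).mpr rfl, ?_⟩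
  have h1 : cliffMap (S.toSpincStructure.isometry p)
      ((s : (CliffC (stdForm n))ˣ) : CliffC (stdForm n)) =
        (α : ℂ) ⊗ₜ[ℝ] rotor (m.form (S.proj p)) θ (fun i => (e i : Tan n (S.proj p))) := by
    rw [hx, ← hα]
    rfl
  rw [h1, symbolPart_tmul, TensorProduct.smul_tmul', smul_eq_mul,
    inv_mul_cancel₀ (Circle.coe_ne_zero α)]
  refine (congrArg (fun y => (1 : ℂ) ⊗ₜ[ℝ] y) hf).trans ?_
  rw [← TensorProduct.smul_tmul, Complex.real_smul, mul_one]

/-- A change of basis multiplies the wedge by its determinant. -/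
theorem topSymbolIs_of_basis {g : G} {z : MulAction.fixedBy Z g} {α : Circle}
    {f f' : Module.Basis (Fin (Module.finrank ℝ (normalSpace m g z))) ℝ (normalSpace m g z)}
    {c : ℝ} (h : S.TopSymbolIs g z α f c) : S.TopSymbolIs g z α f' (c * f'.det f) := by
  obtain ⟨a, ha, hc⟩ := h
  refine ⟨a, ha, ?_⟩
  rw [hc, wedge_eq_det_smul f' f, ← TensorProduct.smul_tmul, Complex.real_smul]
  congr 1
  push_cast
  ring

theorem topSymbolIs_unique {g : G} {z : MulAction.fixedBy Z g} {α : Circle} (hα : S.IsPhase g z α)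
    {f : Module.Basis (Fin (Module.finrank ℝ (normalSpace m g z))) ℝ (normalSpace m g z)}
    {c c' : ℝ} (h : S.TopSymbolIs g z α f c) (h' : S.TopSymbolIs g z α f c') : c = c' := by
  obtain ⟨f₀, c₀, -, hw, -⟩ := IsPhase.exists_topSymbolIs hα
  have hf : wedge (fun i => (f i : Tan n (z : Z))) ≠ 0 := by
    intro h0
    rw [wedge_eq_det_smul f f₀, h0, smul_zero] at hw
    exact hw rfl
  obtain ⟨a, ha, hc⟩ := h
  obtain ⟨a', ha', hc'⟩ := h'
  rw [(existsUnique_isSpinorAction S g z).unique ha' ha, hc] at hc'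
  exact_mod_cast tmul_left_injective hf hc'

theorem exists_topSymbolIs {g : G} {z : MulAction.fixedBy Z g} {α : Circle}
    (hα : S.IsPhase g z α)
    (f : Module.Basis (Fin (Module.finrank ℝ (normalSpace m g z))) ℝ (normalSpace m g z)) :
    ∃ c : ℝ, c ≠ 0 ∧ S.TopSymbolIs g z α f c := by
  obtain ⟨f₀, c₀, hc₀, hw, h⟩ := IsPhase.exists_topSymbolIs hα
  refine ⟨_, mul_ne_zero hc₀.ne' ?_, topSymbolIs_of_basis (f' := f) h⟩
  exact (f.isUnit_det f₀).ne_zero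

end Orientation

/-! ### Bases of a direct sum and signs of orientations -/

section AdaptedBasis

variable {V : Type*} [AddCommGroup V] [Module ℝ V] {F N : Submodule ℝ V}

/-- The basis of `V` composed of bases of two complementary subspaces. -/
def sumBasis (h : IsCompl F N) {d r n : ℕ} (hn : d + r = n) (t : Module.Basis (Fin d) ℝ F)
    (f : Module.Basis (Fin r) ℝ N) : Module.Basis (Fin n) ℝ V :=
  ((t.prod f).map (Submodule.prodEquivOfIsCompl F N h)).reindex
    (finSumFinEquiv.trans (finCongr hn))

/-- `e` is the basis `(t, f)`. -/
def IsSumBasis {d r n : ℕ} (t : Module.Basis (Fin d) ℝ F) (f : Module.Basis (Fin r) ℝ N)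
    (e : Module.Basis (Fin n) ℝ V) : Prop :=
  (∀ (j : Fin n) (i : Fin d), (j : ℕ) = i → e j = t i) ∧
    ∀ (j : Fin n) (i : Fin r), (j : ℕ) = d + i → e j = f i

theorem isSumBasis_sumBasis (h : IsCompl F N) {d r n : ℕ} (hn : d + r = n)
    (t : Module.Basis (Fin d) ℝ F) (f : Module.Basis (Fin r) ℝ N) :
    IsSumBasis t f (sumBasis h hn t f) := by
  subst hn
  constructor
  · intro j i hj
    obtain rfl : j = Fin.castAdd r i := Fin.ext hj
    simp [sumBasis]
  · intro j i hj
    obtain rfl : j = Fin.natAdd d i := Fin.ext hj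
    simp [sumBasis]

/-- The matrix between two bases composed in this way is block diagonal. -/
theorem IsSumBasis.det_eq {d r n : ℕ} (hn : d + r = n)
    {t t' : Module.Basis (Fin d) ℝ F} {f f' : Module.Basis (Fin r) ℝ N}
    {e e' : Module.Basis (Fin n) ℝ V} (he : IsSumBasis t f e) (he' : IsSumBasis t' f' e') :
    e.det e' = t.det t' * f.det f' := by
  subst hn
  have key : ∀ {t : Module.Basis (Fin d) ℝ F} {f : Module.Basis (Fin r) ℝ N}
      {e : Module.Basis (Fin (d + r)) ℝ V}, IsSumBasis t f e →
      ∀ i : Fin d ⊕ Fin r, e (finSumFinEquiv i) = Sum.elim (fun i => (t i : V))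
        (fun i => (f i : V)) i := by
    intro t f e he i
    rcases i with i | i
    · exact he.1 _ i rfl
    · exact he.2 _ i rfl
  set b := e.reindex finSumFinEquiv.symm with hb
  have hbe : ∀ i, b i = Sum.elim (fun i => (t i : V)) (fun i => (f i : V)) i := fun i => by
    rw [hb, Module.Basis.reindex_apply, Equiv.symm_symm, key he]
  have h1 : e.det e' = b.det (e' ∘ finSumFinEquiv) := by
    rw [hb, Module.Basis.det_reindex]
    congr 1
    ext i
    simp
  have hrepr_t : ∀ v : F, ∀ i, b.repr v i = Sum.elim (fun i => t.repr v i) (fun _ => 0) i := by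
    intro v i
    have h2 : (v : V) = ∑ j : Fin d ⊕ Fin r,
        (Sum.elim (fun i => t.repr v i) (fun _ => 0) j : ℝ) • b j := by
      rw [Fintype.sum_sum_type]
      simp only [hbe, Sum.elim_inl, Sum.elim_inr, zero_smul, Finset.sum_const_zero, add_zero]
      have h3 := congrArg F.subtype (t.sum_repr v)
      rw [map_sum] at h3
      exact h3.symm
    rw [h2, b.repr_sum_self]
  have hrepr_f : ∀ v : N, ∀ i, b.repr v i = Sum.elim (fun _ => 0) (fun i => f.repr v i) i := by
    intro v i
    have h2 : (v : V) = ∑ j : Fin d ⊕ Fin r,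
        (Sum.elim (fun _ => 0) (fun i => f.repr v i) j : ℝ) • b j := by
      rw [Fintype.sum_sum_type]
      simp only [hbe, Sum.elim_inl, Sum.elim_inr, zero_smul, Finset.sum_const_zero, zero_add]
      have h3 := congrArg N.subtype (f.sum_repr v)
      rw [map_sum] at h3
      exact h3.symm
    rw [h2, b.repr_sum_self]
  rw [h1, Module.Basis.det_apply, Module.Basis.det_apply, Module.Basis.det_apply]
  have h3 : b.toMatrix (e' ∘ finSumFinEquiv) =
      Matrix.fromBlocks (t.toMatrix t') 0 0 (f.toMatrix f') := by
    ext i j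
    rw [Module.Basis.toMatrix_apply, Function.comp_apply, key he']
    rcases i with i | i <;> rcases j with j | j <;>
      simp [hrepr_t, hrepr_f, Module.Basis.toMatrix_apply]
  rw [h3, Matrix.det_fromBlocks_zero₂₁]

end AdaptedBasis

section OrientationSigns

variable {V : Type*} [AddCommGroup V] [Module ℝ V] {ι : Type*} [Fintype ι] [DecidableEq ι]

/-- There are only two classes to compare with, `o` and `-o`, so the sign of the determinant tells
whether `e` and `e'` both agree with `o` or both disagree. -/
theorem orientation_eq_iff_of_det (e e' : Module.Basis ι ℝ V) (o : Orientation ℝ V ι) :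
    e'.orientation = o ↔ (0 < e.det e' ↔ e.orientation = o) := by
  rw [← Module.Basis.orientation_eq_iff_det_pos]
  rcases e.orientation_eq_or_eq_neg o with h | h
  · rw [h]
    simp [eq_comm]
  · rcases e.orientation_eq_or_eq_neg e'.orientation with h' | h'
    · rw [h, h']
      simp
    · rw [h, h']
      have h1 : e.orientation ≠ -e.orientation := Module.Ray.ne_neg_self _
      simp [h1]

end OrientationSigns

/-! ### The induced orientation of the tangent spaces of `Z^g` -/

section InducedOrientation

variable {n : ℕ} {Z : Type u} [TopologicalSpace Z] [ChartedSpace (Euc n) Z]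
  [IsManifold (𝓡 n) ∞ Z] {m : Metric n Z} {oZ : ManifoldOrientation n Z}
  {G : Type v} [Group G] [TopologicalSpace G] [MulAction G Z]
  {S : EquivariantSpincStructure.{u, v, w} G m oZ}

/-- Fix one reference triple `(t₀, f₀, e₀)` at each point. For another triple with positive top
symbol the normal determinant is positive, so `t` against `t₀` and `e` against `e₀` have the same
sign: the reference triple determines the orientation, and every other triple agrees with it. -/
theorem existsUnique_isInducedOrientation {g : G} {α : MulAction.fixedBy Z g → Circle}
    (hα : ∀ z, S.IsPhase g z (α z)) : ∃! o : ∀ z : MulAction.fixedBy Z g,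
      Orientation ℝ (fixedTangent n g z) (Fin (Module.finrank ℝ (fixedTangent n g z))),
      S.IsInducedOrientation g α o := by
  have hc : ∀ z : MulAction.fixedBy Z g, IsCompl (fixedTangent n g z) (normalSpace m g z) :=
    fun z => (isNormal_normalSpace m g z).isCompl (m.bilin_comm _) (m.bilin_pos _)
  choose f₀ c₀ hc₀ hw₀ h₀ using fun z => IsPhase.exists_topSymbolIs (hα z)
  let t₀ : ∀ z : MulAction.fixedBy Z g, Module.Basis (Fin (Module.finrank ℝ (fixedTangent n g z)))
    ℝ (fixedTangent n g z) := fun z => Module.finBasis ℝ _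
  let e₀ : ∀ z : MulAction.fixedBy Z g, Module.Basis (Fin n) ℝ (Tan n (z : Z)) := fun z =>
    sumBasis (hc z) (finrank_add_finrank m g z) (t₀ z) (f₀ z)
  have he₀ : ∀ z, IsSumBasis (t₀ z) (f₀ z) (e₀ z) := fun z =>
    isSumBasis_sumBasis (hc z) (finrank_add_finrank m g z) (t₀ z) (f₀ z)
  classical
  have ho : ∀ z : MulAction.fixedBy Z g, ∃ o : Orientation ℝ (fixedTangent n g z)
      (Fin (Module.finrank ℝ (fixedTangent n g z))),
      (t₀ z).orientation = o ↔ (e₀ z).orientation = oZ.at' (z : Z) := by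
    intro z
    by_cases h : (e₀ z).orientation = oZ.at' (z : Z)
    · exact ⟨(t₀ z).orientation, by simp [h]⟩
    · have h1 : (t₀ z).orientation ≠ -(t₀ z).orientation := Module.Ray.ne_neg_self _
      exact ⟨-(t₀ z).orientation, by simp [h, h1]⟩
  choose o ho using ho
  refine ⟨o, ?_, ?_⟩
  · intro z t f e c het hef hsymb hcpos
    have he : IsSumBasis t f e := ⟨het, hef⟩
    have h1 := topSymbolIs_unique (hα z) hsymb (topSymbolIs_of_basis (f' := f) (h₀ z))
    have h2 : 0 < f.det (f₀ z) := by
      rw [h1] at hcpos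
      exact (pos_iff_pos_of_mul_pos hcpos).mp (hc₀ z)
    rw [← Module.Basis.orientation_eq_iff_det_pos, eq_comm,
      Module.Basis.orientation_eq_iff_det_pos] at h2
    rw [orientation_eq_iff_of_det (t₀ z) t, orientation_eq_iff_of_det (e₀ z) e,
      (he₀ z).det_eq (finrank_add_finrank m g z) he, mul_pos_iff_of_pos_right h2, ho z]
  · intro o' ho'
    funext z
    have h1 := ho' z (t₀ z) (f₀ z) (e₀ z) (c₀ z) (he₀ z).1 (he₀ z).2 (h₀ z) (hc₀ z)
    rw [← ho z] at h1
    have h2 : (t₀ z).orientation ≠ -(t₀ z).orientation := Module.Ray.ne_neg_self _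
    rcases (t₀ z).orientation_eq_or_eq_neg (o' z) with h3 | h3 <;>
      rcases (t₀ z).orientation_eq_or_eq_neg (o z) with h4 | h4 <;>
      rw [h3, h4] at h1 <;> rw [h3, h4]
    · exact absurd (h1.mp rfl) h2
    · exact absurd (h1.mpr rfl) h2

end InducedOrientation

/-! ### Local triviality of the spaces of fixed vectors -/

section KernelTransport

variable {X : Type*} [TopologicalSpace X] {E : Type*} [NormedAddCommGroup E]
  [InnerProductSpace ℝ E] [FiniteDimensional ℝ E]

/-- If the spaces of fixed vectors of a continuous family of isometries have constant dimension,
then they and their orthogonal complements are locally trivial. -/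
theorem exists_kernel_transport {R : X → E →L[ℝ] E} {L : X → Submodule ℝ E} {U : Set X} {x₀ : X}
    (hU : IsOpen U) (hx₀ : x₀ ∈ U) (hR : ContinuousOn R U)
    (hiso : ∀ x ∈ U, ∀ v w, inner ℝ (R x v) (R x w) = inner ℝ v w)
    (hL : ∀ x ∈ U, ∀ v, v ∈ L x ↔ R x v = v)
    (hrank : ∀ x ∈ U, Module.finrank ℝ (L x) = Module.finrank ℝ (L x₀)) :
    ∃ (U' : Set X) (Ψ : X → E →L[ℝ] E), IsOpen U' ∧ x₀ ∈ U' ∧ U' ⊆ U ∧ ContinuousOn Ψ U' ∧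
      Ψ x₀ = 1 ∧ (∀ x ∈ U', 0 < (Ψ x).det) ∧
      ∀ x ∈ U', (∀ v ∈ L x₀, Ψ x v ∈ L x) ∧
        ∀ v, (∀ w ∈ L x₀, inner ℝ v w = 0) → ∀ w ∈ L x, inner ℝ (Ψ x v) w = 0 := by
  set p : E →L[ℝ] E := (L x₀).starProjection with hp
  have hpL : ∀ v ∈ L x₀, p v = v := fun v hv => Submodule.starProjection_eq_self_iff.mpr hv
  have hpmem : ∀ v, p v ∈ L x₀ := fun v => Submodule.starProjection_apply_mem _ v
  have hp0 : ∀ v, (∀ w ∈ L x₀, inner ℝ v w = 0) → p v = 0 := by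
    intro v hv
    rw [hp, Submodule.starProjection_apply_eq_zero_iff, Submodule.mem_orthogonal']
    exact hv
  have horth : ∀ x ∈ U, ∀ v, ∀ w ∈ L x, inner ℝ (v - R x v) w = 0 := by
    intro x hx v w hw
    rw [inner_sub_left]
    nth_rewrite 2 [← (hL x hx w).mp hw]
    rw [hiso x hx, sub_self]
  -- On `L x` this is the projection `p`, so it maps `L x` into `L x₀`. It is invertible at `x₀`,
  -- where `1 - R x₀` takes values orthogonal to `L x₀`, and hence nearby.
  let Θ : X → E →L[ℝ] E := fun x => (1 - p) * (1 - R x) + p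
  have hΘ : ∀ x v, Θ x v = (v - R x v) - p (v - R x v) + p v := fun x v => rfl
  have hΘ₀ : ∀ v, Θ x₀ v = (v - R x₀ v) + p v := by
    intro v
    rw [hΘ, hp0 _ (horth x₀ hx₀ v), sub_zero]
  have hunit₀ : IsUnit (Θ x₀) := by
    have hinj : Function.Injective (Θ x₀ : E →ₗ[ℝ] E) := by
      rw [injective_iff_map_eq_zero]
      intro v hv
      have h1 : (v - R x₀ v) + p v = 0 := (hΘ₀ v).symm.trans hv
      have h2 : p v = 0 := by
        have h3 := congrArg p h1
        rwa [map_add, hp0 _ (horth x₀ hx₀ v), zero_add, map_zero, hpL _ (hpmem v)] at h3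
      rw [h2, add_zero, sub_eq_zero] at h1
      rw [← h2, hpL _ ((hL x₀ hx₀ v).mpr h1.symm)]
    rw [ContinuousLinearMap.isUnit_iff_bijective]
    exact ⟨hinj, LinearMap.injective_iff_surjective.mp hinj⟩
  have hinvl : ∀ x, IsUnit (Θ x) → ∀ v, Ring.inverse (Θ x) (Θ x v) = v := by
    intro x hx v
    exact congrArg (fun f : E →L[ℝ] E => f v) (Ring.inverse_mul_cancel (Θ x) hx)
  have hinvr : ∀ x, IsUnit (Θ x) → ∀ v, Θ x (Ring.inverse (Θ x) v) = v := by
    intro x hx v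
    exact congrArg (fun f : E →L[ℝ] E => f v) (Ring.mul_inverse_cancel (Θ x) hx)
  have hΘc : ContinuousOn Θ U :=
    (continuousOn_const.mul (continuousOn_const.sub hR)).add continuousOn_const
  -- On `L x₀` use the inverse of `Θ x`, which returns to `L x`. On the complement use `1 - R x`,
  -- whose values are always orthogonal to `L x`; the factor with `Θ x₀` makes the result the
  -- identity at `x₀`.
  let Ψ : X → E →L[ℝ] E := fun x =>
    Ring.inverse (Θ x) * p + (1 - R x) * (Ring.inverse (Θ x₀) * (1 - p))
  have hΨ : ∀ x v, Ψ x v = Ring.inverse (Θ x) (p v) +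
      (Ring.inverse (Θ x₀) (v - p v) - R x (Ring.inverse (Θ x₀) (v - p v))) := fun x v => rfl
  have hΨ₀ : Ψ x₀ = 1 := by
    ext1 v
    have h1 : Θ x₀ (p v) = p v := by
      rw [hΘ₀, ((hL x₀ hx₀ _).mp (hpmem v)), sub_self, zero_add, hpL _ (hpmem v)]
    have h2 : Ring.inverse (Θ x₀) (p v) = p v := by
      nth_rewrite 1 [← h1]
      exact hinvl x₀ hunit₀ _
    set y := Ring.inverse (Θ x₀) (v - p v) with hy
    have h3 : (y - R x₀ y) + p y = v - p v := by
      rw [← hΘ₀, hy, hinvr x₀ hunit₀]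
    have h4 : p y = 0 := by
      have h5 := congrArg p h3
      rwa [map_add, hp0 _ (horth x₀ hx₀ y), zero_add, map_sub, hpL _ (hpmem y), hpL _ (hpmem v),
        sub_self] at h5
    rw [hΨ, h2, ← hy]
    rw [h4, add_zero] at h3
    rw [h3]
    simp
  set U₁ := U ∩ Θ ⁻¹' {f | IsUnit f} with hU₁
  have hU₁o : IsOpen U₁ := hΘc.isOpen_inter_preimage hU Units.isOpen
  have hΨc : ContinuousOn Ψ U₁ := by
    refine ContinuousOn.add (ContinuousOn.mul ?_ continuousOn_const)
      ((continuousOn_const.sub (hR.mono Set.inter_subset_left)).mul continuousOn_const)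
    intro x hx
    obtain ⟨a, ha⟩ : IsUnit (Θ x) := hx.2
    have h1 : ContinuousAt Ring.inverse (Θ x) := ha ▸ NormedRing.inverse_continuousAt a
    exact h1.comp_continuousWithinAt ((hΘc x hx.1).mono Set.inter_subset_left)
  have hdet : ContinuousOn (fun x => (Ψ x).det) U₁ :=
    ContinuousLinearMap.continuous_det.comp_continuousOn hΨc
  refine ⟨U₁ ∩ (fun x => (Ψ x).det) ⁻¹' Set.Ioi 0, Ψ, hdet.isOpen_inter_preimage hU₁o isOpen_Ioi,
    ⟨⟨hx₀, hunit₀⟩, ?_⟩, fun x hx => hx.1.1, hΨc.mono Set.inter_subset_left, hΨ₀,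
    fun x hx => hx.2, fun x hx => ⟨fun v hv => ?_, fun v hv w hw => ?_⟩⟩
  · change 0 < (Ψ x₀).det
    rw [hΨ₀]
    change 0 < LinearMap.det (LinearMap.id : E →ₗ[ℝ] E)
    rw [LinearMap.det_id]
    exact one_pos
  · have hxU : x ∈ U := hx.1.1
    have hxu : IsUnit (Θ x) := hx.1.2
    -- Here the constancy of the rank enters: an injective map from `L x` into `L x₀` is onto.
    have h1 : (L x).map (Θ x : E →ₗ[ℝ] E) = L x₀ := by
      refine Submodule.eq_of_le_of_finrank_eq ?_ ?_
      · rintro _ ⟨w, hw, rfl⟩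
        change Θ x w ∈ L x₀
        rw [hΘ, (hL x hxU w).mp hw, sub_self, map_zero, sub_zero, zero_add]
        exact hpmem w
      · rw [← hrank x hxU]
        exact (Submodule.equivMapOfInjective (Θ x : E →ₗ[ℝ] E)
          (Function.LeftInverse.injective (hinvl x hxu)) (L x)).finrank_eq.symm
    obtain ⟨w, hw, hwv⟩ : v ∈ (L x).map (Θ x : E →ₗ[ℝ] E) := h1 ▸ hv
    have hwv' : Θ x w = v := hwv
    rw [hΨ, hpL v hv, sub_self, map_zero, map_zero, sub_zero, add_zero, ← hwv', hinvl x hxu]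
    exact hw
  · rw [hΨ, hp0 v hv, map_zero, zero_add, sub_zero]
    exact horth x hx.1.1 _ w hw

end KernelTransport

/-! ### Transport of bases and continuity of wedge products -/

section BasisTransport

/-- The image of a basis under an isomorphism which maps a subspace into a subspace of the same
dimension. -/
theorem exists_basis_of_mapsTo {V V' : Type*} [AddCommGroup V] [Module ℝ V] [AddCommGroup V']
    [Module ℝ V'] [FiniteDimensional ℝ V'] (T : V →ₗ[ℝ] V') (hTi : Function.Injective T)
    {F : Submodule ℝ V} {F' : Submodule ℝ V'} (hT : ∀ v ∈ F, T v ∈ F')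
    (hd : Module.finrank ℝ F' = Module.finrank ℝ F)
    (b : Module.Basis (Fin (Module.finrank ℝ F)) ℝ F) :
    ∃ b' : Module.Basis (Fin (Module.finrank ℝ F')) ℝ F',
      ∀ i, (b' i : V') = T (b (Fin.cast hd i)) := by
  let f : Fin (Module.finrank ℝ F') → F' := fun i => T.restrict hT (b (Fin.cast hd i))
  have hf : LinearIndependent ℝ f := by
    have h1 := (b.linearIndependent.comp (Fin.cast hd) (Fin.cast_injective hd)).map'
      (T.restrict hT) (LinearMap.ker_eq_bot.mpr fun x y h => Subtype.ext
        (hTi (congrArg Subtype.val h)))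
    exact h1
  rcases Nat.eq_zero_or_pos (Module.finrank ℝ F') with h0 | h0
  · have hsub : Subsingleton F' := Module.finrank_zero_iff.mp h0
    have : IsEmpty (Fin (Module.finrank ℝ F')) := by rw [h0]; infer_instance
    exact ⟨Module.finBasis ℝ F', fun i => this.elim i⟩
  · have : Nonempty (Fin (Module.finrank ℝ F')) := ⟨⟨0, h0⟩⟩
    exact ⟨basisOfLinearIndependentOfCardEqFinrank hf (Fintype.card_fin _), fun i => by
      rw [coe_basisOfLinearIndependentOfCardEqFinrank]; rfl⟩

end BasisTransport

section WedgeContinuity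

theorem continuous_linear_wedge {n : ℕ} (ℓ : ExteriorAlgebra ℝ (Euc n) →ₗ[ℝ] ℝ) (r : ℕ) :
    Continuous fun v : Fin r → Euc n => ℓ (wedge v) := by
  have hfin : Module.Finite ℝ (ExteriorAlgebra ℝ (Euc n)) :=
    Module.Finite.of_basis (Module.finBasis ℝ (Euc n)).ExteriorAlgebra
  let _ : TopologicalSpace (ExteriorAlgebra ℝ (Euc n)) := moduleTopology ℝ _
  have : IsModuleTopology ℝ (ExteriorAlgebra ℝ (Euc n)) := ⟨rfl⟩
  have hadd := IsModuleTopology.toContinuousAdd ℝ (ExteriorAlgebra ℝ (Euc n))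
  have hsmul : ContinuousSMul ℝ (ExteriorAlgebra ℝ (Euc n)) :=
    IsModuleTopology.toContinuousSMul ℝ _
  have hmul := IsModuleTopology.continuous_mul_of_finite ℝ (ExteriorAlgebra ℝ (Euc n))
  have hgrp := IsModuleTopology.topologicalAddGroup ℝ (ExteriorAlgebra ℝ (Euc n))
  have hι : Continuous (ExteriorAlgebra.ι ℝ (M := Euc n)) :=
    LinearMap.continuous_of_finiteDimensional _
  refine (IsModuleTopology.continuous_of_linearMap ℓ).comp ?_
  induction r with
  | zero =>
    change Continuous fun v : Fin 0 → Euc n => ExteriorAlgebra.ιMulti ℝ 0 v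
    simp only [ExteriorAlgebra.ιMulti_zero_apply]
    exact continuous_const
  | succ r ih =>
    change Continuous fun v : Fin (r + 1) → Euc n => ExteriorAlgebra.ιMulti ℝ (r + 1) v
    simp only [ExteriorAlgebra.ιMulti_succ_apply]
    exact hmul.comp ((hι.comp (continuous_apply 0)).prodMk (ih.comp
      (continuous_pi fun i => continuous_apply i.succ)))

end WedgeContinuity

/-! ### Continuous frames from the principal bundle -/

section FrameAt

variable {n : ℕ} {Z : Type u} [TopologicalSpace Z] [ChartedSpace (Euc n) Z]
  [IsManifold (𝓡 n) ∞ Z] {m : Metric n Z} {oZ : ManifoldOrientation n Z}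

theorem SpincStructure.continuous_proj (S : SpincStructure.{u, w} m oZ) : Continuous S.proj :=
  (FiberBundle.continuous_proj (Euc n) (fun z : Z => Tan n z)).comp (S.continuous_frame 0)

/-- Continuity is given for each fixed vector; expanding in the standard basis makes it joint, as a
finite sum in a local trivialization. -/
theorem SpincStructure.continuous_frame_apply (S : SpincStructure.{u, w} m oZ) :
    Continuous fun q : S.P × Euc n =>
      (⟨S.proj q.1, S.frame q.1 q.2⟩ : TangentBundle (𝓡 n) Z) := by
  rw [continuous_iff_continuousAt]
  rintro ⟨q₀, v₀⟩
  rw [FiberBundle.continuousAt_totalSpace (Euc n)]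
  have hproj : Continuous fun q : S.P × Euc n => S.proj q.1 := S.continuous_proj.comp continuous_fst
  refine ⟨hproj.continuousAt, ?_⟩
  set e := trivializationAt (Euc n) (fun z : Z => Tan n z) (S.proj q₀) with he
  have hb : ∀ᶠ q : S.P × Euc n in 𝓝 (q₀, v₀), S.proj q.1 ∈ e.baseSet :=
    hproj.continuousAt.eventually_mem (e.open_baseSet.mem_nhds
      (FiberBundle.mem_baseSet_trivializationAt' (S.proj q₀)))
  have hbasis : ∀ i, ContinuousAt (fun q : S.P × Euc n =>
      (e ⟨S.proj q.1, S.frame q.1 (EuclideanSpace.basisFun (Fin n) ℝ i)⟩).2) (q₀, v₀) := by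
    intro i
    have h1 := ((S.continuous_frame (EuclideanSpace.basisFun (Fin n) ℝ i)).comp
      (continuous_fst (X := S.P) (Y := Euc n))).continuousAt (x := (q₀, v₀))
    exact ((FiberBundle.continuousAt_totalSpace (Euc n) _).mp h1).2
  have hsum : ContinuousAt (fun q : S.P × Euc n => ∑ i, q.2 i •
      (e ⟨S.proj q.1, S.frame q.1 (EuclideanSpace.basisFun (Fin n) ℝ i)⟩).2) (q₀, v₀) := by
    refine tendsto_finsetSum _ fun i _ => ?_
    have h2 : Continuous fun q : S.P × Euc n => q.2 i := by fun_prop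
    exact Filter.Tendsto.smul h2.continuousAt (hbasis i)
  refine hsum.congr ?_
  filter_upwards [hb] with q hq
  have hlin := e.linear ℝ hq
  have h1 : S.frame q.1 q.2 = ∑ i, q.2 i • S.frame q.1 (EuclideanSpace.basisFun (Fin n) ℝ i) := by
    conv_lhs => rw [← (EuclideanSpace.basisFun (Fin n) ℝ).sum_repr q.2, map_sum]
    simp
  rw [h1]
  have h2 := map_sum hlin.mk' (fun i => q.2 i • S.frame q.1 (EuclideanSpace.basisFun (Fin n) ℝ i))
    Finset.univ
  simp only [map_smul] at h2
  exact h2.symm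

/-- The frame given by a point of the principal bundle over `z`. -/
def SpincStructure.frameAt (S : SpincStructure.{u, w} m oZ) (q : S.P) (z : Z) :
    Euc n ≃ₗ[ℝ] Tan n z := S.frame q

variable {S : SpincStructure.{u, w} m oZ}

theorem SpincStructure.frameAt_proj (q : S.P) : S.frameAt q (S.proj q) = S.frame q := rfl

theorem SpincStructure.mk_frameAt {q : S.P} {z : Z} (h : S.proj q = z) (v : Euc n) :
    (⟨z, S.frameAt q z v⟩ : TangentBundle (𝓡 n) Z) = ⟨S.proj q, S.frame q v⟩ := by
  subst h
  rfl

theorem SpincStructure.continuousOn_frameAt {X : Type*} [TopologicalSpace X] {U : Set X}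
    {ι : X → Z} {p : X → S.P} {v : X → Euc n} (hp : ContinuousOn p U) (hv : ContinuousOn v U)
    (h : ∀ x ∈ U, S.proj (p x) = ι x) :
    ContinuousOn (fun x => (⟨ι x, S.frameAt (p x) (ι x) (v x)⟩ : TangentBundle (𝓡 n) Z)) U := by
  refine (S.continuous_frame_apply.comp_continuousOn (hp.prodMk hv)).congr fun x hx => ?_
  exact SpincStructure.mk_frameAt (h x hx) _

/-- In positive dimension the frames respect the orientation, so the sign depends on `ε` alone. In
dimension 0 no such compatibility is imposed, and the sign is locally constant by continuity of the
orientation of `Z`; only this case needs a small `W`. -/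
theorem SpincStructure.exists_orientation_frameAt (S : SpincStructure.{u, w} m oZ)
    (ε : Module.Basis (Fin n) ℝ (Euc n)) (z₀ : Z) : ∃ W : Set Z, IsOpen W ∧ z₀ ∈ W ∧
      ∀ z ∈ W, ∀ z' ∈ W, ∀ q q' : S.P, S.proj q = z → S.proj q' = z' →
        ((ε.map (S.frameAt q z)).orientation = oZ.at' z ↔
          (ε.map (S.frameAt q' z')).orientation = oZ.at' z') := by
  rcases Nat.eq_zero_or_pos n with hn | hn
  · subst hn
    obtain ⟨W, b, hW, hz₀, -, hb⟩ := oZ.continuous' z₀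
    refine ⟨W, hW, hz₀, fun z hz z' hz' q q' _ _ => ?_⟩
    have h1 := (hb z hz).trans (hb z' hz').symm
    rw [Module.Basis.orientation_isEmpty, Module.Basis.orientation_isEmpty] at h1
    rw [Module.Basis.orientation_isEmpty, Module.Basis.orientation_isEmpty]
    exact h1
  · refine ⟨Set.univ, isOpen_univ, Set.mem_univ _, fun z _ z' _ q q' hq hq' => ?_⟩
    have key : ∀ (q : S.P) (z : Z), S.proj q = z →
        ((ε.map (S.frameAt q z)).orientation = oZ.at' z ↔
          ε.orientation = (EuclideanSpace.basisFun (Fin n) ℝ).toBasis.orientation) := by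
      rintro q _ rfl
      rw [SpincStructure.frameAt_proj, Module.Basis.orientation_map, ← S.frame_orientation hn.ne' q]
      exact (Orientation.map (Fin n) (S.frame q)).injective.eq_iff
    rw [key q z hq, key q' z' hq']

variable {G : Type v} [Group G] [TopologicalSpace G] [MulAction G Z]
  {S : EquivariantSpincStructure.{u, v, w} G m oZ}

theorem frameAt_mem_fixedTangent {g : G} {q : S.P} {s : Spinc n}
    (hs : g • q = MulOpposite.op s • q) {z : MulAction.fixedBy Z g} (h : S.proj q = z)
    (v : Euc n) : S.frameAt q (z : Z) v ∈ fixedTangent n g z ↔ rotation s v = v := by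
  obtain ⟨z, hz⟩ := z
  obtain rfl : S.proj q = z := h
  rw [mem_fixedTangent]
  refine Iff.trans ?_ (S.frame q).injective.eq_iff
  rw [← fixedDiff_frame hs hz]
  rfl

theorem frameAt_mem_normalSpace {g : G} {q : S.P} {s : Spinc n}
    (hs : g • q = MulOpposite.op s • q) {z : MulAction.fixedBy Z g} (h : S.proj q = z)
    (v : Euc n) : S.frameAt q (z : Z) v ∈ normalSpace m g z ↔
      ∀ w, rotation s w = w → inner ℝ v w = 0 := by
  have h1 := frameAt_mem_fixedTangent hs h
  obtain ⟨z, hz⟩ := z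
  obtain rfl : S.proj q = z := h
  change (∀ w ∈ fixedTangent n g ⟨S.proj q, hz⟩, m.inner (S.proj q) (S.frame q v) w = 0) ↔ _
  constructor
  · intro h2 w hw
    rw [← S.frame_inner q]
    exact h2 _ ((h1 w).mpr hw)
  · intro h2 w hw
    obtain ⟨w, rfl⟩ := (S.frame q).surjective w
    rw [S.frame_inner q]
    exact h2 w ((h1 w).mp hw)

theorem extCMap_injective {V W : Type*} [AddCommGroup V] [Module ℝ V] [AddCommGroup W]
    [Module ℝ W] (f : V ≃ₗ[ℝ] W) : Function.Injective (extCMap f.toLinearMap) := by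
  refine Function.LeftInverse.injective (g := extCMap f.symm.toLinearMap) fun a => ?_
  induction a using TensorProduct.induction_on with
  | zero => simp
  | add x y hx hy => rw [map_add, map_add, hx, hy]
  | tmul ζ x =>
    have h : ExteriorAlgebra.map f.symm.toLinearMap (ExteriorAlgebra.map f.toLinearMap x) = x := by
      rw [← AlgHom.comp_apply, ExteriorAlgebra.map_comp_map]
      simp
    exact congrArg (fun y => ζ ⊗ₜ[ℝ] y) h

/-- The top-degree part of the symbol in a frame. -/
theorem TopSymbolIs.frame_eq {g : G} {q : S.P} {s : Spinc n}
    (hs : g • q = MulOpposite.op s • q) {z : MulAction.fixedBy Z g} (h : S.proj q = z)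
    {α : Circle}
    {f : Module.Basis (Fin (Module.finrank ℝ (normalSpace m g z))) ℝ (normalSpace m g z)}
    {c : ℝ} (hc : S.TopSymbolIs g z α f c)
    (φ : Fin (Module.finrank ℝ (normalSpace m g z)) → Euc n)
    (hφ : ∀ i, (f i : Tan n (z : Z)) = S.frameAt q (z : Z) (φ i)) :
    (α : ℂ)⁻¹ • symbolPart (stdForm n) (Module.finrank ℝ (normalSpace m g z))
      ((s : (CliffC (stdForm n))ˣ) : CliffC (stdForm n)) = (c : ℂ) ⊗ₜ[ℝ] wedge φ := by
  obtain ⟨z, hz⟩ := z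
  obtain rfl : S.proj q = z := h
  obtain ⟨a, ha, hc⟩ := hc
  rw [(isSpinorAction_iff hs hz a).mp ha, symbolPart_cliffMap] at hc
  apply extCMap_injective (S.frame q)
  rw [map_smul]
  refine hc.trans ?_
  have h1 : wedge (fun i => (f i : Tan n (S.proj q))) =
      ExteriorAlgebra.map (S.frame q).toLinearMap (wedge φ) := by
    rw [extMap_wedge]
    congr 1
    exact funext hφ
  rw [h1]
  rfl

end FrameAt

/-! ### Continuity of the induced orientation -/

section ContinuousOrientation

variable {V : Type*} [AddCommGroup V] [Module ℝ V]

/-- The real part of the extension of a linear form on `Λ(V)` to `Λ(V) ⊗ ℂ`. -/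
def extRe (ℓ : ExteriorAlgebra ℝ V →ₗ[ℝ] ℝ) : ExtC V →ₗ[ℝ] ℝ :=
  TensorProduct.lift (LinearMap.mk₂ ℝ (fun (ζ : ℂ) x => ζ.re * ℓ x)
    (by simp [add_mul]) (by simp [mul_assoc]) (by simp [mul_add])
    (fun c ζ x => by rw [map_smul, smul_eq_mul, smul_eq_mul]; ring))

variable {n : ℕ} {Z : Type u} [TopologicalSpace Z] [ChartedSpace (Euc n) Z]
  [IsManifold (𝓡 n) ∞ Z] {m : Metric n Z} {oZ : ManifoldOrientation n Z}
  {G : Type v} [Group G] [TopologicalSpace G] [MulAction G Z]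
  {S : EquivariantSpincStructure.{u, v, w} G m oZ}

/-- Near every fixed point there are continuous frames of `T Z`, over `Z^g`, which are composed of
frames of the tangent and the normal spaces of `Z^g`. -/
theorem exists_local_splitting (S : EquivariantSpincStructure.{u, v, w} G m oZ) {g : G}
    (hrank : ∀ z₀ : MulAction.fixedBy Z g, ∀ᶠ z in 𝓝 z₀,
      Module.finrank ℝ (fixedTangent n g z) = Module.finrank ℝ (fixedTangent n g z₀))
    (z₀ : MulAction.fixedBy Z g) : ∃ (U : Set (MulAction.fixedBy Z g))
      (p : MulAction.fixedBy Z g → S.P) (s : MulAction.fixedBy Z g → Spinc n)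
      (Ψ : MulAction.fixedBy Z g → Euc n →L[ℝ] Euc n), IsOpen U ∧ z₀ ∈ U ∧
      ContinuousOn p U ∧ ContinuousOn s U ∧ ContinuousOn Ψ U ∧ Ψ z₀ = 1 ∧
      (∀ z ∈ U, S.proj (p z) = z) ∧ (∀ z ∈ U, g • p z = MulOpposite.op (s z) • p z) ∧
      (∀ z ∈ U, 0 < (Ψ z).det) ∧
      (∀ z ∈ U,
        Module.finrank ℝ (fixedTangent n g z) = Module.finrank ℝ (fixedTangent n g z₀)) ∧
      (∀ z ∈ U, ∀ v, S.frameAt (p z₀) (z₀ : Z) v ∈ fixedTangent n g z₀ →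
        S.frameAt (p z) (z : Z) (Ψ z v) ∈ fixedTangent n g z) ∧
      ∀ z ∈ U, ∀ v, S.frameAt (p z₀) (z₀ : Z) v ∈ normalSpace m g z₀ →
        S.frameAt (p z) (z : Z) (Ψ z v) ∈ normalSpace m g z := by
  obtain ⟨U₁, p, s, hU₁, hz₁, hp, hs, hproj, hact⟩ := exists_local_spinor S g z₀
  obtain ⟨U₂, hU₂r, hU₂, hz₂⟩ := mem_nhds_iff.mp (hrank z₀)
  let R : MulAction.fixedBy Z g → Euc n →L[ℝ] Euc n := fun z =>
    LinearMap.toContinuousLinearMap (rotationₗ (s z))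
  let L : MulAction.fixedBy Z g → Submodule ℝ (Euc n) := fun z =>
    (fixedTangent n g z).comap (S.frameAt (p z) (z : Z)).toLinearMap
  have hR : ContinuousOn R (U₁ ∩ U₂) := by
    rw [continuousOn_clm_apply]
    intro v
    exact (continuous_rotation v).comp_continuousOn (hs.mono Set.inter_subset_left)
  have hL : ∀ z ∈ U₁ ∩ U₂, ∀ v, v ∈ L z ↔ R z v = v := fun z hz v =>
    frameAt_mem_fixedTangent (hact z hz.1) (hproj z hz.1) v
  have hLrank : ∀ z, Module.finrank ℝ (L z) = Module.finrank ℝ (fixedTangent n g z) := fun z =>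
    ((S.frameAt (p z) (z : Z)).ofSubmodule' (fixedTangent n g z)).finrank_eq
  obtain ⟨U, Ψ, hU, hz₀, hUU, hΨ, hΨ₀, hdet, hΨL⟩ := exists_kernel_transport (hU₁.inter hU₂)
    ⟨hz₁, hz₂⟩ hR (fun z _ v w => inner_rotation (s z) v w) hL
    (fun z hz => by rw [hLrank, hLrank]; exact hU₂r hz.2)
  have hU1 : U ⊆ U₁ := fun z hz => (hUU hz).1
  refine ⟨U, p, s, Ψ, hU, hz₀, hp.mono hU1, hs.mono hU1, hΨ, hΨ₀, fun z hz => hproj z (hU1 hz),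
    fun z hz => hact z (hU1 hz), hdet, fun z hz => hU₂r (hUU hz).2,
    fun z hz v hv => (hΨL z hz).1 v hv, fun z hz v hv => ?_⟩
  rw [frameAt_mem_normalSpace (hact z₀ hz₁) (hproj z₀ hz₁)] at hv
  rw [frameAt_mem_normalSpace (hact z (hU1 hz)) (hproj z (hU1 hz))]
  intro w hw
  exact (hΨL z hz).2 v (fun w' hw' => hv w' ((hL z₀ ⟨hz₁, hz₂⟩ w').mp hw')) w
    ((hL z (hUU hz) w).mpr hw)

/-- Bases of the tangent and normal spaces at `z₀` are carried along by the local splitting. The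
coefficient of the top symbol in the carried normal basis stays positive near `z₀`, so the sign of
the tangent basis is that of the composed basis in `TZ`, which is locally constant. -/
theorem isContinuousOrientation_of_isInducedOrientation {g : G}
    (hrank : ∀ z₀ : MulAction.fixedBy Z g, ∀ᶠ z in 𝓝 z₀,
      Module.finrank ℝ (fixedTangent n g z) = Module.finrank ℝ (fixedTangent n g z₀))
    {α : MulAction.fixedBy Z g → Circle} (hα : IsLocallyConstant α)
    (hph : ∀ z, S.IsPhase g z (α z))
    {o : ∀ z : MulAction.fixedBy Z g,
      Orientation ℝ (fixedTangent n g z) (Fin (Module.finrank ℝ (fixedTangent n g z)))}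
    (ho : S.IsInducedOrientation g α o) : IsContinuousOrientation (fixedTangent n g) o := by
  intro z₀
  obtain ⟨U, p, s, Ψ, hU, hz₀, hp, hs, hΨ, hΨ₀, hproj, hact, hdet, hrk, hΨF, hΨN⟩ :=
    exists_local_splitting S hrank z₀
  have hcompl : IsCompl (fixedTangent n g z₀) (normalSpace m g z₀) :=
    (isNormal_normalSpace m g z₀).isCompl (m.bilin_comm _) (m.bilin_pos _)
  obtain ⟨f₀, c₀, hc₀, hw₀, hsymb₀⟩ := IsPhase.exists_topSymbolIs (hph z₀)
  let t₀ := Module.finBasis ℝ (fixedTangent n g z₀)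
  let e₀ : Module.Basis (Fin n) ℝ (Tan n (z₀ : Z)) :=
    sumBasis hcompl (finrank_add_finrank m g z₀) t₀ f₀
  have he₀ : IsSumBasis t₀ f₀ e₀ :=
    isSumBasis_sumBasis hcompl (finrank_add_finrank m g z₀) t₀ f₀
  let φ₀ := S.frameAt (p z₀) (z₀ : Z)
  let ε : Module.Basis (Fin n) ℝ (Euc n) := e₀.map φ₀.symm
  obtain ⟨W, hW, hz₀W, hor⟩ := S.toSpincStructure.exists_orientation_frameAt ε (z₀ : Z)
  -- the isomorphisms of tangent spaces which define the frames
  have hdet0 : ∀ z ∈ U, (Ψ z).det ≠ 0 := fun z hz => (hdet z hz).ne'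
  let T : ∀ z : MulAction.fixedBy Z g, Tan n (z₀ : Z) →ₗ[ℝ] Tan n (z : Z) := fun z =>
    (S.frameAt (p z) (z : Z)).toLinearMap ∘ₗ (Ψ z).toLinearMap ∘ₗ φ₀.symm.toLinearMap
  have hTapp : ∀ z v, T z v = S.frameAt (p z) (z : Z) (Ψ z (φ₀.symm v)) := fun z v => rfl
  have hΨinj : ∀ z ∈ U, Function.Injective (Ψ z) := fun z hz =>
    ((Ψ z).toContinuousLinearEquivOfDetNeZero (hdet0 z hz)).injective
  have hTinj : ∀ z ∈ U, Function.Injective (T z) := fun z hz =>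
    (S.frameAt (p z) (z : Z)).injective.comp ((hΨinj z hz).comp φ₀.symm.injective)
  have hTF : ∀ z ∈ U, ∀ v ∈ fixedTangent n g z₀, T z v ∈ fixedTangent n g z := fun z hz v hv =>
    hΨF z hz _ ((φ₀.apply_symm_apply v).symm ▸ hv)
  have hTN : ∀ z ∈ U, ∀ v ∈ normalSpace m g z₀, T z v ∈ normalSpace m g z := fun z hz v hv =>
    hΨN z hz _ ((φ₀.apply_symm_apply v).symm ▸ hv)
  have hrkN : ∀ z ∈ U, Module.finrank ℝ (normalSpace m g z) =
      Module.finrank ℝ (normalSpace m g z₀) := by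
    intro z hz
    have h1 := finrank_add_finrank m g z
    have h2 := finrank_add_finrank m g z₀
    have h3 := hrk z hz
    omega
  -- positivity of the top-degree part
  let y : Fin (Module.finrank ℝ (normalSpace m g z₀)) → Euc n := fun i => φ₀.symm (f₀ i)
  have hwy : wedge y ≠ 0 := by
    intro h0
    apply hw₀
    have h1 : wedge (fun i => (f₀ i : Tan n (z₀ : Z))) =
        ExteriorAlgebra.map φ₀.toLinearMap (wedge y) := by
      rw [extMap_wedge]
      congr 1
      funext i
      exact (φ₀.apply_symm_apply _).symm
    rw [h1, h0, map_zero]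
  -- A linear form that detects the top symbol at `z₀` turns the comparison of wedges into one of
  -- continuous real functions.
  obtain ⟨ℓ, hℓ⟩ : ∃ ℓ : ExteriorAlgebra ℝ (Euc n) →ₗ[ℝ] ℝ, ℓ (wedge y) = 1 := by
    exact Module.Projective.exists_dual_eq_one ℝ hwy
  let Φ : CliffC (stdForm n) →ₗ[ℝ] ℝ := extRe ℓ ∘ₗ (((α z₀ : ℂ)⁻¹ • symbolPart (stdForm n)
    (Module.finrank ℝ (normalSpace m g z₀))).restrictScalars ℝ)
  let F : MulAction.fixedBy Z g → ℝ := fun z =>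
    Φ ((s z : (CliffC (stdForm n))ˣ) : CliffC (stdForm n))
  have hF : ContinuousAt F z₀ := (continuous_spinc_apply Φ).continuousAt.comp
    (hs.continuousAt (hU.mem_nhds hz₀))
  let D : MulAction.fixedBy Z g → ℝ := fun z => ℓ (wedge fun i => Ψ z (y i))
  have hD : ContinuousAt D z₀ := by
    refine (continuous_linear_wedge ℓ _).continuousAt.comp
      (f := fun z => fun i => Ψ z (y i)) (continuousAt_pi.mpr fun i => ?_)
    exact (hΨ.continuousAt (hU.mem_nhds hz₀)).clm_apply continuousAt_const
  have hD₀ : D z₀ = 1 := by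
    simp only [D, hΨ₀]
    exact hℓ
  -- `F` evaluates the top symbol and `D` the wedge of the carried normal basis, both in the frame
  -- at `z`. Both are continuous and positive at `z₀`, so their quotient `c` is positive nearby.
  have hFD : ∀ z ∈ U, α z = α z₀ → ∀ (f : Module.Basis (Fin (Module.finrank ℝ
      (normalSpace m g z))) ℝ (normalSpace m g z)) (hr : Module.finrank ℝ (normalSpace m g z) =
        Module.finrank ℝ (normalSpace m g z₀)) (c : ℝ),
      (∀ i, (f i : Tan n (z : Z)) = T z (f₀ (Fin.cast hr i))) →
      S.TopSymbolIs g z (α z) f c → F z = c * D z := by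
    intro z hz hαz f hr c hf hc
    have h1 := TopSymbolIs.frame_eq (hact z hz) (hproj z hz) hc
      (fun i => Ψ z (y (Fin.cast hr i))) hf
    rw [wedge_cast hr (fun i => Ψ z (y i)), hr, hαz] at h1
    exact congrArg (extRe ℓ) h1
  have hF₀ : 0 < F z₀ := by
    rw [hFD z₀ hz₀ rfl f₀ rfl c₀ (fun i => ?_) hsymb₀, hD₀, mul_one]
    · exact hc₀
    · rw [hTapp, hΨ₀]
      exact (φ₀.apply_symm_apply _).symm
  have hgood : ∀ᶠ z in 𝓝 z₀, z ∈ U ∧ (z : Z) ∈ W ∧ 0 < F z ∧ 0 < D z ∧ α z = α z₀ := by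
    filter_upwards [hU.mem_nhds hz₀, continuous_subtype_val.continuousAt.eventually_mem
      (hW.mem_nhds hz₀W), hF.eventually_const_lt hF₀,
      hD.eventually_const_lt (by rw [hD₀]; exact one_pos), hα.eventually_eq z₀]
      with z h1 h2 h3 h4 h5
    exact ⟨h1, h2, h3, h4, h5⟩
  obtain ⟨U', hU'good, hU', hz₀'⟩ := mem_nhds_iff.mp hgood
  have hframe : ∀ z, ∃ b : Module.Basis (Fin (Module.finrank ℝ (fixedTangent n g z))) ℝ
      (fixedTangent n g z), z ∈ U' →
      (∀ (i : Fin (Module.finrank ℝ (fixedTangent n g z)))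
        (h : (i : ℕ) < Module.finrank ℝ (fixedTangent n g z₀)),
        (b i : Tan n (z : Z)) = T z (t₀ ⟨i, h⟩)) ∧
      (b.orientation = o z ↔
        (ε.map (S.frameAt (p z) (z : Z))).orientation = oZ.at' (z : Z)) := by
    intro z
    by_cases hz' : z ∈ U'
    swap
    · exact ⟨Module.finBasis ℝ _, fun h => absurd h hz'⟩
    obtain ⟨hz, hzW, hFz, hDz, hαz⟩ := hU'good hz'
    obtain ⟨t, ht⟩ := exists_basis_of_mapsTo (T z) (hTinj z hz) (hTF z hz) (hrk z hz) t₀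
    obtain ⟨f, hf⟩ := exists_basis_of_mapsTo (T z) (hTinj z hz) (hTN z hz) (hrkN z hz) f₀
    obtain ⟨c, hc, hsymb⟩ := exists_topSymbolIs (hph z) f
    have hcpos : 0 < c := by
      have h1 := hFD z hz hαz f (hrkN z hz) c hf hsymb
      rw [h1] at hFz
      exact (pos_iff_pos_of_mul_pos hFz).mpr hDz
    let Ψe : Euc n ≃ₗ[ℝ] Euc n :=
      ((Ψ z).toContinuousLinearEquivOfDetNeZero (hdet0 z hz)).toLinearEquiv
    let e : Module.Basis (Fin n) ℝ (Tan n (z : Z)) :=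
      (ε.map Ψe).map (S.frameAt (p z) (z : Z))
    have he : ∀ j, e j = T z (e₀ j) := fun j => rfl
    have h1 := ho z t f e c (fun j i hj => by
        have h2 : (j : ℕ) = (Fin.cast (hrk z hz) i : ℕ) := hj
        rw [he, ht, he₀.1 j _ h2])
      (fun j i hj => by
        have h2 : (j : ℕ) = Module.finrank ℝ (fixedTangent n g z₀) +
          (Fin.cast (hrkN z hz) i : ℕ) := by rw [hj, hrk z hz]; rfl
        rw [he, hf, he₀.2 j _ h2]) hsymb hcpos
    refine ⟨t, fun _ => ⟨fun i h => ht i, ?_⟩⟩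
    rw [h1]
    -- The transport has positive determinant, so it can be dropped from the sign, which then
    -- involves only the frames of the principal bundle.
    have h3 : (ε.map Ψe).orientation = ε.orientation :=
      (ε.orientation_comp_linearEquiv_eq_iff_det_pos Ψe).mpr (hdet z hz)
    rw [Module.Basis.orientation_map, h3, ← Module.Basis.orientation_map]
  choose b hb using hframe
  -- The index type of a basis varies with the point, so the fields are indexed by natural numbers,
  -- with the value `0` from the rank on.
  let X : ℕ → ∀ z : MulAction.fixedBy Z g, Tan n (z : Z) := fun i z =>
    if h : i < Module.finrank ℝ (fixedTangent n g z₀) then T z (t₀ ⟨i, h⟩) else 0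
  refine ⟨U', X, b, hU', hz₀', fun z hz => hrk z (hU'good hz).1, fun z hz i => ?_, fun i hi => ?_,
    fun z hz => ?_⟩
  · have h : (i : ℕ) < Module.finrank ℝ (fixedTangent n g z₀) := by
      rw [← hrk z (hU'good hz).1]
      exact i.2
    rw [(hb z hz).1 i h]
    simp only [X, dif_pos h]
  · simp only [X, dif_pos hi]
    have h1 : ContinuousOn (fun z => Ψ z (φ₀.symm (t₀ ⟨i, hi⟩))) U' :=
      (hΨ.mono fun z hz => (hU'good hz).1).clm_apply continuousOn_const
    exact SpincStructure.continuousOn_frameAt (S := S.toSpincStructure)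
      (ι := fun z : MulAction.fixedBy Z g => (z : Z)) (hp.mono fun z hz => (hU'good hz).1) h1
      fun z hz => hproj z (hU'good hz).1
  · rw [(hb z hz).2, (hb z₀ hz₀').2]
    exact hor z (hU'good hz).2.1 z₀ hz₀W (p z) (p z₀) (hproj z (hU'good hz).1) (hproj z₀ hz₀)

end ContinuousOrientation

end SpincFixed

end

open SpincFixed in
theorem proposition1p1 {n d : ℕ} {Z : Type u} [TopologicalSpace Z] [T2Space Z] [CompactSpace Z]
    [ChartedSpace (EuclideanSpace ℝ (Fin n)) Z] [IsManifold (𝓡 n) ∞ Z]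
    {G : Type v} [TopologicalSpace G] [T2Space G] [CompactSpace G]
    [ChartedSpace (EuclideanSpace ℝ (Fin d)) G] [Group G] [LieGroup (𝓡 d) ∞ G]
    [MulAction G Z] [ContMDiffSMul (𝓡 d) (𝓡 n) ∞ G Z]
    (m : Metric n Z) (oZ : ManifoldOrientation n Z)
    (S : EquivariantSpincStructure.{u, v, w} G m oZ) (g : G) :
    -- `Z^g` is a submanifold
    IsFixedSubmanifold n Z g ∧
    -- the spinor action of `g` at a fixed point is a well-defined element of `C(T_z Z)`
    (∀ z : MulAction.fixedBy Z g, ∃! a, S.IsSpinorAction g z a) ∧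
    -- its phase is unique, except for the sign where `dg` has the eigenvalue `-1`
    (∀ (z : MulAction.fixedBy Z g) (α : Circle), S.IsPhase g z α → ∀ β : Circle,
      S.IsPhase g z β ↔ β = α ∨
        ((β : ℂ) = -(α : ℂ) ∧ (fixedDiff (n := n) g z).HasEigenvalue (-1))) ∧
    -- there is exactly one locally constant phase, once that sign is normalized
    (∃! α : MulAction.fixedBy Z g → Circle, IsLocallyConstant α ∧ ∀ z, S.IsPhase g z (α z) ∧
      ((fixedDiff (n := n) g z).HasEigenvalue (-1) →
        0 ≤ Complex.arg (α z) ∧ Complex.arg (α z) < Real.pi)) ∧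
    -- the top-degree part of the symbol is then a real non-zero section, and orients `Z^g`
    (∀ α : MulAction.fixedBy Z g → Circle, IsLocallyConstant α → (∀ z, S.IsPhase g z (α z)) →
      (∀ z f, ∃ c : ℝ, c ≠ 0 ∧ S.TopSymbolIs g z (α z) f c) ∧
      ∃! o : ∀ z : MulAction.fixedBy Z g,
          Orientation ℝ (fixedTangent n g z) (Fin (Module.finrank ℝ (fixedTangent n g z))),
        IsContinuousOrientation (fixedTangent n g) o ∧ S.IsInducedOrientation g α o) := by
  have hsub : ∀ h : G, IsFixedSubmanifold n Z h := fun h =>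
    isFixedSubmanifold_of_isometry (d := d) m h (bilin_fixedDiff S)
  have hsmooth : ∀ h : G, ContMDiff (𝓡 n) (𝓡 n) ∞ fun y : Z => h • y := fun h =>
    ContMDiffSMul.contMDiff_const_smul (I := 𝓡 d) h
  have : ContinuousSMul G Z :=
    ContMDiffSMul.continuousSMul (I := 𝓡 d) (I' := 𝓡 n) (G := G) (M := Z) ∞
  refine ⟨hsub g, existsUnique_isSpinorAction S g, fun z α h β => isPhase_iff_of_isPhase h β,
    existsUnique_phase S g fun z₀ => eventually_hasEigenvalue_neg_one (hsmooth g)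
      (hsmooth (g ^ 2)) (hsub g) (hsub (g ^ 2)) z₀,
    fun α hα hph => ⟨fun z f => exists_topSymbolIs (hph z) f, ?_⟩⟩
  -- The splitting of `TZ` alone determines the orientation; continuity is then a property of it and
  -- plays no part in uniqueness.
  obtain ⟨o, ho, huniq⟩ := existsUnique_isInducedOrientation hph
  exact ⟨o, ⟨isContinuousOrientation_of_isInducedOrientation
    (fun z₀ => (hsub g).eventually_finrank z₀) hα hph ho, ho⟩, fun o' h => huniq o' h.2⟩
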